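/- Let $n\ge 2$. Let $\mathbf{Ein}^{1,n-1}$ be the space of isotropic lines of $\mathbf R^{2,n}$ with its natural conformal Lorentzian structure. For $x\in\mathbf{Ein}^{1,n-1}$ let $C(x)$, the lightcone of $x$, be the set of isotropic lines orthogonal to $x$. The complement of any lightcone is conformally identified with Minkowski space $\mathbf R^{1,n-1}$ by stereographic projection (an affine chart; all of them are obtained from one by linear isometries of $\mathbf R^{2,n}$). A domain (nonempty connected open subset) $\Omega\subset\mathbf{Ein}^{1,n-1}$ is *proper* if $\overline\Omega\cap C(x)=\emptyset$ for some $x$; *causally convex* if it is contained in some affine chart $\mathbf R^{1,n-1}$ in such a way that every causal curve of $\mathbf R^{1,n-1}$ joining two points of $\Omega$ lies in $\Omega$; *dually convex* if for every $a\in\partial\Omega$ there is $b\in\mathbf{Ein}^{1,n-1}$ with $a\in C(b)$ and $C(b)\cap\Omega=\emptyset$. A conformal spacetime is *globally hyperbolic* if it has a Cauchy hypersurface, i.e. an acausal hypersurface that every inextensible causal curve meets exactly once; it is *maximal* if every one-to-one conformal map from it to a globally hyperbolic spacetime (of the same dimension) that sends a Cauchy hypersurface to a Cauchy hypersurface is onto.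 **Proposition.** Let $\Omega\subset\mathbf{Ein}^{1,n-1}$ be a proper causally convex domain. There is an affine chart $\mathbf R^{1,n-1}$ containing $\overline\Omega$. In any such chart, with any splitting $\mathbf R^{1,n-1}=H\oplus H^\perp$, $H$ a spacelike hyperplane, and with $V\subset H$ the orthogonal projection of $\Omega$, there are $1$-Lipschitz functions $f_-,f_+:\overline V\to H^\perp\simeq\mathbf R$, coinciding on $\partial V$, such that $$\Omega=\{(x,t)\in V\times H^\perp \mid f_-(x)<t<f_+(x)\}.$$ Let $\Lambda\subset\mathbf R^{1,n-1}$ be the graph of $f:=f_\pm|_{\partial V}$ and $C(\Lambda)=\bigcup_{q\in\Lambda}C(q)$. Then the following are equivalent: 1. $\Omega$ is dually convex; 2. $\Omega$, with the conformal structure induced by $\mathbf R^{1,n-1}$, is a maximal globally hyperbolic spacetime; 3. $\Omega$ is a connected component of $\mathbf R^{1,n-1}\smallsetminus C(\Lambda)$. -/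

import Mathlib

open scoped Manifold ContDiff Topology LinearAlgebra.Projectivization
open Set Filter Bundle

noncomputable section

-- Without this line, instance search finds the manifold structure of a model vector space through
-- this (definitionally equal) detour.
attribute [-instance] TopCat.of.chartedSpace

/-! ### Minkowski space and Lorentzian manifolds

Throughout, `n = d + 1` is the dimension of the spacetimes. -/

/-- The vector space `ℝ^{1,d}`, written as `H^⊥ ⊕ H` with `H^⊥ = ℝ` the time axis and
`H = ℝ^d` a Euclidean (spacelike) hyperplane. A point is a pair `(t, x)`. -/
abbrev Mink (d : ℕ) : Type := ℝ × EuclideanSpace ℝ (Fin d)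

/-- The Minkowski form `b((t,x),(s,y)) = -ts + ⟨x,y⟩` of signature `(1,d)`. -/
def minkForm (d : ℕ) : Mink d →L[ℝ] Mink d →L[ℝ] ℝ :=
  (innerSL ℝ (E := EuclideanSpace ℝ (Fin d))).bilinearComp
      (ContinuousLinearMap.snd ℝ ℝ _) (ContinuousLinearMap.snd ℝ ℝ _)
    - (ContinuousLinearMap.mul ℝ ℝ).bilinearComp
      (ContinuousLinearMap.fst ℝ ℝ _) (ContinuousLinearMap.fst ℝ ℝ _)

theorem minkForm_apply {d : ℕ} (v w : Mink d) :
    minkForm d v w = -(v.1 * w.1) + inner ℝ v.2 w.2 := by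
  simp [minkForm]; ring

theorem minkForm_symm {d : ℕ} (v w : Mink d) : minkForm d v w = minkForm d w v := by
  rw [minkForm_apply, minkForm_apply, real_inner_comm, mul_comm]

/-- A smooth Lorentzian metric (signature `(1,d)`) on a smooth manifold of dimension `d + 1`.
A conformal class is always given by one of its representatives; all notions below depend only on
the conformal class. -/
structure LorentzMetric (d : ℕ) (N : Type) [TopologicalSpace N] [ChartedSpace (Mink d) N]
    [IsManifold 𝓘(ℝ, Mink d) ∞ N] where
  form (x : N) : TangentSpace 𝓘(ℝ, Mink d) x →L[ℝ] TangentSpace 𝓘(ℝ, Mink d) x →L[ℝ] ℝ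
  symm (x : N) (v w : TangentSpace 𝓘(ℝ, Mink d) x) : form x v w = form x w v
  signature (x : N) : ∃ e : Mink d ≃ₗ[ℝ] TangentSpace 𝓘(ℝ, Mink d) x,
    ∀ v w : Mink d, form x (e v) (e w) = minkForm d v w
  contMDiff : ContMDiff 𝓘(ℝ, Mink d)
    (𝓘(ℝ, Mink d).prod 𝓘(ℝ, Mink d →L[ℝ] Mink d →L[ℝ] ℝ)) ∞
    (fun x ↦ TotalSpace.mk' (Mink d →L[ℝ] Mink d →L[ℝ] ℝ) x (form x))

/-- A constant bilinear form on a normed space is smooth as a section over the tangent bundle. -/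
theorem contMDiff_constForm {F : Type*} [NormedAddCommGroup F] [NormedSpace ℝ F]
    (c : F →L[ℝ] F →L[ℝ] ℝ) :
    ContMDiff 𝓘(ℝ, F) (𝓘(ℝ, F).prod 𝓘(ℝ, F →L[ℝ] F →L[ℝ] ℝ)) ∞
      (fun x : F ↦ TotalSpace.mk' (F →L[ℝ] F →L[ℝ] ℝ) x
        (show TangentSpace 𝓘(ℝ, F) x →L[ℝ] TangentSpace 𝓘(ℝ, F) x →L[ℝ] ℝ from c)) := by
  intro x
  refine (contMDiffAt_section (E := fun x : F ↦ TangentSpace 𝓘(ℝ, F) x →L[ℝ]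
    TangentSpace 𝓘(ℝ, F) x →L[ℝ] ℝ)
    (s := fun x ↦ (show TangentSpace 𝓘(ℝ, F) x →L[ℝ] TangentSpace 𝓘(ℝ, F) x →L[ℝ] ℝ from c)) x).2 ?_
  have : (fun y : F ↦ (trivializationAt (F →L[ℝ] F →L[ℝ] ℝ) (fun x : F ↦
      TangentSpace 𝓘(ℝ, F) x →L[ℝ] TangentSpace 𝓘(ℝ, F) x →L[ℝ] ℝ) x ⟨y,
        (show TangentSpace 𝓘(ℝ, F) y →L[ℝ] TangentSpace 𝓘(ℝ, F) y →L[ℝ] ℝ from c)⟩).2) =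
      fun _ ↦ c := by
    ext y v w
    rw [hom_trivializationAt_apply]
    simp only [ContinuousLinearMap.inCoordinates, ContinuousLinearMap.comp_apply]
    have hb : y ∈ (trivializationAt (F →L[ℝ] ℝ)
        (fun x : F ↦ TangentSpace 𝓘(ℝ, F) x →L[ℝ] ℝ) x).baseSet := by
      rw [hom_trivializationAt_baseSet]
      simp [chartAt_self_eq]
    have h1 : ∀ L : TangentSpace 𝓘(ℝ, F) y →L[ℝ] ℝ, Trivialization.continuousLinearMapAt ℝ
        (trivializationAt (F →L[ℝ] ℝ) (fun x : F ↦ TangentSpace 𝓘(ℝ, F) x →L[ℝ] ℝ) x) y L =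
        (show F →L[ℝ] ℝ from L) := by
      intro L
      rw [Trivialization.continuousLinearMapAt_apply, Trivialization.coe_linearMapAt_of_mem _ hb]
      change ContinuousLinearMap.inCoordinates F (TangentSpace 𝓘(ℝ, F)) ℝ (Bundle.Trivial F ℝ)
        x y x y L = _
      ext u
      simp only [ContinuousLinearMap.inCoordinates, ContinuousLinearMap.comp_apply,
        TangentBundle.symmL_model_space]
      simp
      rfl
    rw [h1, TangentBundle.symmL_model_space]
    rfl
  rw [this]
  exact contMDiffAt_const

/-- The flat metric of Minkowski space. -/
def minkowski (d : ℕ) : LorentzMetric d (Mink d) where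
  form _ := minkForm d
  symm _ v w := minkForm_symm v w
  signature x := ⟨LinearEquiv.refl ℝ (Mink d), fun _ _ ↦ rfl⟩
  contMDiff := contMDiff_constForm (minkForm d)

section Causality

variable {d : ℕ} {M : Type} [TopologicalSpace M] [ChartedSpace (Mink d) M]
  [IsManifold 𝓘(ℝ, Mink d) ∞ M]
  {N : Type} [TopologicalSpace N] [ChartedSpace (Mink d) N] [IsManifold 𝓘(ℝ, Mink d) ∞ N]

/-! An open subset `U` of a Lorentzian manifold `(M, g)` is regarded as a spacetime in its own
right, with the restriction of `g`; the whole manifold is the case `U = univ`. -/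

/-- `U` is a spacetime: open, connected, and time-orientable (it carries a continuous timelike
vector field). -/
def IsSpacetime (g : LorentzMetric d M) (U : Set M) : Prop :=
  IsOpen U ∧ IsConnected U ∧
    ∃ X : ∀ x : M, TangentSpace 𝓘(ℝ, Mink d) x,
      ContinuousOn (fun x ↦ (⟨x, X x⟩ : TangentBundle 𝓘(ℝ, Mink d) M)) U ∧
      ∀ x ∈ U, g.form x (X x) (X x) < 0

/-- A causal curve defined on the interval `I`: a `C¹` curve whose velocity is everywhere a nonzero
causal vector. By continuity the velocity stays in one of the two halves of the causal cone, so that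
the curve is either future or past directed. -/
def IsCausalCurve (g : LorentzMetric d M) (γ : ℝ → M) (I : Set ℝ) : Prop :=
  ContMDiffOn 𝓘(ℝ, ℝ) 𝓘(ℝ, Mink d) 1 γ I ∧
    ∀ t ∈ I, mfderivWithin 𝓘(ℝ, ℝ) 𝓘(ℝ, Mink d) γ I t (1 : ℝ) ≠ 0 ∧
      g.form (γ t) (mfderivWithin 𝓘(ℝ, ℝ) 𝓘(ℝ, Mink d) γ I t (1 : ℝ))
        (mfderivWithin 𝓘(ℝ, ℝ) 𝓘(ℝ, Mink d) γ I t (1 : ℝ)) ≤ 0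

/-- Every causal curve of `M` joining two points of `U` lies in `U`. -/
def IsCausallyConvexIn (g : LorentzMetric d M) (U : Set M) : Prop :=
  ∀ γ : ℝ → M, IsCausalCurve g γ (Icc 0 1) → γ 0 ∈ U → γ 1 ∈ U → ∀ t ∈ Icc (0 : ℝ) 1, γ t ∈ U

/-- The curve `γ : I → U` has no endpoint in `U`, neither in the future nor in the past. (If `I`
contains its supremum, the filter `atTop` of `I` is concentrated at it, so that such a curve has an
endpoint.) -/
def IsInextensibleIn (U : Set M) (γ : ℝ → M) (I : Set ℝ) : Prop :=
  ∀ p ∈ U, ¬ Tendsto (fun t : I ↦ γ t) atTop (𝓝 p) ∧ ¬ Tendsto (fun t : I ↦ γ t) atBot (𝓝 p)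

/-- `S` is an embedded topological hypersurface: it is locally a coordinate hyperplane in some
topological chart. -/
def IsTopologicalHypersurface (d : ℕ) {M : Type} [TopologicalSpace M] (S : Set M) : Prop :=
  ∀ p ∈ S, ∃ φ : OpenPartialHomeomorph M (Mink d), p ∈ φ.source ∧
    ∀ x ∈ φ.source, x ∈ S ↔ (φ x).1 = 0

/-- `S` is a Cauchy hypersurface of the spacetime `U`: an acausal hypersurface of `U` that every
inextensible causal curve of `U` meets exactly once. -/
def IsCauchyHypersurface (g : LorentzMetric d M) (U S : Set M) : Prop :=
  S ⊆ U ∧ IsTopologicalHypersurface d S ∧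
    (∀ γ : ℝ → M, IsCausalCurve g γ (Icc 0 1) → MapsTo γ (Icc 0 1) U → γ 0 ∈ S → γ 1 ∉ S) ∧
    ∀ (I : Set ℝ) (γ : ℝ → M), I.OrdConnected → IsCausalCurve g γ I → MapsTo γ I U →
      IsInextensibleIn U γ I → ∃! t, t ∈ I ∧ γ t ∈ S

/-- `U` is a globally hyperbolic spacetime. -/
def IsGloballyHyperbolic (g : LorentzMetric d M) (U : Set M) : Prop :=
  IsSpacetime g U ∧ ∃ S, IsCauchyHypersurface g U S

/-- `f : U → N` is smooth and conformal: `f^* g_N = e^u g_M` on `U` with `u` smooth. -/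
def IsConformalOn (gM : LorentzMetric d M) (gN : LorentzMetric d N) (U : Set M) (f : M → N) :
    Prop :=
  ContMDiffOn 𝓘(ℝ, Mink d) 𝓘(ℝ, Mink d) ∞ f U ∧
    ∃ u : M → ℝ, ContMDiffOn 𝓘(ℝ, Mink d) 𝓘(ℝ, ℝ) ∞ u U ∧
      ∀ x ∈ U, ∀ v w : TangentSpace 𝓘(ℝ, Mink d) x,
        gN.form (f x) (mfderiv 𝓘(ℝ, Mink d) 𝓘(ℝ, Mink d) f x v)
          (mfderiv 𝓘(ℝ, Mink d) 𝓘(ℝ, Mink d) f x w) = Real.exp (u x) * gM.form x v w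

/-- `f` is a Cauchy embedding of `U` into `W`: a one-to-one conformal map that sends a Cauchy
hypersurface of `U` to a Cauchy hypersurface of `W`. -/
def IsCauchyEmbedding (gM : LorentzMetric d M) (U : Set M) (gN : LorentzMetric d N) (W : Set N)
    (f : M → N) : Prop :=
  MapsTo f U W ∧ InjOn f U ∧ IsConformalOn gM gN U f ∧
    ∃ S, IsCauchyHypersurface gM U S ∧ IsCauchyHypersurface gN W (f '' S)

/-- `U` is a maximal globally hyperbolic spacetime: it is globally hyperbolic, and every Cauchy
embedding of `U` into a globally hyperbolic spacetime `W` is onto. -/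
def IsGloballyHyperbolicMaximal (gM : LorentzMetric d M) (U : Set M) : Prop :=
  IsGloballyHyperbolic gM U ∧
    ∀ (N : Type) [TopologicalSpace N] [T2Space N] [SecondCountableTopology N]
      [ChartedSpace (Mink d) N] [IsManifold 𝓘(ℝ, Mink d) ∞ N]
      (gN : LorentzMetric d N) (W : Set N), IsGloballyHyperbolic gN W →
      ∀ f : M → N, IsCauchyEmbedding gM U gN W f → SurjOn f U W

end Causality

/-! ### The Einstein universe -/

/-- The vector space `ℝ^{2,d+1}`, written as the orthogonal sum of a hyperbolic plane and
`ℝ^{1,d}`. -/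
abbrev Ambient (d : ℕ) : Type := ℝ × ℝ × Mink d

/-- The form of signature `(2,d+1)` on `ℝ^{2,d+1}` with quadratic form `(a,c,v) ↦ -ac + b(v,v)`. -/
def ambientForm (d : ℕ) : LinearMap.BilinForm ℝ (Ambient d) :=
  LinearMap.mk₂ ℝ
    (fun p q ↦ minkForm d p.2.2 q.2.2 - (p.1 * q.2.1 + p.2.1 * q.1) / 2)
    (by intro p p' q; simp; ring) (by intro c p q; simp; ring)
    (by intro p q q'; simp; ring) (by intro c p q; simp; ring)

theorem ambientForm_apply {d : ℕ} (p q : Ambient d) :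
    ambientForm d p q = minkForm d p.2.2 q.2.2 - (p.1 * q.2.1 + p.2.1 * q.1) / 2 := rfl

/-- The quotient topology on projective space. -/
instance (d : ℕ) : TopologicalSpace (ℙ ℝ (Ambient d)) :=
  TopologicalSpace.coinduced (Projectivization.mk' ℝ) inferInstance

/-- The Einstein universe `Ein^{1,d}`: the space of isotropic lines of `ℝ^{2,d+1}`. -/
def Ein (d : ℕ) : Type :=
  {x : ℙ ℝ (Ambient d) // ambientForm d x.rep x.rep = 0}

instance (d : ℕ) : TopologicalSpace (Ein d) := instTopologicalSpaceSubtype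

theorem ambientForm_rep_mk {d : ℕ} {v w : Ambient d} (hv : v ≠ 0) (hw : w ≠ 0) :
    ambientForm d (Projectivization.mk ℝ v hv).rep (Projectivization.mk ℝ w hw).rep = 0 ↔
      ambientForm d v w = 0 := by
  obtain ⟨a, ha⟩ := Projectivization.exists_smul_eq_mk_rep ℝ v hv
  obtain ⟨b, hb⟩ := Projectivization.exists_smul_eq_mk_rep ℝ w hw
  rw [← ha, ← hb]
  simp [Units.smul_def]

/-- The point of the Einstein universe defined by a nonzero isotropic vector. -/
def Ein.mk {d : ℕ} (v : Ambient d) (hv : v ≠ 0) (h : ambientForm d v v = 0) : Ein d :=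
  ⟨Projectivization.mk ℝ v hv, (ambientForm_rep_mk hv hv).2 h⟩

/-- The lightcone `C(x)`: the isotropic lines contained in `x^⊥`. -/
def lightcone {d : ℕ} (x : Ein d) : Set (Ein d) :=
  {y | ambientForm d x.1.rep y.1.rep = 0}

/-- The linear isometries of `ℝ^{2,d+1}`. -/
structure AmbientIsometry (d : ℕ) extends Ambient d ≃ₗ[ℝ] Ambient d where
  isometry' (p q : Ambient d) :
    ambientForm d (toLinearEquiv p) (toLinearEquiv q) = ambientForm d p q

/-- The section `v ↦ (1, b(v,v), v)` of the isotropic cone underlying the standard stereographic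
projection. -/
def minkLift {d : ℕ} (v : Mink d) : Ambient d := (1, minkForm d v v, v)

theorem minkLift_ne_zero {d : ℕ} (v : Mink d) : minkLift v ≠ 0 := by
  intro h
  have := congrArg Prod.fst h
  simp [minkLift] at this

theorem minkLift_isotropic {d : ℕ} (v : Mink d) :
    ambientForm d (minkLift v) (minkLift v) = 0 := by
  simp [ambientForm_apply, minkLift]

/-- The section `minkLift` is isometric onto its image: the form of `ℝ^{2,d+1}` restricts to the
Minkowski form. Hence the affine charts below are conformal for the natural conformal structure of
the Einstein universe. -/
theorem ambientForm_minkLift_sub {d : ℕ} (v w : Mink d) :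
    ambientForm d (minkLift v - minkLift w) (minkLift v - minkLift w) =
      minkForm d (v - w) (v - w) := by
  simp [ambientForm_apply, minkLift]

/-- The affine charts (inverse stereographic projections) `ℝ^{1,d} → Ein^{1,d}`: the standard one
`v ↦ [1 : b(v,v) : v]`, whose image is the complement of the lightcone of `∞ = [0 : 1 : 0]`,
followed by an element `A` of the isometry group of `ℝ^{2,d+1}`. The image is the complement of the
lightcone of `A ∞`, and the conformal structure of `Ein^{1,d}` is the one for which all these charts
are conformal. -/
def affineChart {d : ℕ} (A : AmbientIsometry d) (v : Mink d) : Ein d :=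
  Ein.mk (A.toLinearEquiv (minkLift v))
    (fun h ↦ minkLift_ne_zero v ((LinearEquiv.map_eq_zero_iff _).1 h))
    (by rw [A.isometry', minkLift_isotropic])

/-- A subset of the Einstein universe is proper if its closure misses some lightcone. -/
def IsProperDomain {d : ℕ} (Ω : Set (Ein d)) : Prop :=
  ∃ x : Ein d, closure Ω ∩ lightcone x = ∅

/-- A subset of the Einstein universe is causally convex if it is contained in some affine chart, as
a causally convex subset of Minkowski space. -/
def IsCausallyConvexDomain {d : ℕ} (Ω : Set (Ein d)) : Prop :=
  ∃ A : AmbientIsometry d, Ω ⊆ range (affineChart A) ∧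
    IsCausallyConvexIn (minkowski d) (affineChart A ⁻¹' Ω)

/-- Every boundary point lies on a lightcone that misses `Ω`. -/
def IsDuallyConvex {d : ℕ} (Ω : Set (Ein d)) : Prop :=
  ∀ a ∈ frontier Ω, ∃ b : Ein d, a ∈ lightcone b ∧ lightcone b ∩ Ω = ∅

/-! ### Boundary data of a causally convex domain -/

/-- The orthogonal projection of `U ⊆ ℝ^{1,d}` to the spacelike hyperplane `H = ℝ^d`. -/
def spaceProj {d : ℕ} (U : Set (Mink d)) : Set (EuclideanSpace ℝ (Fin d)) := Prod.snd '' U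

/-- With `V` the projection of `U` to `H`, the functions `fLow, fUp` are 1-Lipschitz on the closure
of `V`, coincide on `∂V`, and `U = {(t,x) | x ∈ V, fLow x < t < fUp x}`. Their values on the closure
of `V` are determined by `U`. -/
def IsBoundaryData {d : ℕ} (U : Set (Mink d)) (fLow fUp : EuclideanSpace ℝ (Fin d) → ℝ) : Prop :=
  LipschitzOnWith 1 fLow (closure (spaceProj U)) ∧
  LipschitzOnWith 1 fUp (closure (spaceProj U)) ∧
  (∀ x ∈ frontier (spaceProj U), fLow x = fUp x) ∧
  U = {p | p.2 ∈ spaceProj U ∧ fLow p.2 < p.1 ∧ p.1 < fUp p.2}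

/-- The graph over `∂V` of a function `f`. -/
def boundaryGraph {d : ℕ} (U : Set (Mink d)) (f : EuclideanSpace ℝ (Fin d) → ℝ) : Set (Mink d) :=
  {p | p.2 ∈ frontier (spaceProj U) ∧ p.1 = f p.2}

/-- The trace in `ℝ^{1,d}`, seen in `Ein^{1,d}` through the affine chart `A`, of
`C(Λ) = ⋃_{q ∈ Λ} C(q)`. -/
def coneUnion {d : ℕ} (A : AmbientIsometry d) (Λ : Set (Mink d)) : Set (Mink d) :=
  affineChart A ⁻¹' ⋃ q ∈ Λ, lightcone (affineChart A q)

/-- `U` is a connected component of the subspace `F`. -/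
def IsComponentOf {X : Type} [TopologicalSpace X] (U F : Set X) : Prop :=
  ∃ p ∈ F, U = connectedComponentIn F p

end

open scoped Manifold ContDiff Topology LinearAlgebra.Projectivization
open Set Filter Bundle

noncomputable section

attribute [-instance] TopCat.of.chartedSpace
set_option linter.unusedSectionVars false

/-! ### The metric and vector fields in the charts of a manifold -/

section Coord
variable {d : ℕ} {N : Type} [TopologicalSpace N] [ChartedSpace (Mink d) N]
  [IsManifold 𝓘(ℝ, Mink d) ∞ N]

/-! Let `U` be `Ω` read in an affine chart containing its closure. The Einstein universe is compact,
so `U` is bounded. A change of affine chart preserves or reverses the causal order on each diamond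
with ends in the domain (`isOrderConvex_of_transition`), so `U` contains every point lying causally
between two of its points, whichever chart exhibits the causal convexity. The vertical fibres of `U`
are then intervals whose ends are 1-Lipschitz and merge over `∂V` (`exists_boundaryData`).

Each of the three conditions is equivalent to `U = D`, where `D` (`spacelikeRegion`) is the set of
points over `V` that are spacelike to all of `Λ`; the inclusion `U ⊆ D` always holds. `D` is the
component of the complement of the cones that contains `U`
(`IsBoundaryData.connectedComponentIn_eq`). If a lightcone through a boundary point over `V` misses
`Ω`, it contains a null ray which yields a point of `Λ` causally related to the boundary point, so
nothing beyond the graphs is in `D`; conversely, if `U = D`, each boundary point is on the lightcone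
of a point of `Λ` (`IsBoundaryData.isDuallyConvex_iff`).

Maximality implies `U = D`: a strict contraction strictly between the two boundary functions has a
graph that is a Cauchy hypersurface both of `U` and of `D`, so the inclusion of `U` into `D` is a
Cauchy embedding.

Suppose `U = D` and let `f : U → W` be a Cauchy embedding, with Cauchy hypersurface `S`. An
inextensible timelike curve of `W` meets `f(S)` once, while each of its pieces in `f(U)` lifts to an
inextensible curve and meets `f(S)`. So there is one piece, and the inverse of `f` respects
causality (`IsCauchyMap.causalLE_of_chron`). If `f` is not onto, there are `f(c i) → z ∈ W` with `c
i → p ∈ ∂U`. Either `p` is on `Λ`, or `p` is strictly after (or before) points `x j` of `U` that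
tend to some `q ∈ Λ` (`IsBoundaryData.frontier_condition`). As `q` is spacelike to `U`, the `f(x j)`
have no cluster point in `W` (`IsCauchyMap.escapes`); this rules out `p ∈ Λ`. In the other case,
they precede points tending to `z`, and a limit argument gives an inextensible timelike curve all of
whose points lie after infinitely many `f(x j)`. It meets `f(S)` in some `f(u)`, so `x j ≤ u`
infinitely often and `q ≤ u`, which is impossible (`IsCauchyMap.surjOn`).

The limit argument uses no limit curves. Chronology is generated by timelike segments of charts;
chains of them are smoothed to `C¹` curves (`exists_curve_through`), and a point is followed down a
chronological sequence that leaves every neighbourhood in a countable cover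
(`exists_seq_not_tendsto`). That the descent never gets stuck (`exists_descent_of_escape`) rests on
local shifts to the future that preserve chronology (`exists_pushUp`), which replace the missing
closedness of the chronological relation. -/

/-- The tangent vector at `φ⁻¹ x` with coordinates `v` in the chart `φ` centred at `c`. -/
def tv (c : N) (x : Mink d) :
    Mink d →L[ℝ] TangentSpace 𝓘(ℝ, Mink d) ((extChartAt 𝓘(ℝ, Mink d) c).symm x) :=
  (trivializationAt (Mink d) (TangentSpace 𝓘(ℝ, Mink d)) c).symmL ℝ
    ((extChartAt 𝓘(ℝ, Mink d) c).symm x)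

/-- The metric in the chart centred at `c`. -/
def coordForm (g : LorentzMetric d N) (c : N) (x : Mink d) : Mink d →L[ℝ] Mink d →L[ℝ] ℝ :=
  ContinuousLinearMap.bilinearComp (σ₁₃ := RingHom.id ℝ) (σ₂₃ := RingHom.id ℝ) (E := Mink d) (F := Mink d) (G := ℝ)
    (show Mink d →L[ℝ] Mink d →L[ℝ] ℝ from g.form ((extChartAt 𝓘(ℝ, Mink d) c).symm x))
    (show Mink d →L[ℝ] Mink d from tv c x) (show Mink d →L[ℝ] Mink d from tv c x)

theorem coordForm_apply (g : LorentzMetric d N) (c : N) (x v w : Mink d) :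
    coordForm g c x v w = g.form ((extChartAt 𝓘(ℝ, Mink d) c).symm x) (tv c x v) (tv c x w) := rfl

/-- A vector field in the chart centred at `c`. -/
def coordField (X : ∀ x : N, TangentSpace 𝓘(ℝ, Mink d) x) (c : N) (x : Mink d) : Mink d :=
  (trivializationAt (Mink d) (TangentSpace 𝓘(ℝ, Mink d)) c).continuousLinearMapAt ℝ
    ((extChartAt 𝓘(ℝ, Mink d) c).symm x) (X ((extChartAt 𝓘(ℝ, Mink d) c).symm x))

theorem chart_symm_mem_source {c : N} {x : Mink d} (hx : x ∈ (extChartAt 𝓘(ℝ, Mink d) c).target) :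
    (extChartAt 𝓘(ℝ, Mink d) c).symm x ∈ (chartAt (Mink d) c).source := by
  rw [← extChartAt_source 𝓘(ℝ, Mink d)]
  exact (extChartAt 𝓘(ℝ, Mink d) c).map_target hx

theorem tv_coordField (X : ∀ x : N, TangentSpace 𝓘(ℝ, Mink d) x) {c : N} {x : Mink d}
    (hx : x ∈ (extChartAt 𝓘(ℝ, Mink d) c).target) :
    tv c x (coordField X c x) = X ((extChartAt 𝓘(ℝ, Mink d) c).symm x) :=
  Trivialization.symmL_continuousLinearMapAt _
    (by simpa using chart_symm_mem_source hx) _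

theorem continuousLinearMapAt_tv {c : N} {x : Mink d}
    (hx : x ∈ (extChartAt 𝓘(ℝ, Mink d) c).target) (v : Mink d) :
    (trivializationAt (Mink d) (TangentSpace 𝓘(ℝ, Mink d)) c).continuousLinearMapAt ℝ
      ((extChartAt 𝓘(ℝ, Mink d) c).symm x) (tv c x v) = v :=
  Trivialization.continuousLinearMapAt_symmL _
    (by simpa using chart_symm_mem_source hx) _

theorem tv_eq_mfderiv {c : N} {x : Mink d} (hx : x ∈ (extChartAt 𝓘(ℝ, Mink d) c).target)
    (v : Mink d) : tv c x v =
      mfderiv 𝓘(ℝ, Mink d) 𝓘(ℝ, Mink d) (extChartAt 𝓘(ℝ, Mink d) c).symm x v := by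
  have := TangentBundle.symmL_trivializationAt (I := 𝓘(ℝ, Mink d)) (chart_symm_mem_source hx)
  rw [PartialEquiv.right_inv _ hx, modelWithCornersSelf_coe, range_id, mfderivWithin_univ] at this
  rw [← this]
  rfl

/-- In finite dimension a form depends smoothly on the point once its values on constant vectors do.
The constant vectors of the chart are smooth sections of the tangent bundle, on which the smooth
section `g.form` is evaluated. -/
theorem contDiffOn_coordForm (g : LorentzMetric d N) (c : N) :
    ContDiffOn ℝ ∞ (coordForm g c) (extChartAt 𝓘(ℝ, Mink d) c).target := by
  have hs : ∀ v : Mink d, ContMDiffOn 𝓘(ℝ, Mink d) (𝓘(ℝ, Mink d).prod 𝓘(ℝ, Mink d)) ∞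
      (fun x ↦ TotalSpace.mk' (Mink d) (E := TangentSpace 𝓘(ℝ, Mink d))
        ((extChartAt 𝓘(ℝ, Mink d) c).symm x) (tv c x v)) (extChartAt 𝓘(ℝ, Mink d) c).target := by
    intro v
    have h1 := Trivialization.contMDiffOn_symm (n := ∞) (IB := 𝓘(ℝ, Mink d))
      (trivializationAt (Mink d) (TangentSpace 𝓘(ℝ, Mink d)) c)
    have h2 : ContMDiffOn 𝓘(ℝ, Mink d) (𝓘(ℝ, Mink d).prod 𝓘(ℝ, Mink d)) ∞
        (fun x : Mink d ↦ (((extChartAt 𝓘(ℝ, Mink d) c).symm x, v) : N × Mink d))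
        (extChartAt 𝓘(ℝ, Mink d) c).target :=
      (contMDiffOn_extChartAt_symm c).prodMk contMDiffOn_const
    have h3 := h1.comp h2 (fun x hx ↦ by
      rw [mem_preimage, Trivialization.mem_target]
      simpa using chart_symm_mem_source hx)
    refine h3.congr fun x hx ↦ ?_
    have hb : (extChartAt 𝓘(ℝ, Mink d) c).symm x ∈
        (trivializationAt (Mink d) (TangentSpace 𝓘(ℝ, Mink d)) c).baseSet := by
      simpa using chart_symm_mem_source hx
    exact (congrArg (TotalSpace.mk' (Mink d) _)
      (Trivialization.symmL_apply (R := ℝ) _ hb v)).trans (Trivialization.mk_symm _ hb v)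
  rw [contDiffOn_clm_apply]
  intro v
  rw [contDiffOn_clm_apply]
  intro w
  rw [← contMDiffOn_iff_contDiffOn]
  have hg : ContMDiffOn 𝓘(ℝ, Mink d) (𝓘(ℝ, Mink d).prod 𝓘(ℝ, Mink d →L[ℝ] Mink d →L[ℝ] ℝ)) ∞
      (fun x ↦ TotalSpace.mk' (Mink d →L[ℝ] Mink d →L[ℝ] ℝ)
        (E := fun x : N ↦ (TangentSpace 𝓘(ℝ, Mink d) x →L[ℝ] TangentSpace 𝓘(ℝ, Mink d) x →L[ℝ] ℝ))
        ((extChartAt 𝓘(ℝ, Mink d) c).symm x)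
        (g.form ((extChartAt 𝓘(ℝ, Mink d) c).symm x))) (extChartAt 𝓘(ℝ, Mink d) c).target :=
    g.contMDiff.comp_contMDiffOn (contMDiffOn_extChartAt_symm c)
  have := ContMDiffOn.clm_bundle_apply₂ (F₃ := ℝ) (E₃ := Bundle.Trivial N ℝ) hg (hs v) (hs w)
  intro x hx
  have h4 := this x hx
  rw [contMDiffWithinAt_totalSpace] at h4
  exact h4.2

theorem continuousOn_coordField {X : ∀ x : N, TangentSpace 𝓘(ℝ, Mink d) x} {W : Set N}
    (hX : ContinuousOn (fun x ↦ (⟨x, X x⟩ : TangentBundle 𝓘(ℝ, Mink d) N)) W) (c : N) :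
    ContinuousOn (coordField X c)
      ((extChartAt 𝓘(ℝ, Mink d) c).target ∩ (extChartAt 𝓘(ℝ, Mink d) c).symm ⁻¹' W) := by
  have h1 : ContinuousOn (fun x ↦ (⟨(extChartAt 𝓘(ℝ, Mink d) c).symm x, X _⟩ :
      TangentBundle 𝓘(ℝ, Mink d) N)) ((extChartAt 𝓘(ℝ, Mink d) c).target ∩
      (extChartAt 𝓘(ℝ, Mink d) c).symm ⁻¹' W) :=
    hX.comp ((continuousOn_extChartAt_symm c).mono inter_subset_left) fun x hx ↦ hx.2
  have h2 := (trivializationAt (Mink d) (TangentSpace 𝓘(ℝ, Mink d)) c).continuousOn.comp h1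
    (fun x hx ↦ by
      rw [Trivialization.mem_source]
      simpa using chart_symm_mem_source hx.1)
  refine (continuous_snd.comp_continuousOn h2).congr fun x hx ↦ ?_
  rw [coordField, Trivialization.continuousLinearMapAt_apply, Trivialization.coe_linearMapAt_of_mem]
  · rfl
  · simpa using chart_symm_mem_source hx.1

end Coord

/-! ### Timelike vectors and the two halves of the cone -/

section Cone
variable {d : ℕ}

/-- For timelike vectors the spatial norm is below the absolute time component, so Cauchy–Schwarz
makes the time part dominate. Hence the time components alone decide the sign of the product of two
timelike vectors. -/
theorem abs_inner_lt_of_timelike {v w : Mink d} (hv : minkForm d v v < 0) (hw : minkForm d w w < 0) :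
    |inner ℝ v.2 w.2| < |v.1 * w.1| := by
  rw [minkForm_apply, real_inner_self_eq_norm_sq] at hv hw
  have h1 : ‖v.2‖ < |v.1| := by
    refine abs_lt_of_sq_lt_sq' ?_ (abs_nonneg _) |>.2
    rw [sq_abs]; nlinarith
  have h2 : ‖w.2‖ < |w.1| := by
    refine abs_lt_of_sq_lt_sq' ?_ (abs_nonneg _) |>.2
    rw [sq_abs]; nlinarith
  rw [abs_mul]
  calc _ ≤ ‖v.2‖ * ‖w.2‖ := abs_real_inner_le_norm _ _
    _ < _ := mul_lt_mul'' h1 h2 (norm_nonneg _) (norm_nonneg _)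

theorem minkForm_neg_iff {v w : Mink d} (hv : minkForm d v v < 0) (hw : minkForm d w w < 0) :
    minkForm d v w < 0 ↔ 0 < v.1 * w.1 := by
  have h := abs_inner_lt_of_timelike hv hw
  rw [minkForm_apply]
  rw [abs_lt] at h
  constructor
  · intro h'
    by_contra h0
    rw [abs_of_nonpos (not_lt.1 h0)] at h
    linarith [h.1]
  · intro h'
    rw [abs_of_pos h'] at h
    linarith [h.2]

theorem minkForm_ne_zero {v w : Mink d} (hv : minkForm d v v < 0) (hw : minkForm d w w < 0) :
    minkForm d v w ≠ 0 := by
  have h := abs_inner_lt_of_timelike hv hw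
  rw [minkForm_apply]
  intro h0
  have : inner ℝ v.2 w.2 = v.1 * w.1 := by linarith
  rw [this] at h
  exact lt_irrefl _ h

variable {N : Type} [TopologicalSpace N] [ChartedSpace (Mink d) N]
  [IsManifold 𝓘(ℝ, Mink d) ∞ N] (g : LorentzMetric d N)

/-- In a frame adapted to the signature, a negative product of timelike vectors means time
components of equal sign, and this relation is transitive. -/
theorem LorentzMetric.neg_trans {y : N} {u v w : TangentSpace 𝓘(ℝ, Mink d) y}
    (hu : g.form y u u < 0) (hv : g.form y v v < 0) (hw : g.form y w w < 0)
    (huv : g.form y u v < 0) (hvw : g.form y v w < 0) : g.form y u w < 0 := by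
  obtain ⟨e, he⟩ := g.signature y
  obtain ⟨u, rfl⟩ := e.surjective u
  obtain ⟨v, rfl⟩ := e.surjective v
  obtain ⟨w, rfl⟩ := e.surjective w
  rw [he] at *
  rw [minkForm_neg_iff (by assumption) (by assumption)] at *
  have h1 : 0 < (u.1 * v.1) * (v.1 * w.1) := mul_pos huv hvw
  have h2 : (u.1 * v.1) * (v.1 * w.1) = (v.1 ^ 2) * (u.1 * w.1) := by ring
  rw [h2] at h1
  exact (pos_iff_pos_of_mul_pos h1).1 (lt_of_le_of_ne (sq_nonneg _) fun h0 ↦ by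
    rw [← h0] at h1; simp at h1)

theorem LorentzMetric.ne_zero_of_timelike {y : N} {u v : TangentSpace 𝓘(ℝ, Mink d) y}
    (hu : g.form y u u < 0) (hv : g.form y v v < 0) : g.form y u v ≠ 0 := by
  obtain ⟨e, he⟩ := g.signature y
  obtain ⟨u, rfl⟩ := e.surjective u
  obtain ⟨v, rfl⟩ := e.surjective v
  rw [he] at *
  exact minkForm_ne_zero hu hv

theorem LorentzMetric.nondegenerate {y : N} {u : TangentSpace 𝓘(ℝ, Mink d) y}
    (hu : ∀ v, g.form y u v = 0) : u = 0 := by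
  obtain ⟨e, he⟩ := g.signature y
  obtain ⟨u, rfl⟩ := e.surjective u
  have h : ∀ v, minkForm d u v = 0 := fun v ↦ by rw [← he]; exact hu _
  -- Pairing `u` with its time reflection gives the Euclidean square of `u`.
  have h1 := h (-u.1, u.2)
  rw [minkForm_apply, real_inner_self_eq_norm_sq] at h1
  have h2 : u.1 ^ 2 + ‖u.2‖ ^ 2 = 0 := by simpa [pow_two] using h1
  have h3 : u.1 = 0 := by nlinarith [sq_nonneg u.1, sq_nonneg ‖u.2‖]
  have h4 : ‖u.2‖ = 0 := by nlinarith [sq_nonneg u.1, sq_nonneg ‖u.2‖]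
  have : u = 0 := Prod.ext h3 (norm_eq_zero.1 h4)
  simp [this]

/-- The timelike vectors at `y` in the half of the cone containing `X y`. -/
def futureCone (X : ∀ x : N, TangentSpace 𝓘(ℝ, Mink d) x) (y : N) :
    Set (TangentSpace 𝓘(ℝ, Mink d) y) :=
  {v | g.form y v v < 0 ∧ g.form y v (X y) < 0}

variable {g} {X : ∀ x : N, TangentSpace 𝓘(ℝ, Mink d) x}

theorem futureCone_add {y : N} (hX : g.form y (X y) (X y) < 0) {v w : TangentSpace 𝓘(ℝ, Mink d) y}
    (hv : v ∈ futureCone g X y) (hw : w ∈ futureCone g X y) : v + w ∈ futureCone g X y := by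
  have h := g.neg_trans hv.1 hX hw.1 hv.2 (by rw [g.symm]; exact hw.2)
  refine ⟨?_, ?_⟩
  · rw [map_add, map_add, add_apply, add_apply,
      g.symm y w v]
    linarith [hv.1, hw.1]
  · rw [map_add, add_apply]
    linarith [hv.2, hw.2]

theorem futureCone_smul {y : N} {v : TangentSpace 𝓘(ℝ, Mink d) y}
    (hv : v ∈ futureCone g X y) {c : ℝ} (hc : 0 < c) : c • v ∈ futureCone g X y := by
  refine ⟨?_, ?_⟩
  · rw [map_smul, map_smul, smul_apply, smul_eq_mul, smul_eq_mul]
    exact mul_neg_of_pos_of_neg hc (mul_neg_of_pos_of_neg hc hv.1)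
  · rw [map_smul, smul_apply, smul_eq_mul]
    exact mul_neg_of_pos_of_neg hc hv.2

theorem mem_futureCone_congr {y : N} (hX : g.form y (X y) (X y) < 0)
    {e v : TangentSpace 𝓘(ℝ, Mink d) y}
    (he : e ∈ futureCone g X y) (hv : g.form y v v < 0) (hve : g.form y v e < 0) :
    v ∈ futureCone g X y :=
  ⟨hv, g.neg_trans hv he.1 hX hve he.2⟩

theorem form_neg_of_mem_futureCone {y : N} (hX : g.form y (X y) (X y) < 0)
    {v w : TangentSpace 𝓘(ℝ, Mink d) y}
    (hv : v ∈ futureCone g X y) (hw : w ∈ futureCone g X y) : g.form y v w < 0 :=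
  g.neg_trans hv.1 hX hw.1 hv.2 (by rw [g.symm]; exact hw.2)

end Cone

/-! ### Velocities in the tangent bundle and in charts -/

section Velocity
variable {d : ℕ} {N : Type} [TopologicalSpace N] [ChartedSpace (Mink d) N]
  [IsManifold 𝓘(ℝ, Mink d) ∞ N]

/-- The velocity of a curve, as a point of the tangent bundle. -/
def vel (γ : ℝ → N) (t : ℝ) : TangentBundle 𝓘(ℝ, Mink d) N :=
  ⟨γ t, mfderiv 𝓘(ℝ, ℝ) 𝓘(ℝ, Mink d) γ t (1 : ℝ)⟩

theorem vel_congr {γ γ' : ℝ → N} {t : ℝ} (h : γ =ᶠ[𝓝 t] γ') :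
    (vel γ t : TangentBundle 𝓘(ℝ, Mink d) N) = vel γ' t := by
  refine TotalSpace.ext h.eq_of_nhds (heq_of_eq ?_)
  exact DFunLike.congr_fun (h.mfderiv_eq (I := 𝓘(ℝ, ℝ)) (I' := 𝓘(ℝ, Mink d))) (1 : ℝ)

variable (g : LorentzMetric d N) (X : ∀ x : N, TangentSpace 𝓘(ℝ, Mink d) x)

/-- The future timelike tangent vectors based at points of `O`. -/
def futureTangent (O : Set N) : Set (TangentBundle 𝓘(ℝ, Mink d) N) :=
  {p | p.proj ∈ O ∧ p.2 ∈ futureCone g X p.proj}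

/-- `γ` is `C¹` at `t`, with future timelike velocity based at a point of `O`. -/
def IsFutureAt (O : Set N) (γ : ℝ → N) (t : ℝ) : Prop :=
  ContMDiffAt 𝓘(ℝ, ℝ) 𝓘(ℝ, Mink d) 1 γ t ∧ vel γ t ∈ futureTangent g X O

variable {g X}

theorem IsFutureAt.mem {O : Set N} {γ : ℝ → N} {t : ℝ} (h : IsFutureAt g X O γ t) : γ t ∈ O := h.2.1

theorem IsFutureAt.of_mem {O O' : Set N} {γ : ℝ → N} {t : ℝ} (h : IsFutureAt g X O γ t)
    (ht : γ t ∈ O') : IsFutureAt g X O' γ t := ⟨h.1, ht, h.2.2⟩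

theorem IsFutureAt.congr {O : Set N} {γ γ' : ℝ → N} {t : ℝ} (h : IsFutureAt g X O γ t)
    (hγ : γ =ᶠ[𝓝 t] γ') : IsFutureAt g X O γ' t :=
  ⟨h.1.congr_of_eventuallyEq hγ.symm, by rw [← vel_congr hγ]; exact h.2⟩

variable (g X) in
/-- The future cone in the chart centred at `c`. -/
def coordCone (c : N) (x : Mink d) : Set (Mink d) :=
  {v | coordForm g c x v v < 0 ∧ coordForm g c x v (coordField X c x) < 0}

theorem mem_coordCone_iff {c : N} {x : Mink d} (hx : x ∈ (extChartAt 𝓘(ℝ, Mink d) c).target)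
    {v : Mink d} : v ∈ coordCone g X c x ↔
      tv c x v ∈ futureCone g X ((extChartAt 𝓘(ℝ, Mink d) c).symm x) := by
  simp only [coordCone, futureCone, mem_ofPred_eq, coordForm_apply, tv_coordField X hx]

/-- The points of the chart centred at `c` that represent points of `O`. -/
def chartDom (c : N) (O : Set N) : Set (Mink d) :=
  (extChartAt 𝓘(ℝ, Mink d) c).target ∩ (extChartAt 𝓘(ℝ, Mink d) c).symm ⁻¹' O

theorem isOpen_chartDom (c : N) {O : Set N} (hO : IsOpen O) :
    IsOpen (chartDom c O : Set (Mink d)) :=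
  (continuousOn_extChartAt_symm c).isOpen_inter_preimage (isOpen_extChartAt_target c) hO

/-- Strict inequalities between continuous functions of the base point and the vector together. This
joint openness lets one fixed cone serve over a whole ball in `exists_isConeBox`. -/
theorem isOpen_coordCone {O : Set N} (hO : IsOpen O)
    (hX : ContinuousOn (fun x ↦ (⟨x, X x⟩ : TangentBundle 𝓘(ℝ, Mink d) N)) O) (c : N) :
    IsOpen {p : Mink d × Mink d | p.1 ∈ chartDom c O ∧ p.2 ∈ coordCone g X c p.1} := by
  have hD : IsOpen (Prod.fst ⁻¹' chartDom c O : Set (Mink d × Mink d)) :=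
    (isOpen_chartDom c hO).preimage continuous_fst
  have h1 : ContinuousOn (fun p : Mink d × Mink d ↦ coordForm g c p.1)
      (Prod.fst ⁻¹' chartDom c O) :=
    (contDiffOn_coordForm g c).continuousOn.comp continuousOn_fst fun p hp ↦ hp.1
  have h2 : ContinuousOn (fun p : Mink d × Mink d ↦ coordField X c p.1)
      (Prod.fst ⁻¹' chartDom c O) :=
    (continuousOn_coordField hX c).comp continuousOn_fst fun p hp ↦ hp
  have h3 : ContinuousOn (fun p : Mink d × Mink d ↦ (coordForm g c p.1 p.2 p.2,
      coordForm g c p.1 p.2 (coordField X c p.1))) (Prod.fst ⁻¹' chartDom c O) :=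
    ((h1.clm_apply continuousOn_snd).clm_apply continuousOn_snd).prodMk
      ((h1.clm_apply continuousOn_snd).clm_apply h2)
  exact h3.isOpen_inter_preimage hD ((isOpen_Iio (a := (0 : ℝ))).prod (isOpen_Iio (a := (0 : ℝ))))

theorem coordField_mem {c : N} {x : Mink d} (hx : x ∈ (extChartAt 𝓘(ℝ, Mink d) c).target)
    (hX : g.form _ (X ((extChartAt 𝓘(ℝ, Mink d) c).symm x)) (X _) < 0) :
    coordField X c x ∈ coordCone g X c x := by
  rw [mem_coordCone_iff hx, tv_coordField X hx]
  exact ⟨hX, hX⟩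

theorem vel_chart_symm {c : N} {F : ℝ → Mink d} {t : ℝ} (hF : ContDiffAt ℝ 1 F t)
    (ht : F t ∈ (extChartAt 𝓘(ℝ, Mink d) c).target) :
    ContMDiffAt 𝓘(ℝ, ℝ) 𝓘(ℝ, Mink d) 1 (fun s ↦ (extChartAt 𝓘(ℝ, Mink d) c).symm (F s)) t ∧
    vel (fun s ↦ (extChartAt 𝓘(ℝ, Mink d) c).symm (F s)) t =
      (⟨(extChartAt 𝓘(ℝ, Mink d) c).symm (F t), tv c (F t) (deriv F t)⟩ :
        TangentBundle 𝓘(ℝ, Mink d) N) := by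
  have h1 : ContMDiffAt 𝓘(ℝ, Mink d) 𝓘(ℝ, Mink d) ∞ (extChartAt 𝓘(ℝ, Mink d) c).symm (F t) :=
    (contMDiffOn_extChartAt_symm c).contMDiffAt ((isOpen_extChartAt_target c).mem_nhds ht)
  have h2 : ContMDiffAt 𝓘(ℝ, ℝ) 𝓘(ℝ, Mink d) 1 F t := hF.contMDiffAt
  refine ⟨(h1.of_le (by norm_cast)).comp t h2, ?_⟩
  refine TotalSpace.ext rfl (heq_of_eq ?_)
  have h3 := mfderiv_comp t (h1.mdifferentiableAt (by simp)) (h2.mdifferentiableAt one_ne_zero)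
  change mfderiv 𝓘(ℝ, ℝ) 𝓘(ℝ, Mink d) ((extChartAt 𝓘(ℝ, Mink d) c).symm ∘ F) t (1 : ℝ) = _
  rw [h3, tv_eq_mfderiv ht]
  simp only [mfderiv_eq_fderiv]
  rfl

theorem isFutureAt_chart_symm {c : N} {O : Set N} {F : ℝ → Mink d} {t : ℝ} (hF : ContDiffAt ℝ 1 F t)
    (ht : F t ∈ chartDom c O) (hv : deriv F t ∈ coordCone g X c (F t)) :
    IsFutureAt g X O (fun s ↦ (extChartAt 𝓘(ℝ, Mink d) c).symm (F s)) t := by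
  obtain ⟨h1, h2⟩ := vel_chart_symm hF ht.1
  refine ⟨h1, ?_⟩
  rw [h2]
  exact ⟨ht.2, (mem_coordCone_iff ht.1).1 hv⟩

theorem contDiffAt_chart_comp {c : N} {γ : ℝ → N} {t : ℝ}
    (h : ContMDiffAt 𝓘(ℝ, ℝ) 𝓘(ℝ, Mink d) 1 γ t) (ht : γ t ∈ (extChartAt 𝓘(ℝ, Mink d) c).source) :
    ContDiffAt ℝ 1 (fun s ↦ extChartAt 𝓘(ℝ, Mink d) c (γ s)) t := by
  rw [← contMDiffAt_iff_contDiffAt]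
  exact (contMDiffAt_extChartAt' (by rwa [extChartAt_source] at ht)).comp t h

theorem eventuallyEq_chart {c : N} {γ : ℝ → N} {t : ℝ} (h : ContinuousAt γ t)
    (ht : γ t ∈ (extChartAt 𝓘(ℝ, Mink d) c).source) :
    (fun s ↦ (extChartAt 𝓘(ℝ, Mink d) c).symm (extChartAt 𝓘(ℝ, Mink d) c (γ s))) =ᶠ[𝓝 t] γ := by
  filter_upwards [h.eventually ((isOpen_extChartAt_source c).mem_nhds ht)] with s hs
  exact PartialEquiv.left_inv _ hs

theorem IsFutureAt.chart {c : N} {O : Set N} {γ : ℝ → N} {t : ℝ} (h : IsFutureAt g X O γ t)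
    (ht : γ t ∈ (extChartAt 𝓘(ℝ, Mink d) c).source) :
    deriv (fun s ↦ extChartAt 𝓘(ℝ, Mink d) c (γ s)) t ∈
      coordCone g X c (extChartAt 𝓘(ℝ, Mink d) c (γ t)) := by
  have h1 := h.congr (eventuallyEq_chart h.1.continuousAt ht).symm
  have h3 := (extChartAt 𝓘(ℝ, Mink d) c).map_source ht
  obtain ⟨-, h2⟩ := vel_chart_symm (c := c) (contDiffAt_chart_comp h.1 ht) h3
  have h4 := h1.2
  rw [h2] at h4
  exact (mem_coordCone_iff h3).2 h4.2

/-- Equality in the tangent bundle includes the base points, over which the tangent spaces agree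
only up to transport. One trivialization turns it into an equality of vectors, the form needed by
`contDiffAt_ite`. -/
theorem vel_eq_of_chart {c : N} {γ γ' : ℝ → N} {t : ℝ}
    (h : ContMDiffAt 𝓘(ℝ, ℝ) 𝓘(ℝ, Mink d) 1 γ t) (h' : ContMDiffAt 𝓘(ℝ, ℝ) 𝓘(ℝ, Mink d) 1 γ' t)
    (ht : γ t ∈ (extChartAt 𝓘(ℝ, Mink d) c).source) (hv : (vel γ t : TangentBundle 𝓘(ℝ, Mink d) N) = vel γ' t) :
    deriv (fun s ↦ extChartAt 𝓘(ℝ, Mink d) c (γ s)) t =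
      deriv (fun s ↦ extChartAt 𝓘(ℝ, Mink d) c (γ' s)) t := by
  have e : γ t = γ' t := congrArg TotalSpace.proj hv
  have ht' : γ' t ∈ (extChartAt 𝓘(ℝ, Mink d) c).source := e ▸ ht
  obtain ⟨-, h2⟩ := vel_chart_symm (c := c) (contDiffAt_chart_comp h ht)
    ((extChartAt 𝓘(ℝ, Mink d) c).map_source ht)
  obtain ⟨-, h2'⟩ := vel_chart_symm (c := c) (contDiffAt_chart_comp h' ht')
    ((extChartAt 𝓘(ℝ, Mink d) c).map_source ht')
  rw [vel_congr (eventuallyEq_chart h.continuousAt ht)] at h2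
  rw [vel_congr (eventuallyEq_chart h'.continuousAt ht'), ← hv, h2] at h2'
  rw [← e] at h2'
  have h3 := eq_of_heq (TotalSpace.mk.inj h2').2
  have h4 := congrArg ((trivializationAt (Mink d) (TangentSpace 𝓘(ℝ, Mink d)) c).continuousLinearMapAt ℝ
    ((extChartAt 𝓘(ℝ, Mink d) c).symm (extChartAt 𝓘(ℝ, Mink d) c (γ t)))) h3
  rwa [continuousLinearMapAt_tv ((extChartAt 𝓘(ℝ, Mink d) c).map_source ht),
    continuousLinearMapAt_tv ((extChartAt 𝓘(ℝ, Mink d) c).map_source ht)] at h4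

end Velocity

/-! ### Gluing timelike arcs with matching velocities -/

section Glue

theorem contDiffAt_ite {E : Type*} [NormedAddCommGroup E] [NormedSpace ℝ E] {F₁ F₂ : ℝ → E} {b : ℝ}
    (h₁ : ContDiffAt ℝ 1 F₁ b) (h₂ : ContDiffAt ℝ 1 F₂ b) (h0 : F₁ b = F₂ b)
    (hd : deriv F₁ b = deriv F₂ b) :
    ContDiffAt ℝ 1 (fun t ↦ if t ≤ b then F₁ t else F₂ t) b ∧
      deriv (fun t ↦ if t ≤ b then F₁ t else F₂ t) b = deriv F₁ b := by
  obtain ⟨f₁, u₁, hu₁, hc₁, hf₁⟩ := contDiffAt_one_iff.1 h₁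
  obtain ⟨f₂, u₂, hu₂, hc₂, hf₂⟩ := contDiffAt_one_iff.1 h₂
  obtain ⟨r, hr, hball⟩ := Metric.mem_nhds_iff.1 (inter_mem hu₁ hu₂)
  have hb : b ∈ Metric.ball b r := Metric.mem_ball_self hr
  have e : f₁ b = f₂ b := by
    ext
    rw [← fderiv_apply_one_eq_deriv, ← fderiv_apply_one_eq_deriv, (hf₁ b (hball hb).1).fderiv,
      (hf₂ b (hball hb).2).fderiv] at hd
    exact hd
  -- This one formula gives the derivative on both sides of `b`, and its continuity is that of `min`
  -- and `max`.
  have key : ∀ x ∈ Metric.ball b r, HasFDerivAt (fun t ↦ if t ≤ b then F₁ t else F₂ t)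
      (f₁ (min x b) + f₂ (max x b) - f₁ b) x := by
    intro x hx
    rcases lt_trichotomy x b with hxb | rfl | hxb
    · rw [min_eq_left hxb.le, max_eq_right hxb.le, ← e, add_sub_cancel_right]
      refine (hf₁ x (hball hx).1).congr_of_eventuallyEq ?_
      filter_upwards [Iio_mem_nhds hxb] with t ht
      exact if_pos ht.le
    · rw [min_self, max_self, ← e, add_sub_cancel_right]
      have h3 : HasFDerivWithinAt (fun t ↦ if t ≤ x then F₁ t else F₂ t) (f₁ x) (Iic x) x :=
        ((hf₁ x (hball hx).1).hasFDerivWithinAt).congr (fun t ht ↦ if_pos ht) (if_pos le_rfl)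
      have h4 : HasFDerivWithinAt (fun t ↦ if t ≤ x then F₁ t else F₂ t) (f₁ x) (Ici x) x := by
        rw [e]
        refine ((hf₂ x (hball hx).2).hasFDerivWithinAt).congr (fun t ht ↦ ?_) ?_
        · by_cases h : t ≤ x
          · have : t = x := le_antisymm h ht
            simp [this, h0]
          · simp [h]
        · simp [h0]
      have h5 := h3.union h4
      rw [Iic_union_Ici] at h5
      exact hasFDerivWithinAt_univ.1 h5
    · rw [min_eq_right hxb.le, max_eq_left hxb.le, add_sub_cancel_left]
      refine (hf₂ x (hball hx).2).congr_of_eventuallyEq ?_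
      filter_upwards [Ioi_mem_nhds hxb] with t ht
      exact if_neg (not_le.2 ht)
  refine ⟨contDiffAt_one_iff.2 ⟨_, Metric.ball b r, Metric.ball_mem_nhds b hr, ?_, key⟩, ?_⟩
  · have hmin : ∀ x ∈ Metric.ball b r, min x b ∈ Metric.ball b r := fun x hx ↦ by
      rcases min_choice x b with h | h <;> rw [h] <;> assumption
    have hmax : ∀ x ∈ Metric.ball b r, max x b ∈ Metric.ball b r := fun x hx ↦ by
      rcases max_choice x b with h | h <;> rw [h] <;> assumption
    refine ((hc₁.comp (continuous_id.min continuous_const).continuousOn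
      fun x hx ↦ (hball (hmin x hx)).1).add (hc₂.comp
      (continuous_id.max continuous_const).continuousOn
      fun x hx ↦ (hball (hmax x hx)).2)).sub continuousOn_const
  · rw [← fderiv_apply_one_eq_deriv, (key b hb).fderiv, ← fderiv_apply_one_eq_deriv,
      (hf₁ b (hball hb).1).fderiv]
    simp [e]

variable {d : ℕ} {N : Type} [TopologicalSpace N] [ChartedSpace (Mink d) N]
  [IsManifold 𝓘(ℝ, Mink d) ∞ N] {g : LorentzMetric d N}
  {X : ∀ x : N, TangentSpace 𝓘(ℝ, Mink d) x} {O : Set N}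

theorem IsFutureAt.ite {γ₁ γ₂ : ℝ → N} {b : ℝ} (h₁ : IsFutureAt g X O γ₁ b)
    (h₂ : IsFutureAt g X O γ₂ b)
    (h : (vel γ₁ b : TangentBundle 𝓘(ℝ, Mink d) N) = vel γ₂ b) :
    IsFutureAt g X O (fun t ↦ if t ≤ b then γ₁ t else γ₂ t) b := by
  have e : γ₁ b = γ₂ b := congrArg TotalSpace.proj h
  have hs : γ₁ b ∈ (extChartAt 𝓘(ℝ, Mink d) (γ₁ b)).source := mem_extChartAt_source _
  have hs' : γ₂ b ∈ (extChartAt 𝓘(ℝ, Mink d) (γ₁ b)).source := e ▸ hs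
  obtain ⟨h3, h4⟩ := contDiffAt_ite (contDiffAt_chart_comp h₁.1 hs) (contDiffAt_chart_comp h₂.1 hs')
    (by rw [e]) (vel_eq_of_chart h₁.1 h₂.1 hs h)
  have h5 : IsFutureAt g X O (fun s ↦ (extChartAt 𝓘(ℝ, Mink d) (γ₁ b)).symm
      (if s ≤ b then extChartAt 𝓘(ℝ, Mink d) (γ₁ b) (γ₁ s) else
        extChartAt 𝓘(ℝ, Mink d) (γ₁ b) (γ₂ s))) b := by
    refine isFutureAt_chart_symm h3 ?_ ?_
    · simp only [le_refl, if_true]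
      refine ⟨(extChartAt 𝓘(ℝ, Mink d) (γ₁ b)).map_source hs, ?_⟩
      rw [mem_preimage, PartialEquiv.left_inv _ hs]
      exact h₁.mem
    · rw [h4]
      simp only [le_refl, if_true]
      exact h₁.chart hs
  refine h5.congr ?_
  filter_upwards [eventuallyEq_chart h₁.1.continuousAt hs, eventuallyEq_chart h₂.1.continuousAt hs']
    with t ht ht'
  split_ifs <;> assumption

theorem vel_ite {γ₁ γ₂ : ℝ → N} {b t : ℝ} (h : t ≠ b) :
    (vel (fun t ↦ if t ≤ b then γ₁ t else γ₂ t) t : TangentBundle 𝓘(ℝ, Mink d) N) =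
      if t ≤ b then vel γ₁ t else vel γ₂ t := by
  rcases lt_or_gt_of_ne h with h | h
  · rw [if_pos h.le]
    refine vel_congr ?_
    filter_upwards [Iio_mem_nhds h] with s hs
    exact if_pos hs.le
  · rw [if_neg (not_le.2 h)]
    refine vel_congr ?_
    filter_upwards [Ioi_mem_nhds h] with s hs
    exact if_neg (not_le.2 hs)

theorem IsFutureAt.ite' {γ₁ γ₂ : ℝ → N} {a b c : ℝ} (h₁ : ∀ t ∈ Icc a b, IsFutureAt g X O γ₁ t)
    (h₂ : ∀ t ∈ Icc b c, IsFutureAt g X O γ₂ t)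
    (h : (vel γ₁ b : TangentBundle 𝓘(ℝ, Mink d) N) = vel γ₂ b) {t : ℝ} (ht : t ∈ Icc a c) :
    IsFutureAt g X O (fun t ↦ if t ≤ b then γ₁ t else γ₂ t) t := by
  rcases lt_trichotomy t b with hb | rfl | hb
  · refine (h₁ t ⟨ht.1, hb.le⟩).congr ?_
    filter_upwards [Iio_mem_nhds hb] with s hs
    exact (if_pos hs.le).symm
  · exact (h₁ t ⟨ht.1, le_rfl⟩).ite (h₂ t ⟨le_rfl, ht.2⟩) h
  · refine (h₂ t ⟨hb.le, ht.2⟩).congr ?_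
    filter_upwards [Ioi_mem_nhds hb] with s hs
    exact (if_neg (not_le.2 hs)).symm

theorem vel_comp_affine {γ : ℝ → N} {a b t : ℝ}
    (h : ContMDiffAt 𝓘(ℝ, ℝ) 𝓘(ℝ, Mink d) 1 γ (a * t + b)) :
    ContMDiffAt 𝓘(ℝ, ℝ) 𝓘(ℝ, Mink d) 1 (fun s ↦ γ (a * s + b)) t ∧
    (vel (fun s ↦ γ (a * s + b)) t : TangentBundle 𝓘(ℝ, Mink d) N) =
      ⟨(vel γ (a * t + b)).proj, a • (vel γ (a * t + b)).2⟩ := by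
  have h2 : HasDerivAt (fun s : ℝ ↦ a * s + b) a t := by
    simpa using ((hasDerivAt_id t).const_mul a).add_const b
  have h1 : ContMDiffAt 𝓘(ℝ, ℝ) 𝓘(ℝ, ℝ) 1 (fun s : ℝ ↦ a * s + b) t :=
    ((contDiff_const.mul contDiff_id).add contDiff_const).contDiffAt.contMDiffAt
  refine ⟨h.comp t h1, ?_⟩
  refine TotalSpace.ext rfl (heq_of_eq ?_)
  have h3 := mfderiv_comp t (h.mdifferentiableAt one_ne_zero) (h1.mdifferentiableAt one_ne_zero)
  change mfderiv 𝓘(ℝ, ℝ) 𝓘(ℝ, Mink d) (γ ∘ fun s ↦ a * s + b) t (1 : ℝ) = _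
  rw [h3]
  simp only [mfderiv_eq_fderiv]
  change mfderiv 𝓘(ℝ, ℝ) 𝓘(ℝ, Mink d) γ (a * t + b) (fderiv ℝ (fun s : ℝ ↦ a * s + b) t (1 : ℝ)) = _
  have h4 : (fderiv ℝ (fun s : ℝ ↦ a * s + b) t) (1 : ℝ) = a • (1 : ℝ) := by
    rw [fderiv_apply_one_eq_deriv, h2.deriv]; simp
  refine (congrArg _ h4).trans ?_
  exact map_smul (mfderiv 𝓘(ℝ, ℝ) 𝓘(ℝ, Mink d) γ (a * t + b)) a (1 : ℝ)

theorem IsFutureAt.comp_affine {γ : ℝ → N} {a b t : ℝ} (ha : 0 < a)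
    (h : IsFutureAt g X O γ (a * t + b)) : IsFutureAt g X O (fun s ↦ γ (a * s + b)) t := by
  obtain ⟨h1, h2⟩ := vel_comp_affine h.1
  refine ⟨h1, ?_⟩
  rw [h2]
  exact ⟨h.2.1, futureCone_smul h.2.2 ha⟩

/-- Future timelike arcs with matching velocities fit together to a curve. -/
theorem exists_concat {γ : ℤ → ℝ → N} (h : ∀ k, ∀ t ∈ Icc (0 : ℝ) 1, IsFutureAt g X O (γ k) t)
    (hv : ∀ k, (vel (γ k) 1 : TangentBundle 𝓘(ℝ, Mink d) N) = vel (γ (k + 1)) 0) :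
    ∃ β : ℝ → N, (∀ t, IsFutureAt g X O β t) ∧ ∀ k : ℤ, β k = γ k 0 := by
  have hsh : ∀ (k : ℤ) (t : ℝ), t ∈ Icc (k : ℝ) (k + 1) →
      IsFutureAt g X O (fun s ↦ γ k (1 * s + -k)) t := fun k t ht ↦ by
    refine IsFutureAt.comp_affine one_pos (h k _ ⟨?_, ?_⟩) <;> linarith [ht.1, ht.2]
  refine ⟨fun t ↦ γ ⌊t⌋ (1 * t + -⌊t⌋), fun t ↦ ?_, fun k ↦ by simp⟩
  -- The preceding arc is always included, so that the integer points, where two arcs meet, need no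
  -- separate treatment.
  have hcl : t ∈ Icc ((⌊t⌋ - 1 : ℤ) : ℝ) (⌊t⌋ + 1) :=
    ⟨by push_cast; linarith [Int.floor_le t], (Int.lt_floor_add_one t).le⟩
  set k := ⌊t⌋ with hk
  have hvel : (vel (fun s ↦ γ (k - 1) (1 * s + -((k - 1 : ℤ) : ℝ))) k : TangentBundle 𝓘(ℝ, Mink d) N) =
      vel (fun s ↦ γ k (1 * s + -(k : ℝ))) k := by
    have e1 : 1 * (k : ℝ) + -((k - 1 : ℤ) : ℝ) = 1 := by push_cast; ring
    have e2 : 1 * (k : ℝ) + -(k : ℝ) = 0 := by ring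
    rw [(vel_comp_affine (by rw [e1]; exact (h (k - 1) 1 (by simp)).1)).2,
      (vel_comp_affine (by rw [e2]; exact (h k 0 (by simp)).1)).2, e1, e2, hv, sub_add_cancel]
  have h6 := IsFutureAt.ite' (a := ((k - 1 : ℤ) : ℝ)) (b := k) (c := k + 1)
    (fun t ht ↦ hsh (k - 1) t ⟨ht.1, by push_cast; linarith [ht.2]⟩) (hsh k) hvel hcl
  refine h6.congr ?_
  have hk1 : (k : ℝ) ≤ t := Int.floor_le t
  have hk2 : t < k + 1 := Int.lt_floor_add_one t
  filter_upwards [Ioo_mem_nhds (show (k : ℝ) - 1 < t by linarith) hk2] with s hs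
  split_ifs with hsk
  · rcases hsk.eq_or_lt with rfl | hlt
    · have e := congrArg TotalSpace.proj hvel
      simpa [vel] using e
    · have : ⌊s⌋ = k - 1 := by
        rw [Int.floor_eq_iff]; push_cast; exact ⟨hs.1.le, by linarith⟩
      rw [this]
  · have : ⌊s⌋ = k := by
      rw [Int.floor_eq_iff]; exact ⟨(not_le.1 hsk).le, hs.2⟩
    rw [this]

end Glue

/-! ### The chronological relation generated by segments of charts -/

section Chron
variable {d : ℕ} {N : Type} [TopologicalSpace N] [ChartedSpace (Mink d) N]
  [IsManifold 𝓘(ℝ, Mink d) ∞ N]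

/-- `X` is a continuous timelike vector field on the open set `W`. -/
structure IsTimeOrientation (g : LorentzMetric d N) (X : ∀ x : N, TangentSpace 𝓘(ℝ, Mink d) x)
    (W : Set N) : Prop where
  isOpen : IsOpen W
  continuousOn : ContinuousOn (fun x ↦ (⟨x, X x⟩ : TangentBundle 𝓘(ℝ, Mink d) N)) W
  timelike : ∀ x ∈ W, g.form x (X x) (X x) < 0

theorem IsTimeOrientation.mono {g : LorentzMetric d N} {X : ∀ x : N, TangentSpace 𝓘(ℝ, Mink d) x}
    {W O : Set N} (h : IsTimeOrientation g X W) (hO : IsOpen O) (hOW : O ⊆ W) :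
    IsTimeOrientation g X O :=
  ⟨hO, h.continuousOn.mono hOW, fun x hx ↦ h.timelike x (hOW hx)⟩

/-- `K` is an open convex cone of vectors that are future timelike over the convex open set `B` of a
chart. -/
structure IsConeBox (g : LorentzMetric d N) (X : ∀ x : N, TangentSpace 𝓘(ℝ, Mink d) x)
    (O : Set N) (c : N) (B K : Set (Mink d)) : Prop where
  isOpen : IsOpen B
  convex : Convex ℝ B
  subset : B ⊆ chartDom c O
  isOpen_cone : IsOpen K
  add_mem : ∀ v ∈ K, ∀ w ∈ K, v + w ∈ K
  smul_mem : ∀ v ∈ K, ∀ a : ℝ, 0 < a → a • v ∈ K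
  field_mem : ∀ x ∈ B, coordField X c x ∈ K
  cone_subset : ∀ x ∈ B, K ⊆ coordCone g X c x

/-- `p` and `q` are joined by a future timelike segment of a chart of `O`. -/
def Link (g : LorentzMetric d N) (X : ∀ x : N, TangentSpace 𝓘(ℝ, Mink d) x) (O : Set N)
    (p q : N) : Prop :=
  ∃ (c : N) (B K : Set (Mink d)), IsConeBox g X O c B K ∧
    p ∈ (extChartAt 𝓘(ℝ, Mink d) c).source ∧ q ∈ (extChartAt 𝓘(ℝ, Mink d) c).source ∧
    extChartAt 𝓘(ℝ, Mink d) c p ∈ B ∧ extChartAt 𝓘(ℝ, Mink d) c q ∈ B ∧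
    extChartAt 𝓘(ℝ, Mink d) c q - extChartAt 𝓘(ℝ, Mink d) c p ∈ K

/-- The chronological relation of `O`. -/
abbrev Chron (g : LorentzMetric d N) (X : ∀ x : N, TangentSpace 𝓘(ℝ, Mink d) x) (O : Set N) :
    N → N → Prop :=
  Relation.TransGen (Link g X O)

variable {g : LorentzMetric d N} {X : ∀ x : N, TangentSpace 𝓘(ℝ, Mink d) x} {W O : Set N}

theorem coordCone_add (hX : IsTimeOrientation g X O) {c : N} {x : Mink d} (hx : x ∈ chartDom c O)
    {v w : Mink d} (hv : v ∈ coordCone g X c x) (hw : w ∈ coordCone g X c x) :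
    v + w ∈ coordCone g X c x := by
  rw [mem_coordCone_iff hx.1] at *
  rw [map_add]
  exact futureCone_add (hX.timelike _ hx.2) hv hw

theorem coordCone_smul {c : N} {x : Mink d} {v : Mink d} (hv : v ∈ coordCone g X c x) {a : ℝ}
    (ha : 0 < a) : a • v ∈ coordCone g X c x := by
  obtain ⟨h1, h2⟩ := hv
  refine ⟨?_, ?_⟩
  · rw [map_smul, map_smul, smul_apply, smul_eq_mul, smul_eq_mul]
    exact mul_neg_of_pos_of_neg ha (mul_neg_of_pos_of_neg ha h1)
  · rw [map_smul, smul_apply, smul_eq_mul]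
    exact mul_neg_of_pos_of_neg ha h2

theorem convex_coordCone (hX : IsTimeOrientation g X O) {c : N} {x : Mink d}
    (hx : x ∈ chartDom c O) : Convex ℝ (coordCone g X c x) := by
  refine convex_iff_forall_pos.2 fun v hv w hw a b ha hb _ ↦ ?_
  exact coordCone_add hX hx (coordCone_smul hv ha) (coordCone_smul hw hb)

-- By joint openness, a ball about `v` and a ball about the field lie in all future cones over a
-- small ball. These cones are convex, so they contain the cone spanned by the hull of the two
-- balls. Since the cone is fixed, straight segments in its directions are future timelike
-- throughout.
open scoped Pointwise in
theorem exists_isConeBox (hX : IsTimeOrientation g X O) {c : N} {x : Mink d} (hx : x ∈ chartDom c O)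
    {v : Mink d} (hv : v ∈ coordCone g X c x) :
    ∃ K, v ∈ K ∧ ∃ r > 0, ∀ r', 0 < r' → r' ≤ r → IsConeBox g X O c (Metric.ball x r') K := by
  have hS := isOpen_coordCone (g := g) hX.isOpen hX.continuousOn c
  have hXx := coordField_mem (g := g) hx.1 (hX.timelike _ hx.2)
  have key : ∀ w ∈ coordCone g X c x, ∃ r > 0, ∀ y ∈ Metric.ball x r,
      y ∈ chartDom c O ∧ Metric.ball w r ⊆ coordCone g X c y := by
    intro w hw
    obtain ⟨r, hr, h⟩ := Metric.isOpen_iff.1 hS (x, w) ⟨hx, hw⟩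
    rw [← ball_prod_same] at h
    exact ⟨r, hr, fun y hy ↦ ⟨(h ⟨hy, Metric.mem_ball_self hr⟩ : (y, w) ∈ _).1,
      fun u hu ↦ (h ⟨hy, hu⟩ : (y, u) ∈ _).2⟩⟩
  obtain ⟨r₁, hr₁, h₁⟩ := key v hv
  obtain ⟨r₂, hr₂, h₂⟩ := key _ hXx
  have hcont : ContinuousAt (coordField X c) x :=
    (continuousOn_coordField hX.continuousOn c).continuousAt
      ((isOpen_chartDom c hX.isOpen).mem_nhds hx)
  obtain ⟨r₃, hr₃, h₃⟩ := Metric.mem_nhds_iff.1 (hcont (Metric.ball_mem_nhds _ hr₂))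
  set S := convexHull ℝ (Metric.ball v r₁ ∪ Metric.ball (coordField X c x) r₂) with hSdef
  have hconv : Convex ℝ S := convex_convexHull ℝ _
  have hopen : IsOpen S := (Metric.isOpen_ball.union Metric.isOpen_ball).convexHull
  have hsub : Metric.ball v r₁ ∪ Metric.ball (coordField X c x) r₂ ⊆ S := subset_convexHull ℝ _
  have hin : ∀ w ∈ S, w ∈ ConvexCone.hull ℝ S := fun w hw ↦ ConvexCone.subset_hull hw
  refine ⟨ConvexCone.hull ℝ S, hin _ (hsub (Or.inl (Metric.mem_ball_self hr₁))),
    min r₁ (min r₂ r₃), lt_min hr₁ (lt_min hr₂ hr₃), fun r' hr' hle ↦ ?_⟩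
  have hle1 : r' ≤ r₁ := hle.trans (min_le_left _ _)
  have hle2 : r' ≤ r₂ := hle.trans ((min_le_right _ _).trans (min_le_left _ _))
  have hle3 : r' ≤ r₃ := hle.trans ((min_le_right _ _).trans (min_le_right _ _))
  refine ⟨Metric.isOpen_ball, convex_ball _ _, fun y hy ↦ (h₁ y (Metric.ball_subset_ball hle1 hy)).1,
    ?_, fun a ha b hb ↦ ConvexCone.add_mem _ ha hb, fun a ha b hb ↦ ConvexCone.smul_mem _ hb ha, ?_, ?_⟩
  · have : (ConvexCone.hull ℝ S : Set (Mink d)) = ⋃ a ∈ Ioi (0 : ℝ), a • S := by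
      ext w
      simp only [SetLike.mem_coe, ConvexCone.mem_hull_of_convex hconv, mem_iUnion, mem_Ioi,
        exists_prop]
    rw [this]
    exact isOpen_biUnion fun a ha ↦ hopen.smul₀ (ne_of_gt ha)
  · exact fun y hy ↦ hin _ (hsub (Or.inr (h₃ (Metric.ball_subset_ball hle3 hy))))
  · intro y hy w hw
    have hy1 := h₁ y (Metric.ball_subset_ball hle1 hy)
    have hy2 := h₂ y (Metric.ball_subset_ball hle2 hy)
    obtain ⟨a, ha, u, hu, rfl⟩ := (ConvexCone.mem_hull_of_convex hconv).1 hw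
    exact coordCone_smul (convexHull_min (union_subset hy1.2 hy2.2)
      (convex_coordCone hX hy1.1) hu) ha

theorem Link.curve {p q : N} (h : Link g X O p q) :
    ∃ γ : ℝ → N, γ 0 = p ∧ γ 1 = q ∧ ∀ t ∈ Icc (0 : ℝ) 1, IsFutureAt g X O γ t := by
  obtain ⟨c, B, K, hB, hp, hq, hpB, hqB, hpq⟩ := h
  set a := extChartAt 𝓘(ℝ, Mink d) c p
  set b := extChartAt 𝓘(ℝ, Mink d) c q
  refine ⟨fun t ↦ (extChartAt 𝓘(ℝ, Mink d) c).symm (a + t • (b - a)), ?_, ?_, fun t ht ↦ ?_⟩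
  · simp only [zero_smul, add_zero]
    exact PartialEquiv.left_inv _ hp
  · simp only [one_smul, add_sub_cancel]
    exact PartialEquiv.left_inv _ hq
  have hmem : a + t • (b - a) ∈ B := hB.convex.add_smul_sub_mem hpB hqB ht
  have hd : HasDerivAt (fun t : ℝ ↦ a + t • (b - a)) (b - a) t := by
    simpa using ((hasDerivAt_id t).smul_const (b - a)).const_add a
  refine isFutureAt_chart_symm (by fun_prop) (hB.subset hmem) ?_
  rw [hd.deriv]
  exact hB.cone_subset _ hmem hpq

theorem IsFutureAt.eventually_link (hX : IsTimeOrientation g X O) {γ : ℝ → N} {t : ℝ}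
    (h : IsFutureAt g X O γ t) :
    ∃ δ > 0, ∀ s ∈ Metric.ball t δ, ∀ s' ∈ Metric.ball t δ, s < s' → Link g X O (γ s) (γ s') := by
  have hs : γ t ∈ (extChartAt 𝓘(ℝ, Mink d) (γ t)).source := mem_extChartAt_source _
  have hdom : extChartAt 𝓘(ℝ, Mink d) (γ t) (γ t) ∈ chartDom (γ t) O := by
    refine ⟨(extChartAt 𝓘(ℝ, Mink d) (γ t)).map_source hs, ?_⟩
    rw [mem_preimage, PartialEquiv.left_inv _ hs]
    exact h.mem
  obtain ⟨K, hv, r, hr, hbox⟩ := exists_isConeBox hX hdom (h.chart hs)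
  have hbox := hbox r hr le_rfl
  have hF := contDiffAt_chart_comp h.1 hs
  -- Strict differentiability controls the difference quotient between any two parameters near `t`,
  -- so that it falls into the open cone `K` about the derivative.
  have hstrict := hF.hasStrictDerivAt one_ne_zero
  obtain ⟨ρ, hρ, hρK⟩ := Metric.isOpen_iff.1 hbox.isOpen_cone _ hv
  have h1 := hstrict.hasStrictFDerivAt.isLittleO.def (half_pos hρ)
  rw [nhds_prod_eq] at h1
  obtain ⟨u, hu, h2⟩ := (Filter.eventually_prod_self_iff (r := fun a b ↦
    ‖extChartAt 𝓘(ℝ, Mink d) (γ t) (γ a) - extChartAt 𝓘(ℝ, Mink d) (γ t) (γ b) -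
      (ContinuousLinearMap.toSpanSingleton ℝ
        (deriv (fun s ↦ extChartAt 𝓘(ℝ, Mink d) (γ t) (γ s)) t)) (a - b)‖ ≤ ρ / 2 * ‖a - b‖)).1 h1
  have h3 : ∀ᶠ s in 𝓝 t, γ s ∈ (extChartAt 𝓘(ℝ, Mink d) (γ t)).source :=
    h.1.continuousAt.eventually ((isOpen_extChartAt_source _).mem_nhds hs)
  have h4 : ∀ᶠ s in 𝓝 t, extChartAt 𝓘(ℝ, Mink d) (γ t) (γ s) ∈
      Metric.ball (extChartAt 𝓘(ℝ, Mink d) (γ t) (γ t)) r :=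
    hF.continuousAt.eventually (Metric.ball_mem_nhds _ hr)
  obtain ⟨δ, hδ, h5⟩ := Metric.mem_nhds_iff.1 (inter_mem hu (inter_mem h3 h4))
  refine ⟨δ, hδ, fun s hs s' hs' hlt ↦ ⟨γ t, _, K, hbox, (h5 hs).2.1, (h5 hs').2.1, (h5 hs).2.2,
    (h5 hs').2.2, ?_⟩⟩
  have h6 := h2 s' (h5 hs').1 s (h5 hs).1
  have hpos : 0 < s' - s := sub_pos.2 hlt
  set D := deriv (fun s ↦ extChartAt 𝓘(ℝ, Mink d) (γ t) (γ s)) t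
  set Δ := extChartAt 𝓘(ℝ, Mink d) (γ t) (γ s') - extChartAt 𝓘(ℝ, Mink d) (γ t) (γ s)
  have h7 : (s' - s)⁻¹ • Δ ∈ K := by
    apply hρK
    rw [mem_ball_iff_norm]
    have : (s' - s)⁻¹ • Δ - D = (s' - s)⁻¹ • (Δ - (s' - s) • D) := by
      rw [smul_sub _ Δ, smul_smul, inv_mul_cancel₀ hpos.ne', one_smul]
    rw [this, norm_smul, norm_inv, Real.norm_of_nonneg hpos.le]
    rw [ContinuousLinearMap.toSpanSingleton_apply, Real.norm_of_nonneg hpos.le] at h6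
    calc (s' - s)⁻¹ * ‖Δ - (s' - s) • D‖ ≤ (s' - s)⁻¹ * (ρ / 2 * (s' - s)) := by gcongr
      _ = ρ / 2 := by field_simp
      _ < ρ := by linarith
  have h8 := hbox.smul_mem _ h7 _ hpos
  rwa [smul_smul, mul_inv_cancel₀ hpos.ne', one_smul] at h8

/-- A future timelike curve joins chronologically related points. -/
theorem chron_of_curve (hX : IsTimeOrientation g X O) {γ : ℝ → N} {a b : ℝ} (hab : a < b)
    (h : ∀ t ∈ Icc a b, IsFutureAt g X O γ t) : Chron g X O (γ a) (γ b) := by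
  choose! δ hδ hlink using fun t ht ↦ (h t ht).eventually_link hX
  obtain ⟨η, hη, hleb⟩ := lebesgue_number_lemma_of_metric (s := Icc a b)
    (c := fun t : Icc a b ↦ Metric.ball (t : ℝ) (δ t)) isCompact_Icc (fun _ ↦ Metric.isOpen_ball)
    (fun t ht ↦ mem_iUnion.2 ⟨⟨t, ht⟩, Metric.mem_ball_self (hδ t ht)⟩)
  have step : ∀ s ∈ Icc a b, ∀ s', s < s' → s' - s < η → Link g X O (γ s) (γ s') := by
    intro s hs s' hss' hlt
    obtain ⟨⟨t, ht⟩, hsub⟩ := hleb s hs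
    refine hlink t ht s (hsub (Metric.mem_ball_self hη)) s' (hsub ?_) hss'
    rw [Metric.mem_ball, Real.dist_eq, abs_of_pos (sub_pos.2 hss')]
    exact hlt
  -- Induction on the length in units of `η / 2`: the last piece, shorter than the Lebesgue number
  -- `η`, is a single link.
  have main : ∀ n : ℕ, ∀ s ∈ Icc a b, ∀ s' ∈ Icc a b, s < s' → s' - s < (n + 1) * (η / 2) →
      Chron g X O (γ s) (γ s') := by
    intro n
    induction n with
    | zero =>
      intro s hs s' _ hlt hd
      exact Relation.TransGen.single (step s hs s' hlt (by norm_num at hd; linarith))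
    | succ n ih =>
      intro s hs s' hs' hlt hd
      by_cases hη' : s' - s < η
      · exact Relation.TransGen.single (step s hs s' hlt hη')
      · push_cast at hd
        have hm : s' - η / 2 ∈ Icc a b := ⟨by linarith [hs.1], by linarith [hs'.2]⟩
        exact (ih s hs _ hm (by linarith) (by linarith)).tail
          (step _ hm s' (by linarith) (by linarith))
  obtain ⟨n, hn⟩ := exists_nat_gt ((b - a) / (η / 2))
  refine main n a (left_mem_Icc.2 hab.le) b (right_mem_Icc.2 hab.le) hab ?_
  rw [div_lt_iff₀ (by positivity)] at hn
  nlinarith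

end Chron

/-! ### Smoothing chronological chains to `C¹` curves -/

section Smooth
variable {d : ℕ} {N : Type} [TopologicalSpace N] [ChartedSpace (Mink d) N]
  [IsManifold 𝓘(ℝ, Mink d) ∞ N]
  {g : LorentzMetric d N} {X : ∀ x : N, TangentSpace 𝓘(ℝ, Mink d) x} {W O : Set N}

variable (g X O) in
/-- For all small `ε` and `η`, the points `p` and `q` are joined by a future timelike curve with
initial velocity `ε X p` and final velocity `η X q`. -/
def SmoothlyJoined (p q : N) : Prop :=
  ∃ ε₀ > 0, ∀ ε η : ℝ, 0 < ε → ε < ε₀ → 0 < η → η < ε₀ → ∃ γ : ℝ → N, (∀ t ∈ Icc (0 : ℝ) 1, IsFutureAt g X O γ t) ∧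
    vel γ 0 = (⟨p, ε • X p⟩ : TangentBundle 𝓘(ℝ, Mink d) N) ∧
    vel γ 1 = (⟨q, η • X q⟩ : TangentBundle 𝓘(ℝ, Mink d) N)

theorem smul_coordField {c : N} {p : N} (hp : p ∈ (extChartAt 𝓘(ℝ, Mink d) c).source) (ε : ℝ) :
    (⟨(extChartAt 𝓘(ℝ, Mink d) c).symm (extChartAt 𝓘(ℝ, Mink d) c p),
      tv c (extChartAt 𝓘(ℝ, Mink d) c p) (ε • coordField X c (extChartAt 𝓘(ℝ, Mink d) c p))⟩ :
      TangentBundle 𝓘(ℝ, Mink d) N) = ⟨p, ε • X p⟩ := by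
  rw [map_smul, tv_coordField X ((extChartAt 𝓘(ℝ, Mink d) c).map_source hp),
    PartialEquiv.left_inv _ hp]

theorem IsConeBox.nonneg_add {c : N} {B K : Set (Mink d)} (hB : IsConeBox g X O c B K)
    {u v w : Mink d} (hu : u ∈ K) (hv : v ∈ K) (hw : w ∈ K) {a b e : ℝ} (ha : 0 ≤ a) (hb : 0 ≤ b)
    (he : 0 ≤ e) (h : 0 < a + b) : a • u + b • v + e • w ∈ K := by
  have h1 : a • u + b • v ∈ K := by
    rcases ha.eq_or_lt with rfl | ha
    · rw [zero_smul, zero_add]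
      exact hB.smul_mem _ hv _ (by linarith)
    rcases hb.eq_or_lt with rfl | hb
    · rw [zero_smul, add_zero]
      exact hB.smul_mem _ hu _ ha
    exact hB.add_mem _ (hB.smul_mem _ hu _ ha) _ (hB.smul_mem _ hv _ hb)
  rcases he.eq_or_lt with rfl | he
  · rwa [zero_smul, add_zero]
  · exact hB.add_mem _ h1 _ (hB.smul_mem _ hw _ he)

/-- An explicit cubic in the chart works: its velocity is `ε (1 - t) u + η t v + 6 t (1 - t) w`,
where `w` is the displacement less what the first two terms contribute to the integral. For small
`ε`, `η` the vector `w` is still in the open cone, and the velocity is a nonnegative combination of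
cone vectors. -/
theorem Link.smoothlyJoined {p q : N} (h : Link g X O p q) : SmoothlyJoined g X O p q := by
  obtain ⟨c, B, K, hB, hp, hq, hpB, hqB, hpq⟩ := h
  set a := extChartAt 𝓘(ℝ, Mink d) c p with ha
  set b := extChartAt 𝓘(ℝ, Mink d) c q with hb
  set u := coordField X c a with hu
  set v := coordField X c b with hv
  have huK : u ∈ K := hB.field_mem _ hpB
  have hvK : v ∈ K := hB.field_mem _ hqB
  -- the perturbation of the displacement stays in the cone
  have h1 : ∀ᶠ e : ℝ × ℝ in 𝓝 0, b - a - (e.1 / 2) • u - (e.2 / 2) • v ∈ K := by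
    have : ContinuousAt (fun e : ℝ × ℝ ↦ b - a - (e.1 / 2) • u - (e.2 / 2) • v) 0 := by fun_prop
    exact this.eventually (hB.isOpen_cone.mem_nhds (by simpa using hpq))
  -- the curve stays in the box
  have h2 : ∀ᶠ e : ℝ × ℝ in 𝓝 0, ∀ t ∈ Icc (0 : ℝ) 1,
      a + (e.1 * (t - t ^ 2 / 2)) • u + (e.2 * (t ^ 2 / 2)) • v +
        (3 * t ^ 2 - 2 * t ^ 3) • (b - a - (e.1 / 2) • u - (e.2 / 2) • v) ∈ B := by
    refine (isCompact_Icc.eventually_forall_of_forall_eventually fun t ht ↦ ?_)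
    have hc : Continuous fun z : (ℝ × ℝ) × ℝ ↦ a + (z.1.1 * (z.2 - z.2 ^ 2 / 2)) • u +
        (z.1.2 * (z.2 ^ 2 / 2)) • v +
        (3 * z.2 ^ 2 - 2 * z.2 ^ 3) • (b - a - (z.1.1 / 2) • u - (z.1.2 / 2) • v) := by fun_prop
    refine hc.continuousAt.eventually (hB.isOpen.mem_nhds ?_)
    simp only [Prod.fst_zero, Prod.snd_zero, zero_mul, zero_smul, add_zero, zero_div, sub_zero]
    refine hB.convex.add_smul_sub_mem hpB hqB ⟨?_, ?_⟩
    · nlinarith [sq_nonneg t, mul_nonneg (sq_nonneg t) (sub_nonneg.2 ht.2)]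
    · nlinarith [mul_nonneg (sq_nonneg (1 - t)) ht.1, sq_nonneg (1 - t)]
  obtain ⟨ε₀, hε₀, h3⟩ := Metric.eventually_nhds_iff.1 (h1.and h2)
  refine ⟨ε₀, hε₀, fun ε η hε hεlt hη hηlt ↦ ?_⟩
  obtain ⟨h4, h5⟩ := h3 (y := (ε, η)) (by
    rw [dist_zero_right, Prod.norm_def, Real.norm_of_nonneg hε.le, Real.norm_of_nonneg hη.le]
    exact max_lt hεlt hηlt)
  simp only at h4 h5
  set w := b - a - (ε / 2) • u - (η / 2) • v with hw
  set F : ℝ → Mink d := fun t ↦ a + (ε * (t - t ^ 2 / 2)) • u + (η * (t ^ 2 / 2)) • v +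
        (3 * t ^ 2 - 2 * t ^ 3) • w with hF
  have hd : ∀ t, HasDerivAt F ((ε * (1 - t)) • u + (η * t) • v + (6 * t * (1 - t)) • w) t := by
    intro t
    have e1 : HasDerivAt (fun t : ℝ ↦ ε * (t - t ^ 2 / 2)) (ε * (1 - t)) t := by
      have := (((hasDerivAt_id t).sub ((hasDerivAt_pow 2 t).div_const 2)).const_mul ε)
      refine this.congr_deriv ?_; simp
    have e2 : HasDerivAt (fun t : ℝ ↦ η * (t ^ 2 / 2)) (η * t) t := by
      have := (((hasDerivAt_pow 2 t).div_const 2).const_mul η)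
      refine this.congr_deriv ?_; simp
    have e3 : HasDerivAt (fun t : ℝ ↦ 3 * t ^ 2 - 2 * t ^ 3) (6 * t * (1 - t)) t := by
      have := (((hasDerivAt_pow 2 t).const_mul 3).sub ((hasDerivAt_pow 3 t).const_mul 2))
      refine this.congr_deriv ?_; push_cast; ring
    have := (((e1.smul_const u).const_add a).add (e2.smul_const v)).add (e3.smul_const w)
    exact this
  have hcd : ∀ t, ContDiffAt ℝ 1 F t := fun t ↦ by
    have : ContDiff ℝ 1 F := by fun_prop
    exact this.contDiffAt
  have hF0 : F 0 = a := by simp [hF]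
  have hF1 : F 1 = b := by
    simp only [hF, hw]
    module
  refine ⟨fun t ↦ (extChartAt 𝓘(ℝ, Mink d) c).symm (F t), fun t ht ↦ ?_, ?_, ?_⟩
  · refine isFutureAt_chart_symm (hcd t) (hB.subset (h5 t ht)) ?_
    rw [(hd t).deriv]
    refine hB.cone_subset _ (h5 t ht) (hB.nonneg_add huK hvK h4 ?_ ?_ ?_ ?_)
    · exact mul_nonneg hε.le (by linarith [ht.2])
    · exact mul_nonneg hη.le ht.1
    · exact mul_nonneg (by linarith [ht.1]) (by linarith [ht.2])
    · rcases ht.1.eq_or_lt with rfl | h0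
      · simpa using hε
      · nlinarith [mul_nonneg hε.le (sub_nonneg.2 ht.2), mul_pos hη h0]
  · have h0 : F 0 ∈ (extChartAt 𝓘(ℝ, Mink d) c).target := by
      rw [hF0]; exact (hB.subset hpB).1
    rw [(vel_chart_symm (hcd 0) h0).2, (hd 0).deriv, hF0]
    simp only [sub_zero, mul_one, mul_zero, zero_smul, add_zero]
    rw [hu]
    exact smul_coordField hp ε
  · have h0 : F 1 ∈ (extChartAt 𝓘(ℝ, Mink d) c).target := by
      rw [hF1]; exact (hB.subset hqB).1
    rw [(vel_chart_symm (hcd 1) h0).2, (hd 1).deriv, hF1]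
    simp only [sub_self, mul_one, mul_zero, zero_smul, add_zero, zero_add]
    rw [hv]
    exact smul_coordField hq η

theorem SmoothlyJoined.trans {p q r : N} (h₁ : SmoothlyJoined g X O p q)
    (h₂ : SmoothlyJoined g X O q r) : SmoothlyJoined g X O p r := by
  obtain ⟨ε₁, hε₁, h₁⟩ := h₁
  obtain ⟨ε₂, hε₂, h₂⟩ := h₂
  -- Both arcs are run at double speed, so halved velocities are requested and the threshold
  -- doubles; at `q` both arcs have velocity `min ε₁ ε₂ / 2`.
  refine ⟨2 * min ε₁ ε₂, by positivity, fun ε η hε hlt hη hηlt ↦ ?_⟩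
  have hm : 0 < min ε₁ ε₂ := lt_min hε₁ hε₂
  have hm1 := min_le_left ε₁ ε₂
  have hm2 := min_le_right ε₁ ε₂
  obtain ⟨γ₁, hγ₁, h10, h11⟩ := h₁ (ε / 2) (min ε₁ ε₂ / 2) (half_pos hε) (by linarith)
    (half_pos hm) (by linarith)
  obtain ⟨γ₂, hγ₂, h20, h21⟩ := h₂ (min ε₁ ε₂ / 2) (η / 2) (half_pos hm) (by linarith)
    (half_pos hη) (by linarith)
  have e0 : (2 : ℝ) * 0 + 0 = 0 := by norm_num
  have e1 : (2 : ℝ) * (1 / 2) + 0 = 1 := by norm_num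
  have e2 : (2 : ℝ) * (1 / 2) + -1 = 0 := by norm_num
  have e3 : (2 : ℝ) * 1 + -1 = 1 := by norm_num
  have em : ∀ (ε : ℝ) (y : N), (2 : ℝ) • (ε / 2) • X y = ε • X y := fun ε y ↦ by
    rw [smul_smul]; congr 1; ring
  refine ⟨fun t ↦ if t ≤ 1 / 2 then γ₁ (2 * t + 0) else γ₂ (2 * t + -1), fun t ht ↦ ?_, ?_, ?_⟩
  · refine IsFutureAt.ite' (γ₁ := fun t ↦ γ₁ (2 * t + 0)) (γ₂ := fun t ↦ γ₂ (2 * t + -1))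
      (a := 0) (b := 1 / 2) (c := 1) (fun t ht ↦ ?_) (fun t ht ↦ ?_) ?_ ht
    · exact (hγ₁ _ ⟨by linarith [ht.1], by linarith [ht.2]⟩).comp_affine two_pos
    · exact (hγ₂ _ ⟨by linarith [ht.1], by linarith [ht.2]⟩).comp_affine two_pos
    · rw [(vel_comp_affine (by rw [e1]; exact (hγ₁ 1 (by simp)).1)).2,
        (vel_comp_affine (by rw [e2]; exact (hγ₂ 0 (by simp)).1)).2, e1, e2, h11, h20]
  · rw [vel_ite (γ₁ := fun t ↦ γ₁ (2 * t + 0)) (γ₂ := fun t ↦ γ₂ (2 * t + -1)) (by norm_num),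
      if_pos (by norm_num), (vel_comp_affine (by rw [e0]; exact (hγ₁ 0 (by simp)).1)).2, e0, h10]
    simp only [em]
  · rw [vel_ite (γ₁ := fun t ↦ γ₁ (2 * t + 0)) (γ₂ := fun t ↦ γ₂ (2 * t + -1)) (by norm_num),
      if_neg (by norm_num), (vel_comp_affine (by rw [e3]; exact (hγ₂ 1 (by simp)).1)).2, e3, h21]
    simp only [em]

theorem Chron.smoothlyJoined {p q : N} (h : Chron g X O p q) : SmoothlyJoined g X O p q := by
  induction h with
  | single h => exact h.smoothlyJoined
  | tail _ h ih => exact ih.trans h.smoothlyJoined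

/-- A bi-infinite chronological sequence lies on a future timelike curve. -/
theorem exists_curve_through {z : ℤ → N} (h : ∀ k, Chron g X O (z k) (z (k + 1))) :
    ∃ β : ℝ → N, (∀ t, IsFutureAt g X O β t) ∧ ∀ k : ℤ, β k = z k := by
  choose ε₀ hε₀ hj using fun k ↦ (h k).smoothlyJoined
  -- The speed at the vertex `k` is chosen below the thresholds of both arcs meeting there.
  have hpos : ∀ k, 0 < min (ε₀ (k - 1)) (ε₀ k) / 2 := fun k ↦ half_pos (lt_min (hε₀ _) (hε₀ _))
  have hlt1 : ∀ k, min (ε₀ (k - 1)) (ε₀ k) / 2 < ε₀ k := fun k ↦ by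
    linarith [hpos k, min_le_right (ε₀ (k - 1)) (ε₀ k)]
  have hlt2 : ∀ k, min (ε₀ (k + 1 - 1)) (ε₀ (k + 1)) / 2 < ε₀ k := fun k ↦ by
    have := min_le_left (ε₀ k) (ε₀ (k + 1))
    rw [add_sub_cancel_right]
    linarith [hε₀ k]
  choose γ hγ h0 h1 using fun k ↦ hj k _ _ (hpos k) (hlt1 k) (hpos (k + 1)) (hlt2 k)
  obtain ⟨β, hβ, hβk⟩ := exists_concat hγ fun k ↦ (h1 k).trans (h0 (k + 1)).symm
  exact ⟨β, hβ, fun k ↦ (hβk k).trans (congrArg TotalSpace.proj (h0 k))⟩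

end Smooth

/-! ### Openness, time reversal and exit points of chronological chains -/

section ChronOpen
variable {d : ℕ} {N : Type} [TopologicalSpace N] [ChartedSpace (Mink d) N]
  [IsManifold 𝓘(ℝ, Mink d) ∞ N]
  {g : LorentzMetric d N} {X : ∀ x : N, TangentSpace 𝓘(ℝ, Mink d) x} {W O : Set N}

theorem IsConeBox.mem_of_mem {c p : N} {B K : Set (Mink d)} (hB : IsConeBox g X O c B K)
    (hp : p ∈ (extChartAt 𝓘(ℝ, Mink d) c).source) (hpB : extChartAt 𝓘(ℝ, Mink d) c p ∈ B) :
    p ∈ O := by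
  have := (hB.subset hpB).2
  rwa [mem_preimage, PartialEquiv.left_inv _ hp] at this

theorem Chron.left_mem {p q : N} (h : Chron g X O p q) : p ∈ O := by
  obtain ⟨r, ⟨c, B, K, hB, hp, -, hpB, -⟩, -⟩ := Relation.TransGen.head'_iff.1 h
  exact hB.mem_of_mem hp hpB

theorem Chron.right_mem {p q : N} (h : Chron g X O p q) : q ∈ O := by
  obtain ⟨r, -, ⟨c, B, K, hB, -, hq, -, hqB, -⟩⟩ := Relation.TransGen.tail'_iff.1 h
  exact hB.mem_of_mem hq hqB

theorem Link.eventually_right {p q : N} (h : Link g X O p q) : ∀ᶠ q' in 𝓝 q, Link g X O p q' := by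
  obtain ⟨c, B, K, hB, hp, hq, hpB, hqB, hpq⟩ := h
  have hc : ContinuousAt (extChartAt 𝓘(ℝ, Mink d) c) q := continuousAt_extChartAt' (by exact hq)
  filter_upwards [(isOpen_extChartAt_source c).mem_nhds hq, hc.eventually (hB.isOpen.mem_nhds hqB),
    (hc.sub continuousAt_const).eventually (hB.isOpen_cone.mem_nhds hpq)] with x h1 h2 h3
  exact ⟨c, B, K, hB, hp, h1, hpB, h2, h3⟩

theorem Link.eventually_left {p q : N} (h : Link g X O p q) : ∀ᶠ p' in 𝓝 p, Link g X O p' q := by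
  obtain ⟨c, B, K, hB, hp, hq, hpB, hqB, hpq⟩ := h
  have hc : ContinuousAt (extChartAt 𝓘(ℝ, Mink d) c) p := continuousAt_extChartAt' (by exact hp)
  filter_upwards [(isOpen_extChartAt_source c).mem_nhds hp, hc.eventually (hB.isOpen.mem_nhds hpB),
    (continuousAt_const.sub hc).eventually (hB.isOpen_cone.mem_nhds hpq)] with x h1 h2 h3
  exact ⟨c, B, K, hB, h1, hq, h2, hqB, h3⟩

theorem Chron.eventually_right {p q : N} (h : Chron g X O p q) :
    ∀ᶠ q' in 𝓝 q, Chron g X O p q' := by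
  obtain ⟨r, h1, h2⟩ := Relation.TransGen.tail'_iff.1 h
  filter_upwards [h2.eventually_right] with x hx
  exact Relation.TransGen.tail'_iff.2 ⟨r, h1, hx⟩

theorem Chron.eventually_left {p q : N} (h : Chron g X O p q) :
    ∀ᶠ p' in 𝓝 p, Chron g X O p' q := by
  obtain ⟨r, h1, h2⟩ := Relation.TransGen.head'_iff.1 h
  filter_upwards [h1.eventually_left] with x hx
  exact Relation.TransGen.head'_iff.2 ⟨r, hx, h2⟩

theorem chron_sub_curve (hX : IsTimeOrientation g X O) {γ : ℝ → N} {a b s t : ℝ}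
    (h : ∀ t ∈ Icc a b, IsFutureAt g X O γ t) (has : a ≤ s) (hst : s < t) (htb : t ≤ b) :
    Chron g X O (γ s) (γ t) :=
  chron_of_curve hX hst fun u hu ↦ h u ⟨has.trans hu.1, hu.2.trans htb⟩

theorem Chron.exists_between_left (hX : IsTimeOrientation g X O) {p q : N} (h : Chron g X O p q)
    {G : Set N} (hG : G ∈ 𝓝 p) : ∃ r ∈ G, Chron g X O p r ∧ Chron g X O r q := by
  obtain ⟨r, h1, h2⟩ := Relation.TransGen.head'_iff.1 h
  obtain ⟨γ, rfl, rfl, hγ⟩ := h1.curve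
  have hc : ContinuousAt γ 0 := (hγ 0 (by simp)).1.continuousAt
  have h3 : ∀ᶠ s in 𝓝[>] (0 : ℝ), γ s ∈ G ∧ s < 1 ∧ 0 < s := by
    filter_upwards [(hc.mono_left nhdsWithin_le_nhds).eventually hG,
      nhdsWithin_le_nhds (Iio_mem_nhds one_pos), self_mem_nhdsWithin] with s h1 h2 h3
      using ⟨h1, h2, h3⟩
  obtain ⟨s, hs, hs1, hs0⟩ := h3.exists
  exact ⟨γ s, hs, chron_sub_curve hX hγ le_rfl hs0 hs1.le,
    (chron_sub_curve hX hγ hs0.le hs1 le_rfl).trans_left h2⟩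

/-- Time reversal: through it every statement about the past yields one about the future. Continuity
passes over because trivializations are linear on the fibres. -/
theorem IsTimeOrientation.neg (h : IsTimeOrientation g X O) :
    IsTimeOrientation g (fun x ↦ -X x) O := by
  refine ⟨h.isOpen, ?_, fun x hx ↦ by simpa using h.timelike x hx⟩
  intro x hx
  have h1 := h.continuousOn x hx
  rw [FiberBundle.continuousWithinAt_totalSpace] at h1 ⊢
  refine ⟨h1.1, ?_⟩
  refine h1.2.neg.congr_of_eventuallyEq ?_ ?_
  · have h2 : ∀ᶠ y in 𝓝[O] x, y ∈ (chartAt (Mink d) x).source :=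
      nhdsWithin_le_nhds ((chartAt (Mink d) x).open_source.mem_nhds (mem_chart_source _ _))
    filter_upwards [h2] with y hy
    have hb : y ∈ (trivializationAt (Mink d) (TangentSpace 𝓘(ℝ, Mink d)) x).baseSet := by simpa
    have e := Trivialization.coe_linearMapAt_of_mem (R := ℝ)
      (trivializationAt (Mink d) (TangentSpace 𝓘(ℝ, Mink d)) x) hb
    have e1 := congrFun e (-X y)
    have e2 := congrFun e (X y)
    rw [map_neg] at e1
    exact e1.symm.trans (congrArg Neg.neg e2)
  · have hb : x ∈ (trivializationAt (Mink d) (TangentSpace 𝓘(ℝ, Mink d)) x).baseSet := by simp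
    have e := Trivialization.coe_linearMapAt_of_mem (R := ℝ)
      (trivializationAt (Mink d) (TangentSpace 𝓘(ℝ, Mink d)) x) hb
    have e1 := congrFun e (-X x)
    have e2 := congrFun e (X x)
    rw [map_neg] at e1
    exact e1.symm.trans (congrArg Neg.neg e2)

theorem coordField_neg (c : N) (x : Mink d) :
    coordField (fun x ↦ -X x) c x = -coordField X c x := map_neg _ _

theorem neg_mem_coordCone {c : N} {x v : Mink d} (h : v ∈ coordCone g X c x) :
    -v ∈ coordCone g (fun x ↦ -X x) c x := by
  obtain ⟨h1, h2⟩ := h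
  refine ⟨by simpa using h1, ?_⟩
  rw [coordField_neg]
  simpa using h2

theorem Link.neg {p q : N} (h : Link g X O p q) : Link g (fun x ↦ -X x) O q p := by
  obtain ⟨c, B, K, hB, hp, hq, hpB, hqB, hpq⟩ := h
  refine ⟨c, B, Neg.neg ⁻¹' K, ⟨hB.isOpen, hB.convex, hB.subset,
    hB.isOpen_cone.preimage continuous_neg, fun v hv w hw ↦ ?_, fun v hv a ha ↦ ?_, fun x hx ↦ ?_,
    fun x hx v hv ↦ ?_⟩, hq, hp, hqB, hpB, ?_⟩
  · rw [mem_preimage, neg_add]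
    exact hB.add_mem _ hv _ hw
  · rw [mem_preimage, ← smul_neg]
    exact hB.smul_mem _ hv _ ha
  · rw [mem_preimage, coordField_neg, neg_neg]
    exact hB.field_mem x hx
  · have := neg_mem_coordCone (hB.cone_subset x hx hv)
    rwa [neg_neg] at this
  · rwa [mem_preimage, neg_sub]

theorem Chron.neg {p q : N} (h : Chron g X O p q) : Chron g (fun x ↦ -X x) O q p := by
  induction h with
  | single h => exact .single h.neg
  | tail _ h ih => exact .head h.neg ih

theorem chron_neg_iff {p q : N} : Chron g (fun x ↦ -X x) O q p ↔ Chron g X O p q := by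
  refine ⟨fun h ↦ ?_, Chron.neg⟩
  have := h.neg
  simpa only [neg_neg] using this

/-- A chronological chain that enters the closed set `C` last at a frontier point. -/
theorem Chron.exists_frontier (hX : IsTimeOrientation g X W) {C G : Set N} (hC : IsClosed C)
    (hG : IsOpen G) (hCG : C ⊆ G) (hGW : G ⊆ W) {p q : N} (h : Chron g X W p q)
    (hq : q ∈ interior C) (hp : p ∉ C) :
    ∃ w ∈ frontier C, Chron g X W p w ∧ Chron g X G w q := by
  have hXG := hX.mono hG hGW
  -- entering along a single link
  have enter : ∀ p r : N, Link g X W p r → r ∈ interior C →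
      (p ∈ interior C ∧ Chron g X G p r) ∨
        ∃ w ∈ frontier C, (p = w ∨ Chron g X W p w) ∧ Chron g X G w r := by
    intro p r hpr hr
    obtain ⟨γ, rfl, rfl, hγ⟩ := hpr.curve
    have hcont : ContinuousOn γ (Icc 0 1) := fun t ht ↦ (hγ t ht).1.continuousAt.continuousWithinAt
    have toG : ∀ s ∈ Icc (0 : ℝ) 1, s < 1 → (∀ t ∈ Icc s 1, γ t ∈ C) →
        Chron g X G (γ s) (γ 1) := fun s hs hs1 h ↦
      chron_of_curve hXG hs1 fun t ht ↦ (hγ t ⟨hs.1.trans ht.1, ht.2⟩).of_mem (hCG (h t ht))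
    by_cases hall : ∀ t ∈ Icc (0 : ℝ) 1, γ t ∈ interior C
    · exact Or.inl ⟨hall 0 (by simp), toG 0 (by simp) one_pos fun t ht ↦ interior_subset (hall t ht)⟩
    · right
      push Not at hall
      -- The last parameter in `S` is the point of entry: there the curve is not in the interior,
      -- yet it is a limit of later points in the closed set `C`.
      set S := Icc (0 : ℝ) 1 ∩ γ ⁻¹' (interior C)ᶜ with hS
      have hSc : IsCompact S := isCompact_Icc.of_isClosed_subset
        (hcont.preimage_isClosed_of_isClosed isClosed_Icc isOpen_interior.isClosed_compl)
        inter_subset_left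
      have hSne : S.Nonempty := let ⟨t, ht, ht'⟩ := hall; ⟨t, ht, ht'⟩
      have hs := hSc.sSup_mem hSne
      set s := sSup S with hsdef
      have hs1 : s < 1 := lt_of_le_of_ne hs.1.2 fun e ↦ hs.2 (by rw [e]; exact hr)
      have hlater : ∀ t ∈ Ioc s 1, γ t ∈ interior C := fun t ht ↦ by
        by_contra hn
        exact absurd (le_csSup hSc.bddAbove ⟨⟨hs.1.1.trans ht.1.le, ht.2⟩, hn⟩) (not_le.2 ht.1)
      have hsC : γ s ∈ C := by
        have h1 : ContinuousWithinAt γ (Ioc s 1) s :=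
          ((hγ s hs.1).1.continuousAt).continuousWithinAt
        have h2 : s ∈ closure (Ioc s 1) := by
          rw [closure_Ioc hs1.ne]; exact left_mem_Icc.2 hs1.le
        have := h1.mem_closure h2 (fun t ht ↦ interior_subset (hlater t ht))
        rwa [hC.closure_eq] at this
      refine ⟨γ s, ⟨subset_closure hsC, hs.2⟩, ?_, toG s hs.1 hs1 fun t ht ↦ ?_⟩
      · rcases hs.1.1.eq_or_lt with h0 | h0
        · exact Or.inl (by rw [h0])
        · exact Or.inr (chron_sub_curve hX hγ le_rfl h0 hs1.le)
      · rcases ht.1.eq_or_lt with h0 | h0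
        · rwa [← h0]
        · exact interior_subset (hlater t ⟨h0, ht.2⟩)
  -- The assumption `p ∉ C` is given up for the induction, because the tails of the chain may start
  -- inside `C`.
  have main : (p ∈ interior C ∧ Chron g X G p q) ∨
        ∃ w ∈ frontier C, (p = w ∨ Chron g X W p w) ∧ Chron g X G w q := by
    clear hp
    induction h using Relation.TransGen.head_induction_on with
    | single h => exact enter _ _ h hq
    | head h _ ih =>
      rcases ih with ⟨h1, h2⟩ | ⟨w, hw, h1, h2⟩
      · rcases enter _ _ h h1 with ⟨h3, h4⟩ | ⟨w, hw, h3, h4⟩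
        · exact Or.inl ⟨h3, h4.trans h2⟩
        · exact Or.inr ⟨w, hw, h3, h4.trans h2⟩
      · refine Or.inr ⟨w, hw, Or.inr ?_, h2⟩
        rcases h1 with rfl | h1
        · exact .single h
        · exact .head h h1
  rcases main with ⟨h1, -⟩ | ⟨w, hw, h1, h2⟩
  · exact absurd (interior_subset h1) hp
  · refine ⟨w, hw, h1.resolve_left ?_, h2⟩
    rintro rfl
    exact hp (hC.frontier_subset hw)

/-- From every point near `p` one can leave a fixed neighbourhood of `p` in the past direction. -/
theorem exists_escape (hX : IsTimeOrientation g X W) {p : N} (hp : p ∈ W) :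
    ∃ G, IsOpen G ∧ p ∈ G ∧ ∀ y ∈ G, ∃ y', y' ∉ G ∧ Chron g X W y' y := by
  have hs : p ∈ (extChartAt 𝓘(ℝ, Mink d) p).source := mem_extChartAt_source _
  set x₀ := extChartAt 𝓘(ℝ, Mink d) p p with hx₀
  have hdom : x₀ ∈ chartDom p W := by
    refine ⟨(extChartAt 𝓘(ℝ, Mink d) p).map_source hs, ?_⟩
    rw [mem_preimage, PartialEquiv.left_inv _ hs]
    exact hp
  have hv := coordField_mem (g := g) hdom.1 (hX.timelike _ hdom.2)
  set v := coordField X p x₀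
  have hv0 : v ≠ 0 := fun h0 ↦ by
    have := hv.1
    rw [h0] at this
    simp at this
  have hnv : 0 < ‖v‖ := norm_pos_iff.2 hv0
  obtain ⟨K, hvK, r, hr, hbox⟩ := exists_isConeBox hX hdom hv
  have hbox := hbox r hr le_rfl
  refine ⟨(extChartAt 𝓘(ℝ, Mink d) p).source ∩
    extChartAt 𝓘(ℝ, Mink d) p ⁻¹' Metric.ball x₀ (r / 4),
    (continuousOn_extChartAt p).isOpen_inter_preimage (isOpen_extChartAt_source p)
      Metric.isOpen_ball, ⟨hs, Metric.mem_ball_self (by positivity)⟩, fun y hy ↦ ?_⟩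
  -- A step of length `r / 2` leads out of the ball of radius `r / 4` but keeps within the ball of
  -- radius `r`, where `K` is a future cone.
  set s := r / 2 / ‖v‖ with hsdef
  have hspos : 0 < s := by positivity
  have hnorm : ‖s • v‖ = r / 2 := by
    rw [norm_smul, Real.norm_of_nonneg hspos.le, hsdef, div_mul_cancel₀ _ hnv.ne']
  have hy2 : ‖extChartAt 𝓘(ℝ, Mink d) p y - x₀‖ < r / 4 := mem_ball_iff_norm.1 hy.2
  set y₀ := extChartAt 𝓘(ℝ, Mink d) p y - s • v with hy₀
  have hmem : y₀ ∈ Metric.ball x₀ r := by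
    rw [mem_ball_iff_norm]
    calc ‖y₀ - x₀‖ = ‖(extChartAt 𝓘(ℝ, Mink d) p y - x₀) - s • v‖ := by rw [hy₀]; congr 1; abel
      _ ≤ _ := norm_sub_le _ _
      _ < r := by rw [hnorm]; linarith
  have hmemy : extChartAt 𝓘(ℝ, Mink d) p y ∈ Metric.ball x₀ r :=
    Metric.ball_subset_ball (by linarith) hy.2
  have ht := (hbox.subset hmem).1
  have hr' : extChartAt 𝓘(ℝ, Mink d) p ((extChartAt 𝓘(ℝ, Mink d) p).symm y₀) = y₀ :=
    PartialEquiv.right_inv _ ht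
  refine ⟨(extChartAt 𝓘(ℝ, Mink d) p).symm y₀, fun hn ↦ ?_, .single ⟨p, _, K, hbox,
    (extChartAt 𝓘(ℝ, Mink d) p).map_target ht, hy.1, by rw [hr']; exact hmem, hmemy, ?_⟩⟩
  · have h1 := hn.2
    rw [mem_preimage, hr', mem_ball_iff_norm] at h1
    have h2 : s • v = (extChartAt 𝓘(ℝ, Mink d) p y - x₀) - (y₀ - x₀) := by rw [hy₀]; abel
    have h3 := norm_sub_le (extChartAt 𝓘(ℝ, Mink d) p y - x₀) (y₀ - x₀)
    rw [← h2, hnorm] at h3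
    linarith
  · rw [hr', hy₀, sub_sub_cancel]
    exact hbox.smul_mem _ hvK _ hspos

end ChronOpen

/-! ### Local shifts to the future that preserve chronology -/

section PushUp

theorem ContinuousAt.eventually_norm_sub_lt {E F : Type*} [TopologicalSpace E] [SeminormedAddCommGroup F]
    {f : E → F} {x₀ : E} (hf : ContinuousAt f x₀) {η : ℝ} (hη : 0 < η) :
    ∀ᶠ x in 𝓝 x₀, ‖f x - f x₀‖ < η := by
  filter_upwards [hf.eventually (Metric.ball_mem_nhds _ hη)] with x hx
  rwa [← mem_ball_iff_norm]

theorem abs_bilin_sub_le {E : Type*} [SeminormedAddCommGroup E] [NormedSpace ℝ E]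
    {A B : E →L[ℝ] E →L[ℝ] ℝ} {K : ℝ} (h : ‖A - B‖ ≤ K) (v w : E) :
    |A v w - B v w| ≤ K * ‖v‖ * ‖w‖ :=
  (A - B).le_of_opNorm₂_le_of_le h le_rfl le_rfl

theorem abs_bilin_sub_le_two_mul {E : Type*} [SeminormedAddCommGroup E] [NormedSpace ℝ E]
    {A B C : E →L[ℝ] E →L[ℝ] ℝ} {K : ℝ} (hA : ‖A - C‖ ≤ K) (hB : ‖B - C‖ ≤ K) (v w : E) :
    |B v w - A v w| ≤ 2 * K * ‖v‖ * ‖w‖ := by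
  have h1 := abs_le.1 (abs_bilin_sub_le hA v w)
  have h2 := abs_le.1 (abs_bilin_sub_le hB v w)
  rw [abs_le]
  constructor <;> linarith

theorem LipschitzOnWith.norm_sub_le_mul {E F : Type*} [SeminormedAddCommGroup E]
    [SeminormedAddCommGroup F] {f : E → F} {L : NNReal} {s : Set E} (h : LipschitzOnWith L f s)
    {x y : E} (hx : x ∈ s) (hy : y ∈ s) : ‖f y - f x‖ ≤ L * ‖y - x‖ := by
  rw [← dist_eq_norm, ← dist_eq_norm]
  exact h.dist_le_mul _ hy _ hx

variable {d : ℕ} {N : Type} [TopologicalSpace N] [ChartedSpace (Mink d) N]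
  [IsManifold 𝓘(ℝ, Mink d) ∞ N]
  {g : LorentzMetric d N} {X : ∀ x : N, TangentSpace 𝓘(ℝ, Mink d) x} {W O : Set N}

theorem coordForm_injective {c : N} {x : Mink d}
    (hx : x ∈ (extChartAt 𝓘(ℝ, Mink d) c).target) : (coordForm g c x).ker = ⊥ := by
  rw [LinearMap.ker_eq_bot']
  intro v hv
  have h1 : tv c x v = 0 := by
    refine g.nondegenerate fun u ↦ ?_
    obtain ⟨w, rfl⟩ : ∃ w, tv c x w = u :=
      ⟨_, Trivialization.symmL_continuousLinearMapAt _
        (by simpa using chart_symm_mem_source hx) u⟩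
    rw [← coordForm_apply]
    exact DFunLike.congr_fun hv w
  have h2 := continuousLinearMapAt_tv hx v
  rw [h1, map_zero] at h2
  exact h2.symm

theorem form_neg_of_mem_coordCone (hX : IsTimeOrientation g X O) {c : N} {x : Mink d}
    (hx : x ∈ chartDom c O) {v w : Mink d} (hv : v ∈ coordCone g X c x)
    (hw : w ∈ coordCone g X c x) : coordForm g c x v w < 0 := by
  rw [mem_coordCone_iff hx.1] at hv hw
  exact form_neg_of_mem_futureCone (hX.timelike _ hx.2) hv hw

theorem mem_coordCone_congr (hX : IsTimeOrientation g X O) {c : N} {x : Mink d}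
    (hx : x ∈ chartDom c O) {e v : Mink d} (he : e ∈ coordCone g X c x)
    (hv : coordForm g c x v v < 0) (hve : coordForm g c x v e < 0) : v ∈ coordCone g X c x := by
  rw [mem_coordCone_iff hx.1] at he ⊢
  exact mem_futureCone_congr (hX.timelike _ hx.2) he hv hve

set_option synthInstance.maxHeartbeats 200000 in
set_option maxHeartbeats 1000000 in
/-- Near a point of a chart, the future cones are uniformly sharp. -/
theorem exists_sharp_cone {E : Type*} [NormedAddCommGroup E] [NormedSpace ℝ E] [FiniteDimensional ℝ E]
    {B : E → E →L[ℝ] E →L[ℝ] ℝ} {K : E → Set E} {D : Set E} {x₀ : E}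
    (hneg : ∀ x ∈ D, ∀ v ∈ K x, ∀ w ∈ K x, B x v w < 0)
    (hS : IsOpen {p : E × E | p.1 ∈ D ∧ p.2 ∈ K p.1}) (hsm : ContDiffAt ℝ 1 B x₀)
    (hinj : (B x₀).ker = ⊥) {e : E} (hx : x₀ ∈ D) (hXx : e ∈ K x₀) :
     ∃ m > 0, ∃ L ≥ 0, ∃ r > 0, Metric.ball x₀ r ⊆ D ∧
      (∀ x ∈ Metric.ball x₀ r, e ∈ K x) ∧
      (∀ x ∈ Metric.ball x₀ r, ∀ y ∈ Metric.ball x₀ r, ∀ v ∈ K x,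
        m * ‖v‖ ≤ -B y v e) ∧
      ∀ x ∈ Metric.ball x₀ r, ∀ y ∈ Metric.ball x₀ r,
        ‖B y - B x‖ ≤ L * ‖y - x‖ := by
  obtain ⟨ρ, hρ, hball⟩ := Metric.isOpen_iff.1 hS (x₀, e) ⟨hx, hXx⟩
  rw [← ball_prod_same] at hball
  have hdom : ∀ x ∈ Metric.ball x₀ ρ, x ∈ D := fun x hx ↦
    (hball ⟨hx, Metric.mem_ball_self hρ⟩ : (x, e) ∈ _).1
  have hcone : ∀ x ∈ Metric.ball x₀ ρ, Metric.ball e ρ ⊆ K x := fun x hx u hu ↦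
    (hball ⟨hx, hu⟩ : (x, u) ∈ _).2
  obtain ⟨L, u, hu, hL⟩ := hsm.exists_lipschitzOnWith
  -- Nondegeneracy of the form at `x₀` bounds `‖B x₀ v‖` from below by a multiple of `‖v‖`.
  obtain ⟨κ, hκ, hanti⟩ := (B x₀).toLinearMap.exists_antilipschitzWith
    hinj
  have hκ' : (0 : ℝ) < κ := hκ
  have hlow : ∀ v, (κ : ℝ)⁻¹ * ‖v‖ ≤ ‖B x₀ v‖ := fun v ↦ by
    have := hanti.le_mul_dist v 0
    simp only [dist_zero_right, map_zero] at this
    rw [inv_mul_le_iff₀ hκ']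
    exact this
  set k := (κ : ℝ)⁻¹ with hk
  have hk0 : 0 < k := by positivity
  -- The duality estimate `‖B x v‖ ≤ (2 / ρ) (-B x v e)` and the lower bound `(k / 2) ‖v‖` for its
  -- left side give `2 m ‖v‖ ≤ -B x v e`. Half of this pays for replacing `x` by `y` in the form;
  -- the bound `η` below is chosen for these two purposes.
  set m := ρ * k / 8 with hm
  have hm0 : 0 < m := by positivity
  set η := min (k / 2) (m / (2 * (‖e‖ + 1))) with hη
  have hη0 : 0 < η := by positivity
  have hnear : ∀ᶠ x in 𝓝 x₀, ‖B x - B x₀‖ < η := by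
    exact hsm.continuousAt.eventually_norm_sub_lt hη0
  obtain ⟨r₁, hr₁, hcont⟩ := Metric.mem_nhds_iff.1 hnear
  obtain ⟨r₂, hr₂, hsub⟩ := Metric.mem_nhds_iff.1 hu
  refine ⟨m, hm0, L, L.2, min ρ (min r₁ r₂), by positivity, fun x hx ↦ hdom x ?_,
    fun x hx ↦ hcone x ?_ (Metric.mem_ball_self hρ), fun x hx y hy v hv ↦ ?_, fun x hx y hy ↦ ?_⟩
  · exact Metric.ball_subset_ball (min_le_left _ _) hx
  · exact Metric.ball_subset_ball (min_le_left _ _) hx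
  · have hxρ : x ∈ Metric.ball x₀ ρ := Metric.ball_subset_ball (min_le_left _ _) hx
    have near : ∀ y ∈ Metric.ball x₀ (min ρ (min r₁ r₂)),
        ‖B y - B x₀‖ ≤ η := fun y hy ↦ by
      exact (hcont (Metric.ball_subset_ball ((min_le_right _ _).trans (min_le_left _ _)) hy) : _ < η).le
    -- duality
    have h1 : ‖B x v‖ ≤ 2 / ρ * -B x v e := by
      have hneg' := hneg x (hdom x hxρ) v hv _
        (hcone x hxρ (Metric.mem_ball_self hρ))
      refine ContinuousLinearMap.opNorm_le_of_unit_norm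
        (mul_nonneg (by positivity) (by linarith)) fun u hu ↦ ?_
      have hmem : ∀ s : ℝ, |s| ≤ 1 → e + (s * (ρ / 2)) • u ∈ Metric.ball e ρ := fun s hs ↦ by
        rw [mem_ball_iff_norm, add_sub_cancel_left, norm_smul, hu, mul_one, norm_mul,
          Real.norm_eq_abs, Real.norm_of_nonneg (by positivity : (0 : ℝ) ≤ ρ / 2)]
        nlinarith
      have ha := hneg x (hdom x hxρ) v hv _
        (hcone x hxρ (hmem 1 (by simp)))
      have hb := hneg x (hdom x hxρ) v hv _
        (hcone x hxρ (hmem (-1) (by simp)))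
      rw [map_add, map_smul, smul_eq_mul] at ha hb
      rw [Real.norm_eq_abs, div_mul_eq_mul_div, le_div_iff₀ hρ]
      rcases abs_cases (B x v u) with ⟨h, -⟩ | ⟨h, -⟩ <;> rw [h] <;> nlinarith
    have h2 : k / 2 * ‖v‖ ≤ ‖B x v‖ := by
      have h3 := (B x - B x₀).le_of_opNorm_le (near x hx) v
      have h4 := hlow v
      have h5 : ‖B x₀ v‖ ≤ ‖B x v‖ +
          ‖(B x - B x₀) v‖ := by
        have : B x₀ v = B x v -
          (B x - B x₀) v := by simp
        rw [this]
        exact norm_sub_le _ _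
      have h6 : η ≤ k / 2 := min_le_left _ _
      nlinarith [norm_nonneg v]
    have h3 : 2 * m * ‖v‖ ≤ -B x v e := by
      have h4 := mul_le_mul_of_nonneg_left (h2.trans h1) hρ.le
      have h5 : ρ * (2 / ρ * -B x v e) = 2 * -B x v e := by field_simp
      rw [h5] at h4
      rw [hm]
      linarith
    have h4 : |B y v e - B x v e| ≤ m * ‖v‖ := by
      have h6 := abs_bilin_sub_le_two_mul (near x hx) (near y hy) v e
      have h7 : η * (2 * (‖e‖ + 1)) ≤ m := by
        rw [← le_div_iff₀ (by positivity)]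
        exact min_le_right _ _
      calc _ ≤ _ := h6
        _ = (η * (2 * ‖e‖)) * ‖v‖ := by ring
        _ ≤ m * ‖v‖ := by
          gcongr
          nlinarith
    have := (abs_le.1 h4).2
    linarith
  · exact hL.norm_sub_le_mul
      (hsub (Metric.ball_subset_ball ((min_le_right _ _).trans (min_le_right _ _)) hx))
      (hsub (Metric.ball_subset_ball ((min_le_right _ _).trans (min_le_right _ _)) hy))

set_option synthInstance.maxHeartbeats 200000 in
set_option maxHeartbeats 1000000 in
/-- A small shift, growing exponentially along the cones, maps future vectors to future vectors. -/
theorem exists_shift {E : Type*} [NormedAddCommGroup E] [NormedSpace ℝ E] [FiniteDimensional ℝ E]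
    {B : E → E →L[ℝ] E →L[ℝ] ℝ} {K : E → Set E} {D : Set E} {x₀ : E}
    (hneg : ∀ x ∈ D, ∀ v ∈ K x, ∀ w ∈ K x, B x v w < 0)
    (hsymm : ∀ x v w, B x v w = B x w v)
    (hcongr : ∀ x ∈ D, ∀ e ∈ K x, ∀ v, B x v v < 0 → B x v e < 0 → v ∈ K x)
    (hS : IsOpen {p : E × E | p.1 ∈ D ∧ p.2 ∈ K p.1}) (hsm : ContDiffAt ℝ 1 B x₀)
    (hinj : (B x₀).ker = ⊥) {e : E} (hx : x₀ ∈ D) (hXx : e ∈ K x₀) :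
    ∃ τ : E →L[ℝ] ℝ, ∃ r > 0, ∃ δ₀ > 0,
      Metric.ball x₀ r ⊆ D ∧ (∀ x ∈ Metric.ball x₀ r, e ∈ K x) ∧
      ∀ x ∈ Metric.ball x₀ (r / 2), ∀ δ : ℝ, 0 < δ → δ < δ₀ →
        x + (δ * Real.exp (τ x)) • e ∈ Metric.ball x₀ r ∧
        ∀ v ∈ K x, v + (δ * Real.exp (τ x) * τ v) • e ∈
          K (x + (δ * Real.exp (τ x)) • e) := by
  obtain ⟨m, hm, L, hL, r, hr, hdom, he, hsharp, hlip⟩ := exists_sharp_cone hneg hS hsm hinj hx hXx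
  -- The derivative of the shift `x ↦ x + s e`, with `s = δ exp (τ x)`, is `v ↦ v + h e` with `h = s
  -- τ v`. Moving the base point by `s e` raises `B v v` by at most `L s ‖e‖ ‖v‖²`, and adding `h e`
  -- lowers it by at least `2 h m ‖v‖`. The latter wins as soon as `C ‖v‖ ≤ τ v`; sharpness of the
  -- cones provides such a linear `τ`, a multiple of the pairing with `-e` at `x₀`.
  set C := L * ‖e‖ / m with hC
  have hC0 : 0 ≤ C := by positivity
  set τ : E →L[ℝ] ℝ := -(C / m) • (B x₀).flip e with hτ
  have hτv : ∀ x ∈ Metric.ball x₀ r, ∀ v ∈ K x, C * ‖v‖ ≤ τ v := by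
    intro x hx v hv
    have h1 := hsharp x hx x₀ (Metric.mem_ball_self hr) v hv
    have h2 : τ v = C / m * -B x₀ v e := by
      rw [hτ, smul_apply, ContinuousLinearMap.flip_apply, smul_eq_mul]; ring
    rw [h2]
    calc C * ‖v‖ = C / m * (m * ‖v‖) := by field_simp
      _ ≤ _ := by gcongr
  set E := Real.exp (‖τ‖ * (‖x₀‖ + r)) with hE
  have hE0 : 0 < E := Real.exp_pos _
  refine ⟨τ, r, hr, r / (2 * E * (‖e‖ + 1)), by positivity, hdom, he,
    fun x hx δ hδ hδ' ↦ ?_⟩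
  have hxr : x ∈ Metric.ball x₀ r := Metric.ball_subset_ball (by linarith) hx
  have hxE : Real.exp (τ x) ≤ E := by
    apply Real.exp_le_exp.2
    calc τ x ≤ ‖τ x‖ := le_abs_self _
      _ ≤ ‖τ‖ * ‖x‖ := τ.le_opNorm x
      _ ≤ _ := by
        gcongr
        have := mem_ball_iff_norm.1 hxr
        have h2 := norm_add_le x₀ (x - x₀)
        rw [add_sub_cancel] at h2
        linarith
  set s := δ * Real.exp (τ x) with hs
  have hs0 : 0 < s := mul_pos hδ (Real.exp_pos _)
  have hse : s * ‖e‖ < r / 2 := by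
    rw [lt_div_iff₀ (by positivity)] at hδ'
    have h1 : s ≤ δ * E := by rw [hs]; gcongr
    nlinarith [norm_nonneg e, mul_pos hδ hE0, mul_le_mul_of_nonneg_right h1 (norm_nonneg e)]
  have hy : x + s • e ∈ Metric.ball x₀ r := by
    rw [mem_ball_iff_norm] at hx ⊢
    calc ‖x + s • e - x₀‖ = ‖(x - x₀) + s • e‖ := by congr 1; abel
      _ ≤ _ := norm_add_le _ _
      _ < r := by rw [norm_smul, Real.norm_of_nonneg hs0.le]; linarith
  refine ⟨hy, fun v hv ↦ ?_⟩
  set y := x + s • e with hydef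
  set h := s * τ v with hh
  have hh0 : 0 ≤ h := mul_nonneg hs0.le ((mul_nonneg hC0 (norm_nonneg v)).trans (hτv x hxr v hv))
  have hee : B y e e < 0 := hneg y (hdom hy) e (he y hy) e (he y hy)
  have hve := hsharp x hxr y hy v hv
  have hv0 : 0 < ‖v‖ := norm_pos_iff.2 fun h0 ↦ by
    have := hneg x (hdom hxr) v hv v hv
    rw [h0] at this
    simp at this
  refine hcongr y (hdom hy) e (he y hy) _ ?_ ?_
  · have hsymm : B y e v = B y v e := hsymm _ _ _
    have h1 : B y (v + h • e) (v + h • e) =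
        B y v v + 2 * h * B y v e + h ^ 2 * B y e e := by
      simp only [map_add, map_smul, add_apply, smul_apply, smul_eq_mul, hsymm]
      ring
    have h2 : B y v v ≤ B x v v + L * (s * ‖e‖) * ‖v‖ * ‖v‖ := by
      have h3 := hlip x hxr y hy
      rw [hydef, add_sub_cancel_left, norm_smul, Real.norm_of_nonneg hs0.le, ← hydef] at h3
      have h4 := abs_bilin_sub_le h3 v v
      linarith [(abs_le.1 h4).2]
    have h5 : L * (s * ‖e‖) * ‖v‖ ≤ h * m := by
      have := mul_le_mul_of_nonneg_left (hτv x hxr v hv) (mul_nonneg hs0.le hm.le)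
      rw [hh]
      calc L * (s * ‖e‖) * ‖v‖ = s * m * (C * ‖v‖) := by rw [hC]; field_simp
        _ ≤ _ := this
        _ = _ := by ring
    rw [h1]
    have h6 : 2 * h * (m * ‖v‖) ≤ 2 * h * -B y v e := by gcongr
    have h7 := mul_le_mul_of_nonneg_right h5 hv0.le
    have h8 : 0 ≤ h * m * ‖v‖ := by positivity
    nlinarith [hneg x (hdom hxr) v hv v hv, mul_nonneg (sq_nonneg h) (neg_nonneg.2 hee.le)]
  · rw [map_add, add_apply, map_smul, smul_apply, smul_eq_mul]
    nlinarith [mul_pos hm hv0, mul_nonneg hh0 (neg_nonneg.2 hee.le)]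

set_option synthInstance.maxHeartbeats 200000 in
set_option maxHeartbeats 1000000 in
/-- Near every point, small shifts to the future preserve the chronological relation. -/
theorem exists_pushUp (hX : IsTimeOrientation g X O) {p : N} (hp : p ∈ O) :
    ∃ (G : Set N) (Ψ : ℝ → N → N), ∃ δ₀ > 0, IsOpen G ∧ p ∈ G ∧ G ⊆ O ∧
      (∀ x ∈ G, Tendsto (fun δ ↦ Ψ δ x) (𝓝[>] 0) (𝓝 x)) ∧
      ∀ δ : ℝ, 0 < δ → δ < δ₀ → ContinuousOn (Ψ δ) G ∧ (∀ x ∈ G, Chron g X O x (Ψ δ x)) ∧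
        ∀ x y, Chron g X G x y → Chron g X O (Ψ δ x) (Ψ δ y) := by
  have hs : p ∈ (extChartAt 𝓘(ℝ, Mink d) p).source := mem_extChartAt_source _
  have hdom : extChartAt 𝓘(ℝ, Mink d) p p ∈ chartDom p O := by
    refine ⟨(extChartAt 𝓘(ℝ, Mink d) p).map_source hs, ?_⟩
    rw [mem_preimage, PartialEquiv.left_inv _ hs]
    exact hp
  have he₀ : coordField X p (extChartAt 𝓘(ℝ, Mink d) p p) ∈
      coordCone g X p (extChartAt 𝓘(ℝ, Mink d) p p) :=
    coordField_mem (g := g) hdom.1 (hX.timelike _ hdom.2)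
  have hsm : ContDiffAt ℝ ∞ (coordForm g p) (extChartAt 𝓘(ℝ, Mink d) p p) :=
    (contDiffOn_coordForm g p).contDiffAt ((isOpen_extChartAt_target p).mem_nhds hdom.1)
  obtain ⟨τ, r, hr, δ₀, hδ₀, hsub, he, hshift⟩ := exists_shift
    (B := coordForm g p) (K := coordCone g X p) (D := chartDom p O)
    (fun x hx v hv w hw ↦ form_neg_of_mem_coordCone hX hx hv hw) (fun x v w ↦ g.symm _ _ _)
    (fun x hx e he v hv hve ↦ mem_coordCone_congr hX hx he hv hve)
    (isOpen_coordCone (g := g) hX.isOpen hX.continuousOn p) (hsm.of_le (by norm_cast))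
    (coordForm_injective hdom.1) hdom he₀
  set e := coordField X p (extChartAt 𝓘(ℝ, Mink d) p p)
  have hopen := (continuousOn_extChartAt (I := 𝓘(ℝ, Mink d)) p).isOpen_inter_preimage
    (isOpen_extChartAt_source p)
    (Metric.isOpen_ball (x := extChartAt 𝓘(ℝ, Mink d) p p) (ε := r / 2))
  set G := (extChartAt 𝓘(ℝ, Mink d) p).source ∩
    extChartAt 𝓘(ℝ, Mink d) p ⁻¹' Metric.ball (extChartAt 𝓘(ℝ, Mink d) p p) (r / 2) with hG
  have hbr : ∀ x ∈ G, extChartAt 𝓘(ℝ, Mink d) p x ∈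
      Metric.ball (extChartAt 𝓘(ℝ, Mink d) p p) r := fun x hx ↦
    Metric.ball_subset_ball (by linarith) hx.2
  refine ⟨G, fun δ x ↦ (extChartAt 𝓘(ℝ, Mink d) p).symm (extChartAt 𝓘(ℝ, Mink d) p x +
    (δ * Real.exp (τ (extChartAt 𝓘(ℝ, Mink d) p x))) • e), δ₀, hδ₀, hopen,
    ⟨hs, Metric.mem_ball_self (by positivity)⟩, fun x hx ↦ ?_, fun x hx ↦ ?_, fun δ hδ hδ' ↦ ⟨?_, ?_, ?_⟩⟩
  · have := (hsub (hbr x hx)).2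
    rwa [mem_preimage, PartialEquiv.left_inv _ hx.1] at this
  · have h1 : ContinuousAt (fun δ : ℝ ↦ extChartAt 𝓘(ℝ, Mink d) p x +
        (δ * Real.exp (τ (extChartAt 𝓘(ℝ, Mink d) p x))) • e) 0 := by fun_prop
    have h2 : ContinuousAt (extChartAt 𝓘(ℝ, Mink d) p).symm (extChartAt 𝓘(ℝ, Mink d) p x +
        ((0 : ℝ) * Real.exp (τ (extChartAt 𝓘(ℝ, Mink d) p x))) • e) := by
      rw [zero_mul, zero_smul, add_zero]
      exact continuousAt_extChartAt_symm' hx.1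
    have h3 := (ContinuousAt.comp (f := fun δ : ℝ ↦ extChartAt 𝓘(ℝ, Mink d) p x +
        (δ * Real.exp (τ (extChartAt 𝓘(ℝ, Mink d) p x))) • e) h2 h1).tendsto
    simp only [Function.comp_def, zero_mul, zero_smul, add_zero] at h3
    rw [PartialEquiv.left_inv _ hx.1] at h3
    exact h3.mono_left nhdsWithin_le_nhds
  · have h1 : ContinuousOn (extChartAt 𝓘(ℝ, Mink d) p) G :=
      (continuousOn_extChartAt p).mono inter_subset_left
    have h2 : ContinuousOn (fun x : N ↦ extChartAt 𝓘(ℝ, Mink d) p x +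
        (δ * Real.exp (τ (extChartAt 𝓘(ℝ, Mink d) p x))) • e) G := by fun_prop
    exact (continuousOn_extChartAt_symm p).comp h2 fun x hx ↦ (hsub (hshift _ hx.2 δ hδ hδ').1).1
  · intro x hx
    set x' := extChartAt 𝓘(ℝ, Mink d) p x with hx'
    set s := δ * Real.exp (τ x') with hsdef
    have hs0 : 0 < s := mul_pos hδ (Real.exp_pos _)
    have hd : ∀ t, HasDerivAt (fun t : ℝ ↦ x' + t • s • e) (s • e) t := fun t ↦ by
      simpa using ((hasDerivAt_id t).smul_const (s • e)).const_add x'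
    have hmem : ∀ t ∈ Icc (0 : ℝ) 1, x' + t • s • e ∈
        Metric.ball (extChartAt 𝓘(ℝ, Mink d) p p) r := fun t ht ↦ by
      have := (convex_ball (extChartAt 𝓘(ℝ, Mink d) p p) r).add_smul_sub_mem (hbr x hx)
        (hshift _ hx.2 δ hδ hδ').1 ht
      rwa [add_sub_cancel_left] at this
    have h2 := chron_of_curve (g := g) (X := X) (O := O) hX (a := 0) (b := 1)
      (γ := fun t ↦ (extChartAt 𝓘(ℝ, Mink d) p).symm (x' + t • s • e)) one_pos fun t ht ↦
        isFutureAt_chart_symm (by fun_prop) (hsub (hmem t ht)) (by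
          rw [(hd t).deriv]
          exact coordCone_smul (he _ (hmem t ht)) hs0)
    simp only [zero_smul, add_zero, one_smul] at h2
    rw [hx', PartialEquiv.left_inv _ hx.1] at h2
    exact h2
  · intro x y hxy
    -- The shift takes a future timelike curve of `G` to a future timelike curve of `O`, so its ends
    -- remain chronologically related.
    have hlink : ∀ x y, Link g X G x y → Chron g X O
        ((extChartAt 𝓘(ℝ, Mink d) p).symm (extChartAt 𝓘(ℝ, Mink d) p x +
          (δ * Real.exp (τ (extChartAt 𝓘(ℝ, Mink d) p x))) • e))
        ((extChartAt 𝓘(ℝ, Mink d) p).symm (extChartAt 𝓘(ℝ, Mink d) p y +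
          (δ * Real.exp (τ (extChartAt 𝓘(ℝ, Mink d) p y))) • e)) := by
      intro x y hxy
      obtain ⟨γ, rfl, rfl, hγ⟩ := hxy.curve
      refine chron_of_curve (g := g) (X := X) (O := O) hX (a := 0) (b := 1)
        (γ := fun t ↦ (extChartAt 𝓘(ℝ, Mink d) p).symm (extChartAt 𝓘(ℝ, Mink d) p (γ t) +
          (δ * Real.exp (τ (extChartAt 𝓘(ℝ, Mink d) p (γ t)))) • e)) one_pos fun t ht ↦ ?_
      have h1 := hγ t ht
      have h2 := contDiffAt_chart_comp (c := p) h1.1 h1.mem.1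
      have h3 := h1.chart (c := p) h1.mem.1
      have h4 := hshift _ h1.mem.2 δ hδ hδ'
      set F := fun s ↦ extChartAt 𝓘(ℝ, Mink d) p (γ s) with hF
      have h5 : HasDerivAt F (deriv F t) t := (h2.differentiableAt one_ne_zero).hasDerivAt
      have h6 : HasDerivAt (fun s ↦ τ (F s)) (τ (deriv F t)) t := τ.hasFDerivAt.comp_hasDerivAt t h5
      have h7 : HasDerivAt (fun s ↦ F s + (δ * Real.exp (τ (F s))) • e)
          (deriv F t + (δ * (Real.exp (τ (F t)) * τ (deriv F t))) • e) t :=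
        h5.add ((h6.exp.const_mul δ).smul_const e)
      refine isFutureAt_chart_symm ?_ (hsub h4.1) ?_
      · have : ContDiffAt ℝ 1 (fun s ↦ τ (F s)) t := τ.contDiff.contDiffAt.comp t h2
        exact h2.add ((contDiffAt_const.mul this.exp).smul contDiffAt_const)
      · rw [h7.deriv, ← mul_assoc]
        exact h4.2 _ h3
    induction hxy with
    | single h => exact hlink _ _ h
    | tail _ h ih => exact ih.trans (hlink _ _ h)

end PushUp

/-- If from every point of `Q` near `p` one can go down to a point of `Q` far from `p`, then there
are descending sequences in `Q` without limit. -/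
theorem exists_seq_not_tendsto {N : Type*} [TopologicalSpace N] [SecondCountableTopology N]
    {R : N → N → Prop} {Q W : Set N} (hQW : Q ⊆ W)
    (hstep : ∀ p ∈ W, ∃ G, IsOpen G ∧ p ∈ G ∧ ∀ y ∈ Q ∩ G, ∃ y' ∈ Q, y' ∉ G ∧ R y' y) {y₀ : N}
    (hy₀ : y₀ ∈ Q) :
    ∃ z : ℕ → N, z 0 = y₀ ∧ (∀ n, z n ∈ Q) ∧ (∀ n, R (z (n + 1)) (z n)) ∧
      ∀ p ∈ W, ¬ Tendsto z atTop (𝓝 p) := by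
  choose! G hG hpG hGstep using hstep
  -- Second countability reduces the neighbourhoods that have to be left to countably many.
  obtain ⟨T, hTW, hT, hcov⟩ := TopologicalSpace.countable_cover_nhdsWithin (s := W) (f := G)
    fun p hp ↦ mem_nhdsWithin_of_mem_nhds ((hG p hp).mem_nhds (hpG p hp))
  have hTne : T.Nonempty := by
    obtain ⟨t, ht, -⟩ := mem_iUnion₂.1 (hcov (hQW hy₀))
    exact ⟨t, ht⟩
  obtain ⟨c, hc⟩ := hT.exists_eq_range hTne
  have hcW : ∀ i, c i ∈ W := fun i ↦ hTW (hc ▸ mem_range_self i)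
  have next : ∀ (i : ℕ) (y : Q), ∃ y' : Q, R y' y ∧ ((y : N) ∈ G (c i) → (y' : N) ∉ G (c i)) := by
    intro i y
    by_cases hy : (y : N) ∈ G (c i)
    · obtain ⟨y', h1, h2, h3⟩ := hGstep _ (hcW i) y ⟨y.2, hy⟩
      exact ⟨⟨y', h1⟩, h3, fun _ ↦ h2⟩
    · obtain ⟨y', h1, -, h3⟩ := hGstep _ (hQW y.2) y ⟨y.2, hpG _ (hQW y.2)⟩
      exact ⟨⟨y', h1⟩, h3, fun h ↦ absurd h hy⟩
  choose F hF hF' using next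
  -- Through the pairing of indices, every set of the countable cover has its turn infinitely often.
  -- A sequence with a limit would eventually stay in one of them, against the step that leaves it.
  set z : ℕ → Q := fun n ↦ Nat.rec ⟨y₀, hy₀⟩ (fun n y ↦ F (Nat.unpair n).1 y) n with hz
  refine ⟨fun n ↦ z n, rfl, fun n ↦ (z n).2, fun n ↦ hF _ _, fun p hp hlim ↦ ?_⟩
  obtain ⟨t, ht, hpt⟩ := mem_iUnion₂.1 (hcov hp)
  obtain ⟨i, rfl⟩ : t ∈ range c := hc ▸ ht
  obtain ⟨n₀, hn₀⟩ := eventually_atTop.1 (hlim.eventually ((hG _ (hcW i)).mem_nhds hpt))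
  have h1 := hn₀ (Nat.pair i n₀) (Nat.right_le_pair _ _)
  have h2 := hn₀ (Nat.pair i n₀ + 1) ((Nat.right_le_pair _ _).trans (Nat.le_succ _))
  have h3 := hF' (Nat.unpair (Nat.pair i n₀)).1 (z (Nat.pair i n₀))
  rw [Nat.unpair_pair] at h3
  refine h3 h1 ?_
  have h4 : z (Nat.pair i n₀ + 1) = F (Nat.unpair (Nat.pair i n₀)).1 (z (Nat.pair i n₀)) := rfl
  rw [Nat.unpair_pair] at h4
  rwa [← h4]

/-! ### Limits of chronological chains and inextensible curves -/

section Chains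
variable {d : ℕ} {N : Type} [TopologicalSpace N] [ChartedSpace (Mink d) N]
  [IsManifold 𝓘(ℝ, Mink d) ∞ N]
  {g : LorentzMetric d N} {X : ∀ x : N, TangentSpace 𝓘(ℝ, Mink d) x} {W O : Set N}

/-- The points above a cluster point of chains that start outside of compact sets have the descent
property of `exists_seq_not_tendsto`. -/
theorem exists_descent_of_escape [T2Space N] (hX : IsTimeOrientation g X W) {q : ℕ → N}
    (hq : ∀ p ∈ W, ∃ G ∈ 𝓝 p, ∀ᶠ j in atTop, q j ∉ G) {p : N} (hp : p ∈ W) :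
    ∃ G, IsOpen G ∧ p ∈ G ∧
      ∀ y ∈ {y | ∃ x, (∃ᶠ j in atTop, Chron g X W (q j) x) ∧ Chron g X W x y} ∩ G,
      ∃ y' ∈ {y | ∃ x, (∃ᶠ j in atTop, Chron g X W (q j) x) ∧ Chron g X W x y},
        y' ∉ G ∧ Chron g X W y' y := by
  have : LocallyCompactSpace N := ChartedSpace.locallyCompactSpace (Mink d) N
  have : Nonempty N := ⟨p⟩
  obtain ⟨G₀, Ψ, δ₀, hδ₀, hG₀, hpG₀, hG₀W, hΨlim, hΨ⟩ := exists_pushUp hX hp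
  obtain ⟨G₁, hG₁, hqG₁⟩ := hq p hp
  have hpU : p ∈ G₀ ∩ interior G₁ := ⟨hpG₀, mem_interior_iff_mem_nhds.2 hG₁⟩
  -- `C₂` lies where the shift is defined and is eventually avoided by the `q j`. As `C₁` lies in
  -- the interior of `C₂`, the frontier of `C₂` misses `C₁`.
  obtain ⟨C₂, hC₂, hpC₂, hC₂sub⟩ := exists_compact_subset (hG₀.inter isOpen_interior) hpU
  obtain ⟨C₁, hC₁, hpC₁, hC₁sub⟩ := exists_compact_subset isOpen_interior hpC₂
  have hC₁c := hC₁.isClosed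
  have hC₂c := hC₂.isClosed
  refine ⟨interior C₁, isOpen_interior, hpC₁, ?_⟩
  rintro y ⟨⟨x, hfreq, hxy⟩, hy⟩
  -- For `x` outside of `C₁`, a point just after `x` is already far enough from `p`.
  by_cases hx : x ∈ C₁
  swap
  · obtain ⟨r, hrC, hxr, hry⟩ := hxy.exists_between_left hX (hC₁c.isOpen_compl.mem_nhds hx)
    exact ⟨r, ⟨x, hfreq, hxr⟩, fun h ↦ hrC (interior_subset h), hry⟩
  set A := {j | Chron g X W (q j) x ∧ q j ∉ C₂} with hA
  have hAf : ∃ᶠ j in atTop, j ∈ A := (hfreq.and_eventually hqG₁).mono fun j hj ↦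
    ⟨hj.1, fun h ↦ hj.2 (interior_subset (hC₂sub h).2)⟩
  -- A chain from `q j` to `x` last enters `C₂` at a frontier point `w j` and then runs in `G₀`. By
  -- compactness these entry points cluster at some `w₀`.
  have hw : ∀ j ∈ A, ∃ w ∈ frontier C₂, Chron g X W (q j) w ∧ Chron g X G₀ w x := fun j hj ↦
    hj.1.exists_frontier hX hC₂c hG₀ (fun c hc ↦ (hC₂sub hc).1) hG₀W (hC₁sub hx) hj.2
  choose! w hwC hqw hwx using hw
  have hcomp : IsCompact (frontier C₂) := hC₂.of_isClosed_subset isClosed_frontier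
    hC₂c.frontier_subset
  have hne : (atTop ⊓ 𝓟 A).NeBot := frequently_mem_iff_neBot.1 hAf
  have hevA : ∀ᶠ j in atTop ⊓ 𝓟 A, j ∈ A := mem_inf_of_right (mem_principal_self A)
  obtain ⟨w₀, hw₀, hclus⟩ := hcomp.exists_mapClusterPt_of_frequently (l := atTop ⊓ 𝓟 A) (f := w)
    (hevA.mono fun j hj ↦ hwC j hj).frequently
  have hw₀G : w₀ ∈ G₀ := (hC₂sub (hC₂c.frontier_subset hw₀)).1
  have hw₀C : w₀ ∉ C₁ := fun h ↦ hw₀.2 (hC₁sub h)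
  have hxG₀ : x ∈ G₀ := (hC₂sub (interior_subset (hC₁sub hx))).1
  -- a small push
  obtain ⟨δ, ⟨hδ1, hδ2⟩, hδ3⟩ : ∃ δ, (0 < δ ∧ δ < δ₀) ∧ Chron g X W (Ψ δ x) y := by
    have h1 := (hΨlim x hxG₀).eventually hxy.eventually_left
    have h2 : ∀ᶠ δ in 𝓝[>] (0 : ℝ), 0 < δ ∧ δ < δ₀ := Ioo_mem_nhdsGT hδ₀
    exact (h2.and h1).exists
  obtain ⟨hΨc, hΨup, hΨmono⟩ := hΨ δ hδ1 hδ2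
  -- From `w j` before `x` one cannot conclude that `w₀` is before `x`. But `w₀` is strictly before
  -- `Ψ δ w₀`, and `Ψ δ (w j)` is before `Ψ δ x`, hence before `y`. So a point between `w₀` and `Ψ δ
  -- w₀` is before `y` and after infinitely many `q j`; near `w₀` it avoids `C₁`.
  obtain ⟨y', hy'C, hwy', hy'Ψ⟩ := (hΨup w₀ hw₀G).exists_between_left hX
    (hC₁c.isOpen_compl.mem_nhds hw₀C)
  obtain ⟨x', -, hwx', hx'y'⟩ := hwy'.exists_between_left hX univ_mem
  refine ⟨y', ⟨x', ?_, hx'y'⟩, fun h ↦ hy'C (interior_subset h), ?_⟩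
  · have h1 := hclus.frequently hwx'.eventually_left
    exact ((h1.and_eventually hevA).filter_mono inf_le_left).mono fun j hj ↦
      (hqw j hj.2).trans hj.1
  · have hc : ContinuousAt (Ψ δ) w₀ := hΨc.continuousAt (hG₀.mem_nhds hw₀G)
    have h1 := hclus.frequently (hc.eventually hy'Ψ.eventually_right)
    obtain ⟨j, hj, hjA⟩ := (h1.and_eventually hevA).exists
    exact (hj.trans (hΨmono _ _ (hwx j hjA))).trans hδ3

theorem IsFutureAt.isCausalCurve {β : ℝ → N} (h : ∀ t, IsFutureAt g X O β t) :
    IsCausalCurve g β univ := by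
  refine ⟨fun t _ ↦ (h t).1.contMDiffWithinAt, fun t _ ↦ ?_⟩
  rw [mfderivWithin_univ]
  have h1 : g.form (β t) (mfderiv 𝓘(ℝ, ℝ) 𝓘(ℝ, Mink d) β t (1 : ℝ))
    (mfderiv 𝓘(ℝ, ℝ) 𝓘(ℝ, Mink d) β t (1 : ℝ)) < 0 := (h t).2.2.1
  refine ⟨fun h0 ↦ ?_, h1.le⟩
  rw [h0] at h1
  simp at h1

/-- A chronological pair lies on an inextensible curve; in the past the curve comes from a set with
the descent property. -/
theorem exists_inextensible_curve [SecondCountableTopology N] (hX : IsTimeOrientation g X W)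
    {Q : Set N} (hQW : Q ⊆ W)
    (hstep : ∀ p ∈ W, ∃ G, IsOpen G ∧ p ∈ G ∧ ∀ y ∈ Q ∩ G, ∃ y' ∈ Q, y' ∉ G ∧ Chron g X W y' y)
    {p q : N} (hp : p ∈ Q) (hpq : Chron g X W p q) :
    ∃ β : ℝ → N, (∀ t, IsFutureAt g X W β t) ∧ IsInextensibleIn W β univ ∧ β 0 = p ∧ β 1 = q ∧
      ∀ t, ∃ y ∈ Q, Chron g X W y (β t) := by
  obtain ⟨a, ha0, haQ, ha, halim⟩ := exists_seq_not_tendsto hQW hstep hp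
  obtain ⟨b, hb0, -, hb, hblim⟩ := exists_seq_not_tendsto (R := Chron g (fun x ↦ -X x) W)
    Subset.rfl (fun p hp ↦ by
      obtain ⟨G, hG, hpG, h⟩ := exists_escape hX.neg hp
      refine ⟨G, hG, hpG, fun y hy ↦ ?_⟩
      obtain ⟨y', h1, h2⟩ := h y hy.2
      exact ⟨y', h2.left_mem, h1, h2⟩) hpq.right_mem
  -- The descending sequence supplies the indices up to `0`, where it equals `p`; the ascending one
  -- starts with `q` at the index `1`.
  set z : ℤ → N := fun k ↦ if 0 < k then b (k - 1).toNat else a (-k).toNat with hz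
  have hz1 : ∀ n : ℕ, z (n + 1) = b n := fun n ↦ by
    rw [hz]
    simp only
    rw [if_pos (by positivity)]
    congr 1
    omega
  have hz2 : ∀ n : ℕ, z (-n) = a n := fun n ↦ by
    rw [hz]
    simp only
    rw [if_neg (by omega)]
    congr 1
    omega
  obtain ⟨β, hβ, hβz⟩ := exists_curve_through (g := g) (X := X) (O := W) (z := z) fun k ↦ by
    rcases lt_trichotomy k 0 with hk | rfl | hk
    · obtain ⟨n, rfl⟩ : ∃ n : ℕ, k = -((n + 1 : ℕ) : ℤ) := ⟨(-k - 1).toNat, by omega⟩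
      have : -((n + 1 : ℕ) : ℤ) + 1 = -(n : ℤ) := by push_cast; ring
      rw [this, hz2, hz2]
      exact ha n
    · have h1 := hz1 0
      have h2 := hz2 0
      simp only [Nat.cast_zero, neg_zero] at h1 h2
      rw [h1, h2, ha0, hb0]
      exact hpq
    · obtain ⟨n, rfl⟩ : ∃ n : ℕ, k = (n : ℤ) + 1 := ⟨(k - 1).toNat, by omega⟩
      have h1 := hz1 (n + 1)
      push_cast at h1
      rw [hz1, h1]
      exact chron_neg_iff.1 (hb n)
  have hβ1 : ∀ n : ℕ, β (n + 1) = b n := fun n ↦ by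
    rw [← hz1, ← hβz]; push_cast; rfl
  have hβ2 : ∀ n : ℕ, β (-n) = a n := fun n ↦ by
    rw [← hz2, ← hβz]; push_cast; rfl
  refine ⟨β, hβ, fun p hp ↦ ⟨fun h ↦ hblim p hp ?_, fun h ↦ halim p hp ?_⟩, ?_, ?_, fun t ↦ ?_⟩
  · have : Tendsto (fun n : ℕ ↦ (⟨(n : ℝ) + 1, trivial⟩ : (univ : Set ℝ))) atTop atTop :=
      tendsto_atTop.2 fun s ↦ (tendsto_natCast_atTop_atTop.eventually_ge_atTop (s : ℝ)).mono
        fun n hn ↦ Subtype.coe_le_coe.1 (by simp only; linarith)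
    have h' := h.comp this
    simpa only [Function.comp_def, hβ1] using h'
  · have : Tendsto (fun n : ℕ ↦ (⟨-(n : ℝ), trivial⟩ : (univ : Set ℝ))) atTop atBot :=
      tendsto_atBot.2 fun s ↦ (tendsto_natCast_atTop_atTop.eventually_ge_atTop (-s : ℝ)).mono
        fun n hn ↦ Subtype.coe_le_coe.1 (by simp only; linarith)
    have h' := h.comp this
    simpa only [Function.comp_def, hβ2] using h'
  · simpa [ha0] using hβ2 0
  · simpa [hb0] using hβ1 0
  · obtain ⟨n, hn⟩ := exists_nat_gt (-t)
    refine ⟨a n, haQ n, ?_⟩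
    rw [← hβ2]
    exact chron_of_curve hX (by linarith) fun s _ ↦ hβ s

end Chains

/-! ### The causal order of Minkowski space -/

section Order
variable {d : ℕ}

/-- `q` lies in the causal future of `p`. -/
def CausalLE (p q : Mink d) : Prop := ‖q.2 - p.2‖ ≤ q.1 - p.1

/-- `q` lies in the chronological future of `p`. -/
def ChronLT (p q : Mink d) : Prop := ‖q.2 - p.2‖ < q.1 - p.1

theorem ChronLT.le {p q : Mink d} (h : ChronLT p q) : CausalLE p q := le_of_lt h

theorem CausalLE.refl (p : Mink d) : CausalLE p p := by simp [CausalLE]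

theorem norm_sub_le_add (p q r : Mink d) : ‖r.2 - p.2‖ ≤ ‖q.2 - p.2‖ + ‖r.2 - q.2‖ := by
  have := norm_add_le (q.2 - p.2) (r.2 - q.2)
  rwa [sub_add_sub_cancel'] at this

theorem CausalLE.trans {p q r : Mink d} (h₁ : CausalLE p q) (h₂ : CausalLE q r) : CausalLE p r := by
  have := norm_sub_le_add p q r
  unfold CausalLE at *
  linarith

theorem CausalLE.trans_chronLT {p q r : Mink d} (h₁ : CausalLE p q) (h₂ : ChronLT q r) :
    ChronLT p r := by
  have := norm_sub_le_add p q r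
  unfold CausalLE ChronLT at *
  linarith

theorem ChronLT.trans_causalLE {p q r : Mink d} (h₁ : ChronLT p q) (h₂ : CausalLE q r) :
    ChronLT p r := by
  have := norm_sub_le_add p q r
  unfold CausalLE ChronLT at *
  linarith

theorem chronLT_add_vertical (p : Mink d) {ε : ℝ} (hε : 0 < ε) : ChronLT p (p + (ε, 0)) := by
  simp [ChronLT, hε]

theorem chronLT_sub_vertical (p : Mink d) {ε : ℝ} (hε : 0 < ε) : ChronLT (p - (ε, 0)) p := by
  simp [ChronLT, hε]

theorem isOpen_chronLT : IsOpen {p : Mink d × Mink d | ChronLT p.1 p.2} :=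
  isOpen_lt (by fun_prop) (by fun_prop)

/-- A set containing all points between two of its points. -/
def IsOrderConvex (U : Set (Mink d)) : Prop :=
  ∀ p ∈ U, ∀ q ∈ U, ∀ r, CausalLE p r → CausalLE r q → r ∈ U

theorem minkForm_self (v : Mink d) : minkForm d v v = ‖v.2‖ ^ 2 - v.1 ^ 2 := by
  rw [minkForm_apply, real_inner_self_eq_norm_sq]; ring

theorem minkForm_vertical (v : Mink d) : minkForm d v (1, 0) = -v.1 := by
  simp [minkForm_apply]

theorem minkForm_self_neg_iff {v : Mink d} : minkForm d v v < 0 ↔ ‖v.2‖ < |v.1| := by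
  rw [minkForm_self, sub_neg, sq_lt_sq, abs_of_nonneg (norm_nonneg _)]

theorem minkForm_self_nonpos_iff {v : Mink d} : minkForm d v v ≤ 0 ↔ ‖v.2‖ ≤ |v.1| := by
  rw [minkForm_self, sub_nonpos, sq_le_sq, abs_of_nonneg (norm_nonneg _)]

theorem isTimeOrientation_vertical :
    IsTimeOrientation (minkowski d) (fun _ ↦ ((1, 0) : Mink d)) univ := by
  refine ⟨isOpen_univ, ?_, fun x _ ↦ ?_⟩
  · have h1 : Continuous fun x : Mink d ↦ (⟨x, ((1, 0) : Mink d)⟩ : TangentBundle 𝓘(ℝ, Mink d) (Mink d)) :=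
      (tangentBundleModelSpaceHomeomorph 𝓘(ℝ, Mink d)).symm.continuous.comp
        (by fun_prop : Continuous fun x : Mink d ↦ ((x, ((1, 0) : Mink d)) : Mink d × Mink d))
    exact h1.continuousOn
  · change minkForm d (1, 0) (1, 0) < 0
    rw [minkForm_vertical]
    norm_num

theorem mem_futureCone_minkowski {x v : Mink d} :
    v ∈ futureCone (minkowski d) (fun _ ↦ ((1, 0) : Mink d)) x ↔ ‖v.2‖ < v.1 := by
  have h : v ∈ futureCone (minkowski d) (fun _ ↦ ((1, 0) : Mink d)) x ↔
      minkForm d v v < 0 ∧ minkForm d v (1, 0) < 0 := Iff.rfl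
  rw [h, minkForm_self_neg_iff, minkForm_vertical, neg_lt_zero]
  constructor
  · rintro ⟨h1, h2⟩
    rwa [abs_of_pos h2] at h1
  · intro h
    have := (norm_nonneg _).trans_lt h
    exact ⟨by rwa [abs_of_pos this], this⟩

theorem isFutureAt_minkowski {O : Set (Mink d)} {γ : ℝ → Mink d} {t : ℝ}
    (h : ContDiffAt ℝ 1 γ t) (ht : γ t ∈ O) (hv : ‖(deriv γ t).2‖ < (deriv γ t).1) :
    IsFutureAt (minkowski d) (fun _ ↦ ((1, 0) : Mink d)) O γ t := by
  refine ⟨h.contMDiffAt, ht, ?_⟩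
  have : (mfderiv 𝓘(ℝ, ℝ) 𝓘(ℝ, Mink d) γ t (1 : ℝ) : Mink d) = deriv γ t := by
    rw [mfderiv_eq_fderiv]
    rfl
  rw [vel, this]
  exact mem_futureCone_minkowski.2 hv

theorem ChronLT.chron {p q : Mink d} (h : ChronLT p q) :
    Chron (minkowski d) (fun _ ↦ ((1, 0) : Mink d)) univ p q := by
  have hd : ∀ t, HasDerivAt (fun t : ℝ ↦ p + t • (q - p)) (q - p) t := fun t ↦ by
    simpa using ((hasDerivAt_id t).smul_const (q - p)).const_add p
  have := chron_of_curve (γ := fun t : ℝ ↦ p + t • (q - p)) isTimeOrientation_vertical one_pos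
    fun t _ ↦ isFutureAt_minkowski (by fun_prop) trivial (by rw [(hd t).deriv]; exact h)
  simpa using this

/-- Any two chronological steps are followed by a `C¹` causal curve. -/
theorem exists_isCausalCurve_through {p r q : Mink d} (hpr : ChronLT p r) (hrq : ChronLT r q) :
    ∃ γ : ℝ → Mink d, IsCausalCurve (minkowski d) γ (Icc 0 1) ∧ γ 0 = p ∧ γ (1 / 2) = r ∧ γ 1 = q := by
  -- The three points are continued vertically in both directions, since `exists_curve_through`
  -- takes bi-infinite sequences.
  set z : ℤ → Mink d := fun k ↦ if k < 0 then p + ((k + 1 : ℝ), 0) else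
    if k = 0 then r else q + ((k - 1 : ℝ), 0) with hz
  obtain ⟨β, hβ, hβz⟩ := exists_curve_through (g := minkowski d)
    (X := fun _ ↦ ((1, 0) : Mink d)) (O := univ) (z := z) fun k ↦ by
      refine ChronLT.chron ?_
      have hz0 : z 0 = r := by simp [hz]
      have hz1 : z 1 = q := by ext <;> simp [hz]
      have hz2 : z (-1) = p := by ext <;> simp [hz]
      rcases lt_trichotomy k 0 with hk | rfl | hk
      · rcases (show k + 1 ≤ 0 by omega).eq_or_lt with h | h
        · obtain rfl : k = -1 := by omega
          rw [neg_add_cancel, hz0, hz2]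
          exact hpr
        · simp [hz, hk, h, ChronLT]
      · rw [zero_add, hz0, hz1]
        exact hrq
      · have h1 : ¬ k + 1 < 0 := by omega
        have h2 : ¬ k + 1 = 0 := by omega
        simp only [hz, hk.not_gt, hk.ne', h1, h2, if_false]
        simp [ChronLT]
  have hγ : ∀ t, IsFutureAt (minkowski d) (fun _ ↦ ((1, 0) : Mink d)) univ
      (fun t ↦ β (2 * t + (-1))) t := fun t ↦ (hβ _).comp_affine two_pos
  refine ⟨fun t ↦ β (2 * t + (-1)), ⟨fun t _ ↦ (hγ t).1.contMDiffWithinAt, fun t ht ↦ ?_⟩, ?_, ?_, ?_⟩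
  · have h1 : MDifferentiableAt 𝓘(ℝ, ℝ) 𝓘(ℝ, Mink d) (fun t ↦ β (2 * t + (-1))) t :=
      (hγ t).1.mdifferentiableAt one_ne_zero
    rw [mfderivWithin_eq_mfderiv ((uniqueDiffOn_Icc zero_lt_one).uniqueMDiffOn t ht) h1]
    have h2 := IsFutureAt.isCausalCurve hγ
    have := h2.2 t trivial
    rwa [mfderivWithin_univ] at this
  · have := hβz (-1)
    simp [hz] at this
    simp [this]
  · have := hβz 0
    simp [hz] at this
    norm_num [this]
  · have := hβz 1
    simp [hz] at this
    norm_num [this]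

/-- Lowering the first point and raising the last one slightly within `U` makes both relations to
`r` chronological. Then a `C¹` timelike curve passes through `r`, even if the original relations are
null and the broken line has a corner. -/
theorem IsCausallyConvexIn.isOrderConvex {U : Set (Mink d)} (h : IsCausallyConvexIn (minkowski d) U)
    (hU : IsOpen U) : IsOrderConvex U := by
  intro p hp q hq r hpr hrq
  have hc : ∀ x ∈ U, ∀ᶠ ε : ℝ in 𝓝[>] 0, x + (ε, 0) ∈ U ∧ x - (ε, 0) ∈ U := by
    intro x hx
    have h1 : Tendsto (fun ε : ℝ ↦ x + ((ε, 0) : Mink d)) (𝓝[>] 0) (𝓝 x) := by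
      have : Continuous fun ε : ℝ ↦ x + ((ε, 0) : Mink d) := by fun_prop
      have := this.tendsto 0
      simp only [Prod.mk_zero_zero, add_zero] at this
      exact this.mono_left nhdsWithin_le_nhds
    have h2 : Tendsto (fun ε : ℝ ↦ x - ((ε, 0) : Mink d)) (𝓝[>] 0) (𝓝 x) := by
      have : Continuous fun ε : ℝ ↦ x - ((ε, 0) : Mink d) := by fun_prop
      have := this.tendsto 0
      simp only [Prod.mk_zero_zero, sub_zero] at this
      exact this.mono_left nhdsWithin_le_nhds
    exact (h1.eventually (hU.mem_nhds hx)).and (h2.eventually (hU.mem_nhds hx))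
  obtain ⟨ε, ⟨⟨-, hpε⟩, hqε, -⟩, hε⟩ :=
    (((hc p hp).and (hc q hq)).and (self_mem_nhdsWithin : ∀ᶠ ε : ℝ in 𝓝[>] 0, 0 < ε)).exists
  obtain ⟨γ, hγ, h0, h1, h2⟩ := exists_isCausalCurve_through
    ((chronLT_sub_vertical p hε).trans_causalLE hpr) (hrq.trans_chronLT (chronLT_add_vertical q hε))
  rw [← h1]
  exact h γ hγ (h0 ▸ hpε) (h2 ▸ hqε) _ (by norm_num)

/-- A curve with velocities in the future cone is monotone. -/
theorem causalLE_of_hasDerivWithinAt {γ γ' : ℝ → Mink d} {s t : ℝ} (hst : s ≤ t)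
    (hd : ∀ x ∈ Icc s t, HasDerivWithinAt γ (γ' x) (Icc s t) x)
    (hc : ∀ x ∈ Icc s t, ‖(γ' x).2‖ ≤ (γ' x).1) : CausalLE (γ s) (γ t) := by
  have hd' : ∀ x ∈ Ico s t, HasDerivWithinAt γ (γ' x) (Ici x) x := fun x hx ↦
    ((hd x ⟨hx.1, hx.2.le⟩).mono (Icc_subset_Icc_left hx.1)).mono_of_mem_nhdsWithin
      (Icc_mem_nhdsGE hx.2)
  have hcont : ContinuousOn γ (Icc s t) := fun x hx ↦ (hd x hx).continuousWithinAt
  have hfst : ∀ x ∈ Ico s t, HasDerivWithinAt (fun y ↦ (γ y).1 - (γ s).1) (γ' x).1 (Ici x) x :=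
    fun x hx ↦ ((ContinuousLinearMap.fst ℝ ℝ _).hasFDerivAt.comp_hasDerivWithinAt x (hd' x hx)).sub_const _
  have hsnd : ∀ x ∈ Ico s t, HasDerivWithinAt (fun y ↦ (γ y).2 - (γ s).2) (γ' x).2 (Ici x) x :=
    fun x hx ↦ ((ContinuousLinearMap.snd ℝ ℝ _).hasFDerivAt.comp_hasDerivWithinAt x (hd' x hx)).sub_const _
  exact image_norm_le_of_norm_deriv_right_le_deriv_boundary' (f := fun y ↦ (γ y).2 - (γ s).2)
    (f' := fun x ↦ (γ' x).2) (B := fun y ↦ (γ y).1 - (γ s).1) (B' := fun x ↦ (γ' x).1)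
    ((continuous_snd.comp_continuousOn hcont).sub continuousOn_const) hsnd (by simp)
    ((continuous_fst.comp_continuousOn hcont).sub continuousOn_const) hfst
    (fun x hx ↦ hc x ⟨hx.1, hx.2.le⟩) (right_mem_Icc.2 hst)

end Order

/-! ### Causal curves of Minkowski space -/

section CausalCurves
variable {d : ℕ}

theorem fst_lt_of_hasDerivWithinAt {γ γ' : ℝ → Mink d} {s t : ℝ} (hst : s < t)
    (hd : ∀ x ∈ Icc s t, HasDerivWithinAt γ (γ' x) (Icc s t) x)
    (hc : ∀ x ∈ Icc s t, 0 < (γ' x).1) : (γ s).1 < (γ t).1 := by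
  refine strictMonoOn_of_hasDerivWithinAt_pos (f := fun x ↦ (γ x).1) (f' := fun x ↦ (γ' x).1)
    (convex_Icc s t) ?_ (fun x hx ↦ ?_) (fun x hx ↦ hc x (interior_subset hx))
    (left_mem_Icc.2 hst.le) (right_mem_Icc.2 hst.le) hst
  · exact continuous_fst.comp_continuousOn fun x hx ↦ (hd x hx).continuousWithinAt
  · exact (ContinuousLinearMap.fst ℝ ℝ _).hasFDerivAt.comp_hasDerivWithinAt x
      ((hd x (interior_subset hx)).mono interior_subset)

theorem causalLE_neg {p q : Mink d} : CausalLE (-p) (-q) ↔ CausalLE q p := by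
  simp only [CausalLE, Prod.snd_neg, Prod.fst_neg]
  rw [neg_sub_neg, neg_sub_neg, norm_sub_rev, norm_sub_rev]

theorem CausalLE.of_tendsto {ι : Type*} {l : Filter ι} [l.NeBot] {u v : ι → Mink d} {p q : Mink d}
    (hu : Tendsto u l (𝓝 p)) (hv : Tendsto v l (𝓝 q)) (h : ∀ᶠ i in l, CausalLE (u i) (v i)) :
    CausalLE p q :=
  le_of_tendsto_of_tendsto (hv.snd_nhds.sub hu.snd_nhds).norm (hv.fst_nhds.sub hu.fst_nhds) h

/-- The curve is strictly future directed on `I`. -/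
def IsFutureOn (γ : ℝ → Mink d) (I : Set ℝ) : Prop :=
  ∀ s ∈ I, ∀ t ∈ I, s < t → CausalLE (γ s) (γ t) ∧ (γ s).1 < (γ t).1

/-- A causal curve is future or past directed. -/
theorem IsCausalCurve.isFutureOn_or {γ : ℝ → Mink d} {I : Set ℝ} (hI : I.OrdConnected)
    (h : IsCausalCurve (minkowski d) γ I) : IsFutureOn γ I ∨ IsFutureOn (-γ) I := by
  -- An interval with at most one point has no unique derivative, but also no two parameters to
  -- compare.
  by_cases hsub : I.Subsingleton
  · exact Or.inl fun s hs t ht hst ↦ absurd (hsub hs ht) hst.ne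
  have huniq : UniqueDiffOn ℝ I := by
    refine uniqueDiffOn_convex hI.convex ?_
    obtain ⟨a, ha, b, hb, hab⟩ := not_subsingleton_iff.1 hsub |>.exists_lt
    exact ⟨(a + b) / 2, interior_mono (hI.out ha hb) (by rw [interior_Icc]; constructor <;> linarith)⟩
  have hC : ContDiffOn ℝ 1 γ I := contMDiffOn_iff_contDiffOn.1 h.1
  set γ' := derivWithin γ I with hγ'
  have hcont : ContinuousOn (fun t ↦ (γ' t).1) I :=
    continuous_fst.comp_continuousOn (hC.continuousOn_derivWithin huniq le_rfl)
  have hd : ∀ t ∈ I, HasDerivWithinAt γ (γ' t) I t := fun t ht ↦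
    (hC.differentiableOn one_ne_zero t ht).hasDerivWithinAt
  have hcone : ∀ t ∈ I, ‖(γ' t).2‖ ≤ |(γ' t).1| ∧ (γ' t).1 ≠ 0 := by
    intro t ht
    have h1 : (mfderivWithin 𝓘(ℝ, ℝ) 𝓘(ℝ, Mink d) γ I t (1 : ℝ) : Mink d) = γ' t := by
      rw [mfderivWithin_eq_fderivWithin]
      rfl
    obtain ⟨h2, h3⟩ := h.2 t ht
    rw [h1] at h2 h3
    have h4 := minkForm_self_nonpos_iff.1 h3
    refine ⟨h4, fun h5 ↦ h2 ?_⟩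
    rw [h5, abs_zero] at h4
    exact Prod.ext h5 (norm_le_zero_iff.1 h4)
  -- The time component of the velocity is continuous and never zero: a causal vector without time
  -- component vanishes.
  have hsign : (∀ t ∈ I, 0 < (γ' t).1) ∨ ∀ t ∈ I, (γ' t).1 < 0 := by
    by_contra! hcon
    obtain ⟨⟨a, ha, ha'⟩, b, hb, hb'⟩ := hcon
    obtain ⟨c, hc, hc0⟩ := hI.isPreconnected.intermediate_value ha hb hcont ⟨ha', hb'⟩
    exact (hcone c hc).2 hc0
  rcases hsign with hpos | hneg
  · refine Or.inl fun s hs t ht hst ↦ ?_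
    have hsub := hI.out hs ht
    have hd' : ∀ x ∈ Icc s t, HasDerivWithinAt γ (γ' x) (Icc s t) x := fun x hx ↦
      (hd x (hsub hx)).mono hsub
    exact ⟨causalLE_of_hasDerivWithinAt hst.le hd' fun x hx ↦ by
      have := (hcone x (hsub hx)).1
      rwa [abs_of_pos (hpos x (hsub hx))] at this,
      fst_lt_of_hasDerivWithinAt hst hd' fun x hx ↦ hpos x (hsub hx)⟩
  · refine Or.inr fun s hs t ht hst ↦ ?_
    have hsub := hI.out hs ht
    have hd' : ∀ x ∈ Icc s t, HasDerivWithinAt (-γ) (-γ' x) (Icc s t) x := fun x hx ↦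
      ((hd x (hsub hx)).mono hsub).neg
    exact ⟨causalLE_of_hasDerivWithinAt hst.le hd' fun x hx ↦ by
      have := (hcone x (hsub hx)).1
      rw [abs_of_neg (hneg x (hsub hx))] at this
      rwa [Prod.snd_neg, norm_neg, Prod.fst_neg],
      fst_lt_of_hasDerivWithinAt hst hd' fun x hx ↦ by simpa using hneg x (hsub hx)⟩

/-! ### Regions between two graphs -/

/-- The points over `V` strictly between the graphs of `a` and `b`. -/
def slab (V : Set (EuclideanSpace ℝ (Fin d))) (a b : EuclideanSpace ℝ (Fin d) → ℝ) :
    Set (Mink d) := {p | p.2 ∈ V ∧ a p.2 < p.1 ∧ p.1 < b p.2}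

variable {V : Set (EuclideanSpace ℝ (Fin d))} {a b g : EuclideanSpace ℝ (Fin d) → ℝ}

/-- Reversal of time. -/
def timeRev (p : Mink d) : Mink d := (-p.1, p.2)

theorem timeRev_mem_slab {p : Mink d} : timeRev p ∈ slab V (-b) (-a) ↔ p ∈ slab V a b := by
  simp [slab, timeRev, and_comm]

theorem timeRev_timeRev (p : Mink d) : timeRev (timeRev p) = p := by simp [timeRev]

theorem continuous_timeRev : Continuous (timeRev (d := d)) := by
  unfold timeRev; fun_prop

theorem causalLE_timeRev {p q : Mink d} : CausalLE (timeRev p) (timeRev q) ↔ CausalLE q p := by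
  simp only [CausalLE, timeRev]
  rw [neg_sub_neg, norm_sub_rev]

theorem neg_le_sub_of_lipschitz {f : EuclideanSpace ℝ (Fin d) → ℝ} {s : Set (EuclideanSpace ℝ (Fin d))}
    (hf : LipschitzOnWith 1 f s) {x y : EuclideanSpace ℝ (Fin d)} (hx : x ∈ s) (hy : y ∈ s) :
    f x - f y ≤ ‖x - y‖ := by
  have := hf.norm_sub_le_mul hy hx
  rw [NNReal.coe_one, one_mul, Real.norm_eq_abs] at this
  exact (le_abs_self _).trans this

theorem closure_slab_subset (ha : LipschitzOnWith 1 a (closure V))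
    (hb : LipschitzOnWith 1 b (closure V)) {p : Mink d} (hp : p ∈ closure (slab V a b)) :
    p.2 ∈ closure V ∧ a p.2 ≤ p.1 ∧ p.1 ≤ b p.2 := by
  obtain ⟨u, hu, hlim⟩ := mem_closure_iff_seq_limit.1 hp
  have h2 : Tendsto (fun n ↦ (u n).2) atTop (𝓝 p.2) := (continuous_snd.tendsto p).comp hlim
  have h1 : Tendsto (fun n ↦ (u n).1) atTop (𝓝 p.1) := (continuous_fst.tendsto p).comp hlim
  have hmem : p.2 ∈ closure V := mem_closure_of_tendsto h2 (.of_forall fun n ↦ (hu n).1)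
  have hw : Tendsto (fun n ↦ (u n).2) atTop (𝓝[closure V] p.2) :=
    tendsto_nhdsWithin_iff.2 ⟨h2, .of_forall fun n ↦ subset_closure (hu n).1⟩
  exact ⟨hmem, le_of_tendsto_of_tendsto' ((ha.continuousOn _ hmem).tendsto.comp hw) h1
    fun n ↦ (hu n).2.1.le, le_of_tendsto_of_tendsto' h1 ((hb.continuousOn _ hmem).tendsto.comp hw)
    fun n ↦ (hu n).2.2.le⟩

/-- A point of the slab is not in the causal past of a point of the upper graph over the frontier. -/
theorem not_causalLE_of_mem_slab (ha : LipschitzOnWith 1 a (closure V)) {p q : Mink d}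
    (hp : p ∈ slab V a b) (hq : q.2 ∈ closure V) (hqa : q.1 ≤ a q.2) : ¬ CausalLE p q := by
  intro h
  have := neg_le_sub_of_lipschitz ha hq (subset_closure hp.1)
  have h2 := hp.2.1
  unfold CausalLE at h
  linarith

theorem not_causalLE_of_mem_slab' (hb : LipschitzOnWith 1 b (closure V)) {p q : Mink d}
    (hp : p ∈ slab V a b) (hq : q.2 ∈ closure V) (hqb : b q.2 ≤ q.1) : ¬ CausalLE q p := by
  intro h
  have := neg_le_sub_of_lipschitz hb (subset_closure hp.1) hq
  have h2 := hp.2.2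
  unfold CausalLE at h
  linarith

/-- A future directed curve without limit in the slab runs into its upper boundary. -/
theorem exists_above_of_not_tendsto {ι : Type*} [LinearOrder ι] [Nonempty ι]
    (hV : IsOpen V) (ha : LipschitzOnWith 1 a (closure V)) (hb : LipschitzOnWith 1 b (closure V))
    (hab : ∀ x ∈ frontier V, a x = b x) (hbdd : Bornology.IsBounded (slab V a b))
    (hg : Continuous g) (hgb : ∀ x ∈ V, g x < b x) {σ : ι → Mink d}
    (hσ : ∀ i, σ i ∈ slab V a b) (hmono : ∀ i j, i ≤ j → CausalLE (σ i) (σ j))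
    (hlim : ∀ p ∈ slab V a b, ¬ Tendsto σ atTop (𝓝 p)) : ∃ i, g (σ i).2 < (σ i).1 := by
  have h1 : Monotone fun i ↦ (σ i).1 := fun i j hij ↦ by
    have := hmono i j hij
    have h2 := norm_nonneg ((σ j).2 - (σ i).2)
    unfold CausalLE at this
    simp only
    linarith
  have hbd : BddAbove (range fun i ↦ (σ i).1) := by
    obtain ⟨C, hC⟩ := hbdd.exists_norm_le
    refine bddAbove_def.2 ⟨C, ?_⟩
    rintro _ ⟨i, rfl⟩
    exact (le_abs_self _).trans ((norm_fst_le _).trans (hC _ (hσ i)))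
  have ht := tendsto_atTop_ciSup h1 hbd
  obtain ⟨T, hTdef⟩ : ∃ T, T = ⨆ i, (σ i).1 := ⟨_, rfl⟩
  rw [← hTdef] at ht
  have hTle : ∀ i, (σ i).1 ≤ T := fun i ↦ by
    rw [hTdef]
    exact le_ciSup hbd i
  -- Time increases to a finite limit `T`, and spatial displacements are bounded by time
  -- differences.
  have hcauchy : CauchySeq fun i ↦ (σ i).2 := by
    have hle : ∀ i j, i ≤ j → dist (σ i).2 (σ j).2 ≤ T - (σ i).1 := fun i j hij ↦ by
      rw [dist_comm, dist_eq_norm]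
      have := hmono i j hij
      unfold CausalLE at this
      linarith [hTle j]
    have hlim0 : Tendsto (fun i ↦ T - (σ i).1) atTop (𝓝 0) := by
      rw [← sub_self T]
      exact ht.const_sub T
    exact cauchySeq_of_le_tendsto_0' (s := fun i ↦ (σ i).2) (fun i ↦ T - (σ i).1) hle hlim0
  obtain ⟨x, hx⟩ := cauchySeq_tendsto_of_complete hcauchy
  have hp : Tendsto σ atTop (𝓝 (T, x)) := ht.prodMk_nhds hx
  have hcl := closure_slab_subset ha hb (mem_closure_of_tendsto hp (.of_forall hσ))
  have hge : ∀ i, CausalLE (σ i) (T, x) := fun i ↦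
    CausalLE.of_tendsto tendsto_const_nhds hp ((eventually_ge_atTop i).mono fun j hj ↦ hmono i j hj)
  obtain ⟨i₀⟩ := ‹Nonempty ι›
  -- The limit is causally after a point of the slab, so it is strictly above the lower graph. Over
  -- the frontier the graphs coincide, which leaves no room for it; over `V` it must be on the upper
  -- graph, as it is not in the slab.
  have hTa : a x < T := by
    by_contra! h
    exact not_causalLE_of_mem_slab ha (hσ i₀) hcl.1 h (hge i₀)
  have hxV : x ∈ V := by
    by_contra hxV
    have hfr : x ∈ frontier V := by
      rw [hV.frontier_eq]
      exact ⟨hcl.1, hxV⟩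
    have h := hcl.2.2
    simp only at h
    linarith [hab x hfr]
  have hTb : T = b x := by
    by_contra h
    have hmem : (T, x) ∈ slab V a b := mem_ofPred_eq ▸ ⟨hxV, hTa, lt_of_le_of_ne hcl.2.2 h⟩
    exact hlim (T, x) hmem hp
  have : ∀ᶠ i in atTop, g (σ i).2 < (σ i).1 :=
    ((hg.tendsto x).comp hx).eventually_lt ht (by rw [hTb]; exact hgb x hxV)
  exact this.exists

theorem exists_below_of_not_tendsto {ι : Type*} [LinearOrder ι] [Nonempty ι]
    (hV : IsOpen V) (ha : LipschitzOnWith 1 a (closure V)) (hb : LipschitzOnWith 1 b (closure V))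
    (hab : ∀ x ∈ frontier V, a x = b x) (hbdd : Bornology.IsBounded (slab V a b))
    (hg : Continuous g) (hga : ∀ x ∈ V, a x < g x) {σ : ι → Mink d}
    (hσ : ∀ i, σ i ∈ slab V a b) (hmono : ∀ i j, i ≤ j → CausalLE (σ j) (σ i))
    (hlim : ∀ p ∈ slab V a b, ¬ Tendsto σ atTop (𝓝 p)) : ∃ i, (σ i).1 < g (σ i).2 := by
  have hbdd' : Bornology.IsBounded (slab V (-b) (-a)) := by
    obtain ⟨C, hC⟩ := hbdd.exists_norm_le
    refine isBounded_iff_forall_norm_le.2 ⟨C, fun p hp ↦ ?_⟩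
    have := hC (timeRev p) (timeRev_mem_slab.1 (by rwa [timeRev_timeRev]))
    simpa [timeRev, Prod.norm_def] using this
  obtain ⟨i, hi⟩ := exists_above_of_not_tendsto (σ := fun i ↦ timeRev (σ i)) (g := -g) hV hb.neg
    ha.neg (fun x hx ↦ by simp [hab x hx]) hbdd' hg.neg (fun x hx ↦ by simpa using hga x hx)
    (fun i ↦ timeRev_mem_slab.2 (hσ i)) (fun i j hij ↦ causalLE_timeRev.2 (hmono i j hij))
    fun p hp h ↦ hlim (timeRev p) (timeRev_mem_slab.1 (by rwa [timeRev_timeRev])) (by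
      have := (continuous_timeRev.tendsto p).comp h
      simpa only [Function.comp_def, timeRev_timeRev] using this)
  exact ⟨i, by simpa [timeRev] using hi⟩

end CausalCurves

/-! ### Cauchy hypersurfaces given by strict contractions -/

section Cauchy
variable {d : ℕ} {V : Set (EuclideanSpace ℝ (Fin d))} {a b g : EuclideanSpace ℝ (Fin d) → ℝ}

variable (V g) in
/-- The graph of `g` over `V`. -/
def graphOver : Set (Mink d) := {p | p.2 ∈ V ∧ p.1 = g p.2}

theorem isTopologicalHypersurface_graphOver (hV : IsOpen V) (hg : Continuous g) :
    IsTopologicalHypersurface d (graphOver V g) := by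
  let φ : Mink d ≃ₜ Mink d :=
    { toFun := fun p ↦ (p.1 - g p.2, p.2)
      invFun := fun p ↦ (p.1 + g p.2, p.2)
      left_inv := fun p ↦ by simp
      right_inv := fun p ↦ by simp
      continuous_toFun := by fun_prop
      continuous_invFun := by fun_prop }
  intro p hp
  have hs : IsOpen (Prod.snd ⁻¹' V : Set (Mink d)) := hV.preimage continuous_snd
  refine ⟨φ.toOpenPartialHomeomorph.restrOpen _ hs, ⟨trivial, hp.1⟩, fun x hx ↦ ?_⟩
  change x.2 ∈ V ∧ x.1 = g x.2 ↔ x.1 - g x.2 = 0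
  rw [sub_eq_zero]
  exact and_iff_right hx.2

/-- Distinct points of the graph of a strict contraction are spacelike to each other. The strict
inequality excludes null pairs as well. -/
theorem not_mem_graphOver (hcontr : ∀ x ∈ V, ∀ y ∈ V, x ≠ y → g x - g y < ‖x - y‖) {p q : Mink d}
    (hp : p ∈ graphOver V g) (h : CausalLE p q) (hlt : p.1 < q.1) : q ∉ graphOver V g := by
  intro hq
  unfold CausalLE at h
  by_cases hx : p.2 = q.2
  · rw [hp.2, hq.2, hx] at hlt
    exact lt_irrefl _ hlt
  · have := hcontr _ hq.1 _ hp.1 (Ne.symm hx)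
    rw [hp.2, hq.2] at h
    linarith

theorem exists_above_of_not_tendsto_atBot {ι : Type*} [LinearOrder ι] [Nonempty ι]
    (hV : IsOpen V) (ha : LipschitzOnWith 1 a (closure V)) (hb : LipschitzOnWith 1 b (closure V))
    (hab : ∀ x ∈ frontier V, a x = b x) (hbdd : Bornology.IsBounded (slab V a b))
    (hg : Continuous g) (hgb : ∀ x ∈ V, g x < b x) {σ : ι → Mink d}
    (hσ : ∀ i, σ i ∈ slab V a b) (hmono : ∀ i j, i ≤ j → CausalLE (σ j) (σ i))
    (hlim : ∀ p ∈ slab V a b, ¬ Tendsto σ atBot (𝓝 p)) : ∃ i, g (σ i).2 < (σ i).1 :=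
  exists_above_of_not_tendsto (ι := ιᵒᵈ) (σ := σ ∘ OrderDual.ofDual) hV ha hb hab hbdd hg hgb
    (fun i ↦ hσ (OrderDual.ofDual i)) (fun i j hij ↦ hmono (OrderDual.ofDual j) (OrderDual.ofDual i) hij)
    hlim

theorem exists_below_of_not_tendsto_atBot {ι : Type*} [LinearOrder ι] [Nonempty ι]
    (hV : IsOpen V) (ha : LipschitzOnWith 1 a (closure V)) (hb : LipschitzOnWith 1 b (closure V))
    (hab : ∀ x ∈ frontier V, a x = b x) (hbdd : Bornology.IsBounded (slab V a b))
    (hg : Continuous g) (hga : ∀ x ∈ V, a x < g x) {σ : ι → Mink d}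
    (hσ : ∀ i, σ i ∈ slab V a b) (hmono : ∀ i j, i ≤ j → CausalLE (σ i) (σ j))
    (hlim : ∀ p ∈ slab V a b, ¬ Tendsto σ atBot (𝓝 p)) : ∃ i, (σ i).1 < g (σ i).2 :=
  exists_below_of_not_tendsto (ι := ιᵒᵈ) (σ := σ ∘ OrderDual.ofDual) hV ha hb hab hbdd hg hga
    (fun i ↦ hσ (OrderDual.ofDual i)) (fun i j hij ↦ hmono (OrderDual.ofDual j) (OrderDual.ofDual i) hij)
    hlim

/-- The graph of a strict contraction between the two boundaries of a slab is a Cauchy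
hypersurface. -/
theorem isCauchyHypersurface_graphOver (hne : (slab V a b).Nonempty)
    (hV : IsOpen V) (ha : LipschitzOnWith 1 a (closure V)) (hb : LipschitzOnWith 1 b (closure V))
    (hab : ∀ x ∈ frontier V, a x = b x) (hbdd : Bornology.IsBounded (slab V a b))
    (hg : Continuous g) (hga : ∀ x ∈ V, a x < g x) (hgb : ∀ x ∈ V, g x < b x)
    (hcontr : ∀ x ∈ V, ∀ y ∈ V, x ≠ y → g x - g y < ‖x - y‖) :
    IsCauchyHypersurface (minkowski d) (slab V a b) (graphOver V g) := by
  refine ⟨fun p hp ↦ ⟨hp.1, ?_, ?_⟩, isTopologicalHypersurface_graphOver hV hg, ?_, ?_⟩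
  · rw [hp.2]; exact hga _ hp.1
  · rw [hp.2]; exact hgb _ hp.1
  · intro γ hγ _ h0 h1
    rcases hγ.isFutureOn_or ordConnected_Icc with h | h
    · obtain ⟨h2, h3⟩ := h 0 (by simp) 1 (by simp) one_pos
      exact not_mem_graphOver hcontr h0 h2 h3 h1
    · obtain ⟨h2, h3⟩ := h 0 (by simp) 1 (by simp) one_pos
      exact not_mem_graphOver hcontr h1 (causalLE_neg.1 h2) (neg_lt_neg_iff.1 h3) h0
  · intro I γ hI hγ hmaps hinext
    -- A curve on the empty interval converges to everything along trivial filters, so it is not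
    -- inextensible.
    have hIne : Nonempty I := by
      by_contra hemp
      rw [not_nonempty_iff] at hemp
      obtain ⟨p, hp⟩ := hne
      exact (hinext p hp).1 tendsto_of_isEmpty
    have hcont : ContinuousOn γ I := hγ.1.continuousOn
    have hhc : ContinuousOn (fun t ↦ (γ t).1 - g (γ t).2) I := by fun_prop
    -- The height above the graph changes sign along the curve, in either order of the parameters.
    have ivt : ∀ s t : I, g (γ s).2 < (γ s).1 → (γ t).1 < g (γ t).2 → ∃ t ∈ I, γ t ∈ graphOver V g := by
      intro s t hs ht
      obtain ⟨c, hc, hc0⟩ := hI.isPreconnected.intermediate_value t.2 s.2 hhc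
        (show (0 : ℝ) ∈ _ from ⟨(sub_neg.2 ht).le, (sub_pos.2 hs).le⟩)
      exact ⟨c, hc, (hmaps hc).1, sub_eq_zero.1 hc0⟩
    have hmem : ∀ i : I, γ i ∈ slab V a b := fun i ↦ hmaps i.2
    rcases hγ.isFutureOn_or hI with h | h
    · have hmono : ∀ i j : I, i ≤ j → CausalLE (γ i) (γ j) := fun i j hij ↦ by
        rcases hij.eq_or_lt with rfl | hij
        · exact CausalLE.refl _
        · exact (h i i.2 j j.2 hij).1
      obtain ⟨s, hs⟩ := exists_above_of_not_tendsto (σ := fun i : I ↦ γ i) hV ha hb hab hbdd hg hgb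
        hmem hmono fun p hp ↦ (hinext p hp).1
      obtain ⟨t, ht⟩ := exists_below_of_not_tendsto_atBot (σ := fun i : I ↦ γ i)
        hV ha hb hab hbdd hg hga hmem hmono fun p hp ↦ (hinext p hp).2
      obtain ⟨c, hc, hcS⟩ := ivt s t hs ht
      refine ⟨c, ⟨hc, hcS⟩, fun c' hc' ↦ ?_⟩
      rcases lt_trichotomy c' c with hlt | heq | hlt
      · obtain ⟨h1, h2⟩ := h c' hc'.1 c hc hlt
        exact absurd hcS (not_mem_graphOver hcontr hc'.2 h1 h2)
      · exact heq
      · obtain ⟨h1, h2⟩ := h c hc c' hc'.1 hlt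
        exact absurd hc'.2 (not_mem_graphOver hcontr hcS h1 h2)
    · have h : ∀ s ∈ I, ∀ t ∈ I, s < t → CausalLE (γ t) (γ s) ∧ (γ t).1 < (γ s).1 :=
        fun s hs t ht hst ↦ ⟨causalLE_neg.1 (h s hs t ht hst).1,
          neg_lt_neg_iff.1 (h s hs t ht hst).2⟩
      have hmono : ∀ i j : I, i ≤ j → CausalLE (γ j) (γ i) := fun i j hij ↦ by
        rcases hij.eq_or_lt with rfl | hij
        · exact CausalLE.refl _
        · exact (h i i.2 j j.2 hij).1
      obtain ⟨s, hs⟩ := exists_below_of_not_tendsto (σ := fun i : I ↦ γ i) hV ha hb hab hbdd hg hga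
        hmem hmono fun p hp ↦ (hinext p hp).1
      obtain ⟨t, ht⟩ := exists_above_of_not_tendsto_atBot (σ := fun i : I ↦ γ i)
        hV ha hb hab hbdd hg hgb hmem hmono fun p hp ↦ (hinext p hp).2
      obtain ⟨c, hc, hcS⟩ := ivt t s ht hs
      refine ⟨c, ⟨hc, hcS⟩, fun c' hc' ↦ ?_⟩
      rcases lt_trichotomy c' c with hlt | heq | hlt
      · obtain ⟨h1, h2⟩ := h c' hc'.1 c hc hlt
        exact absurd hc'.2 (not_mem_graphOver hcontr hcS h1 h2)
      · exact heq
      · obtain ⟨h1, h2⟩ := h c hc c' hc'.1 hlt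
        exact absurd hcS (not_mem_graphOver hcontr hc'.2 h1 h2)

/-- A strict contraction strictly between two `1`-Lipschitz functions. -/
theorem exists_contraction_between (hane : LipschitzOnWith 1 a V) (hbne : LipschitzOnWith 1 b V)
    (hlt : ∀ x ∈ V, a x < b x) {R : ℝ} (hR : ∀ x ∈ V, -R < a x ∧ b x < R) :
    ∀ x ∈ V, (a x < (a x + b x) / 2 - (b x ^ 2 - a x ^ 2) / (4 * R) ∧
      (a x + b x) / 2 - (b x ^ 2 - a x ^ 2) / (4 * R) < b x) ∧
      ∀ y ∈ V, x ≠ y → ((a x + b x) / 2 - (b x ^ 2 - a x ^ 2) / (4 * R)) -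
        ((a y + b y) / 2 - (b y ^ 2 - a y ^ 2) / (4 * R)) < ‖x - y‖ := by
  intro x hx
  obtain ⟨h1, h2⟩ := hR x hx
  have h3 := hlt x hx
  have hR0 : 0 < R := by linarith
  -- In this form, a difference of two values is a combination of the differences of `a` and of `b`
  -- with positive weights `2R + a x + a y` and `2R - b x - b y`. Their sum is less than `4R`
  -- because `a < b`, so the Lipschitz constant `1` becomes strict.
  have key : ∀ A B : ℝ, (A + B) / 2 - (B ^ 2 - A ^ 2) / (4 * R) =
      (A * (2 * R + A) + B * (2 * R - B)) / (4 * R) := fun A B ↦ by field_simp; ring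
  refine ⟨⟨?_, ?_⟩, fun y hy hxy ↦ ?_⟩
  · rw [key, lt_div_iff₀ (by positivity)]
    nlinarith
  · rw [key, div_lt_iff₀ (by positivity)]
    nlinarith
  · obtain ⟨h4, h5⟩ := hR y hy
    have h6 := hlt y hy
    have hn : 0 < ‖x - y‖ := norm_pos_iff.2 (sub_ne_zero.2 hxy)
    have hA1 := neg_le_sub_of_lipschitz hane hx hy
    have hB1 := neg_le_sub_of_lipschitz hbne hx hy
    rw [key, key, ← sub_div, div_lt_iff₀ (by positivity)]
    have e1 : a x * (2 * R + a x) + b x * (2 * R - b x) - (a y * (2 * R + a y) + b y * (2 * R - b y))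
        = (a x - a y) * (2 * R + a x + a y) + (b x - b y) * (2 * R - b x - b y) := by ring
    rw [e1]
    have m1 := mul_le_mul_of_nonneg_right hA1 (by linarith : 0 ≤ 2 * R + a x + a y)
    have m2 := mul_le_mul_of_nonneg_right hB1 (by linarith : 0 ≤ 2 * R - b x - b y)
    nlinarith

/-! ### Boundary data -/

theorem isOpen_spaceProj {U : Set (Mink d)} (hU : IsOpen U) : IsOpen (spaceProj U) :=
  isOpenMap_snd U hU

/-- The Lipschitz estimate for the upper boundary of an order convex set. -/
theorem exists_upper {U : Set (Mink d)} (hconv : IsOrderConvex U) (hb : Bornology.IsBounded U) :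
    ∃ f : EuclideanSpace ℝ (Fin d) → ℝ, LipschitzWith 1 f ∧
      ∀ x ∈ spaceProj U, IsLUB {t | (t, x) ∈ U} (f x) := by
  obtain ⟨C, hC⟩ := hb.exists_norm_le
  have hbd : ∀ x, BddAbove {t | (t, x) ∈ U} := fun x ↦ bddAbove_def.2 ⟨C, fun t ht ↦
    (le_abs_self t).trans ((norm_fst_le (t, x)).trans (hC _ ht))⟩
  set F : EuclideanSpace ℝ (Fin d) → ℝ := fun x ↦ sSup {t | (t, x) ∈ U} with hF
  have hlub : ∀ x ∈ spaceProj U, IsLUB {t | (t, x) ∈ U} (F x) := by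
    rintro _ ⟨p, hp, rfl⟩
    exact isLUB_csSup ⟨p.1, hp⟩ (hbd _)
  have hle : ∀ x ∈ spaceProj U, ∀ y ∈ spaceProj U, F y ≤ F x + ‖y - x‖ := by
    rintro _ ⟨p, hp, rfl⟩ y hy
    refine (hlub y hy).2 fun s hs ↦ ?_
    -- The point over `p.2` at height `s - ‖y - p.2‖` is causally before `(s, y)`. If it is above
    -- `p`, order convexity puts it into `U`; otherwise `p` itself is high enough.
    rcases le_total p.1 (s - ‖y - p.2‖) with h | h
    · have : s - ‖y - p.2‖ ≤ F p.2 := by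
        refine (hlub p.2 ⟨p, hp, rfl⟩).1 ?_
        refine hconv p hp (s, y) hs _ ?_ ?_
        · simpa [CausalLE] using h
        · simp [CausalLE]
      linarith
    · have : p.1 ≤ F p.2 := (hlub p.2 ⟨p, hp, rfl⟩).1 hp
      linarith
  have hlip : LipschitzOnWith 1 F (spaceProj U) := by
    refine LipschitzOnWith.of_le_add_mul 1 fun x hx y hy ↦ ?_
    rw [NNReal.coe_one, one_mul, dist_eq_norm]
    exact hle y hy x hx
  obtain ⟨f, hf, hfe⟩ := hlip.extend_real
  exact ⟨f, hf, fun x hx ↦ hfe hx ▸ hlub x hx⟩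

/-- Vertical lines are causal, so the fibres of an order convex set are intervals, open because the
set is. Their upper ends are treated by `exists_upper` and the lower ends by the same lemma after
time reversal. -/
theorem exists_boundaryData {U : Set (Mink d)} (hU : IsOpen U) (hconv : IsOrderConvex U)
    (hb : Bornology.IsBounded U) : ∃ a b, IsBoundaryData U a b := by
  obtain ⟨b, hbL, hbU⟩ := exists_upper hconv hb
  obtain ⟨a', haL, haU⟩ := exists_upper (U := timeRev ⁻¹' U)
    (fun p hp q hq r hpr hrq ↦ hconv _ hq _ hp _ (causalLE_timeRev.2 hrq) (causalLE_timeRev.2 hpr))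
    (by
      obtain ⟨C, hC⟩ := hb.exists_norm_le
      refine isBounded_iff_forall_norm_le.2 ⟨C, fun p hp ↦ ?_⟩
      simpa [timeRev, Prod.norm_def] using hC _ hp)
  have hproj : spaceProj (timeRev ⁻¹' U) = spaceProj U := by
    ext x
    constructor
    · rintro ⟨p, hp, rfl⟩
      exact ⟨_, hp, rfl⟩
    · rintro ⟨p, hp, rfl⟩
      exact ⟨timeRev p, by rwa [mem_preimage, timeRev_timeRev], rfl⟩
  rw [hproj] at haU
  have haU' : ∀ x ∈ spaceProj U, IsGLB {t | (t, x) ∈ U} (-a' x) := by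
    intro x hx
    have := haU x hx
    refine ⟨fun t ht ↦ ?_, fun c hc ↦ ?_⟩
    · have := this.1 (show -t ∈ _ by simpa [timeRev] using ht)
      linarith
    · have := this.2 (show -c ∈ upperBounds _ from fun t ht ↦ by
        have := hc (show -t ∈ {t | (t, x) ∈ U} by simpa [timeRev] using ht)
        linarith)
      linarith
  have hV := isOpen_spaceProj hU
  have hmem : ∀ p : Mink d, p ∈ U ↔ p.2 ∈ spaceProj U ∧ -a' p.2 < p.1 ∧ p.1 < b p.2 := by
    intro p
    constructor
    · intro hp
      have hx : p.2 ∈ spaceProj U := ⟨p, hp, rfl⟩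
      have hnhds : ∀ᶠ t in 𝓝 p.1, (t, p.2) ∈ U := by
        have hc : Continuous fun t : ℝ ↦ ((t, p.2) : Mink d) := by fun_prop
        exact hc.continuousAt.eventually (hU.mem_nhds hp)
      obtain ⟨ε, hε, hball⟩ := Metric.eventually_nhds_iff.1 hnhds
      refine ⟨hx, ?_, ?_⟩
      · have := (haU' _ hx).1 (show p.1 - ε / 2 ∈ _ from hball (by
          rw [Real.dist_eq, sub_sub_cancel_left, abs_neg, abs_of_pos] <;> linarith))
        linarith
      · have := (hbU _ hx).1 (show p.1 + ε / 2 ∈ _ from hball (by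
          rw [Real.dist_eq, add_sub_cancel_left, abs_of_pos] <;> linarith))
        linarith
    · rintro ⟨hx, h1, h2⟩
      obtain ⟨s, hs, hs1⟩ := (isGLB_lt_iff (haU' _ hx)).1 h1
      obtain ⟨t, ht, ht1⟩ := (lt_isLUB_iff (hbU _ hx)).1 h2
      exact hconv _ hs _ ht p (by simpa [CausalLE] using hs1.le) (by simpa [CausalLE] using ht1.le)
  refine ⟨fun x ↦ -a' x, b, (haL.neg).lipschitzOnWith, hbL.lipschitzOnWith, fun x hx ↦ ?_,
    Set.ext hmem⟩
  have hxV : x ∉ spaceProj U := by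
    rw [hV.frontier_eq] at hx
    exact hx.2
  have hle : ∀ y ∈ spaceProj U, -a' y < b y := fun y hy ↦ by
    obtain ⟨p, hp, rfl⟩ := hy
    have := (hmem p).1 hp
    linarith
  have hcl : x ∈ closure (spaceProj U) := frontier_subset_closure hx
  by_contra hne
  have hlt : -a' x < b x := lt_of_le_of_ne (by
    refine closure_minimal (fun y hy ↦ (hle y hy).le) ?_ hcl
    exact isClosed_le haL.continuous.neg hbL.continuous) hne
  -- One sixth of the supposed gap at `x`: for `y` within `ε` of `x`, both heights `m ± ε` lie in
  -- the fibre over `y`. The point `(m, x)` lies between these two points of `U`, which would put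
  -- `x` into `V`.
  set ε := (b x + a' x) / 6 with hε
  have hε0 : 0 < ε := by linarith
  obtain ⟨y, hy, hxy⟩ := Metric.mem_closure_iff.1 hcl ε hε0
  rw [dist_eq_norm] at hxy
  have hb1 := neg_le_sub_of_lipschitz hbL.lipschitzOnWith (mem_univ x) (mem_univ y)
  have ha1 := neg_le_sub_of_lipschitz haL.lipschitzOnWith (mem_univ x) (mem_univ y)
  set m := (b x - a' x) / 2 with hm
  refine hxV ⟨(m, x), hconv (m - ε, y) ?_ (m + ε, y) ?_ (m, x) ?_ ?_, rfl⟩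
  · exact (hmem _).2 ⟨hy, by simp only; linarith, by simp only; linarith⟩
  · exact (hmem _).2 ⟨hy, by simp only; linarith, by simp only; linarith⟩
  · simp only [CausalLE]
    linarith
  · simp only [CausalLE]
    rw [norm_sub_rev]
    linarith

end Cauchy

/-! ### Conformal maps from Minkowski space -/

section Conformal
variable {d : ℕ} {N : Type} [TopologicalSpace N] [ChartedSpace (Mink d) N]
  [IsManifold 𝓘(ℝ, Mink d) ∞ N]
  {g : LorentzMetric d N} {X : ∀ x : N, TangentSpace 𝓘(ℝ, Mink d) x} {U : Set (Mink d)} {W : Set N}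
  {f : Mink d → N}

theorem IsConformalOn.exists_pos (h : IsConformalOn (minkowski d) g U f) {x : Mink d} (hx : x ∈ U) :
    ∃ c : ℝ, 0 < c ∧ ∀ v w : Mink d, g.form (f x) (mfderiv 𝓘(ℝ, Mink d) 𝓘(ℝ, Mink d) f x v)
      (mfderiv 𝓘(ℝ, Mink d) 𝓘(ℝ, Mink d) f x w) = c * minkForm d v w := by
  obtain ⟨-, u, -, hu⟩ := h
  exact ⟨_, Real.exp_pos (u x), fun v w ↦ hu x hx v w⟩

theorem IsConformalOn.contMDiffAt (h : IsConformalOn (minkowski d) g U f) (hU : IsOpen U)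
    {x : Mink d} (hx : x ∈ U) : ContMDiffAt 𝓘(ℝ, Mink d) 𝓘(ℝ, Mink d) ∞ f x :=
  h.1.contMDiffAt (hU.mem_nhds hx)

/-- A conformal map is a local diffeomorphism. -/
theorem IsConformalOn.exists_local_inverse (h : IsConformalOn (minkowski d) g U f) (hU : IsOpen U)
    {x : Mink d} (hx : x ∈ U) :
    ∃ k : N → Mink d, ContMDiffAt 𝓘(ℝ, Mink d) 𝓘(ℝ, Mink d) ∞ k (f x) ∧ k (f x) = x ∧
      ∀ᶠ y in 𝓝 (f x), f (k y) = y := by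
  have hf := h.contMDiffAt hU hx
  set F : Mink d → Mink d := fun y ↦ extChartAt 𝓘(ℝ, Mink d) (f x) (f y) with hF
  have hFc : ContDiffAt ℝ ∞ F x := by
    rw [← contMDiffAt_iff_contDiffAt]
    exact (contMDiffAt_extChartAt (n := ∞)).comp x hf
  have hmd : mfderiv 𝓘(ℝ, Mink d) 𝓘(ℝ, Mink d) f x = fderiv ℝ F x := by
    rw [(hf.mdifferentiableAt (by simp)).mfderiv]
    simp only [writtenInExtChartAt, extChartAt_model_space_eq_id, PartialEquiv.refl_symm,
      PartialEquiv.refl_coe, Function.comp_id, modelWithCornersSelf_coe, range_id,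
      fderivWithin_univ, id]
    rfl
  -- A vector in the kernel is orthogonal to all vectors, by conformality, and the form is
  -- nondegenerate.
  have hinj : Function.Injective (fderiv ℝ F x) := by
    rw [injective_iff_map_eq_zero]
    intro v hv
    obtain ⟨c, hc, hform⟩ := h.exists_pos hx
    refine (minkowski d).nondegenerate (y := x) fun w ↦ ?_
    have h1 := hform v w
    rw [hmd] at h1
    have h2 : c * minkForm d v w = 0 := by
      rw [← h1]
      change g.form (f x) (fderiv ℝ F x v) _ = 0
      rw [hv]
      change (g.form (f x) 0) _ = 0
      rw [map_zero]
      rfl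
    exact (mul_eq_zero.1 h2).resolve_left hc.ne'
  set E : Mink d ≃L[ℝ] Mink d := (LinearEquiv.ofInjectiveEndo (fderiv ℝ F x).toLinearMap
    hinj).toContinuousLinearEquiv with hE
  have hd : HasFDerivAt F (E : Mink d →L[ℝ] Mink d) x := by
    have : (E : Mink d →L[ℝ] Mink d) = fderiv ℝ F x := by ext v <;> rfl
    rw [this]
    exact (hFc.differentiableAt (by simp)).hasFDerivAt
  set K := hFc.localInverse hd (by simp) with hK
  have hKc : ContDiffAt ℝ ∞ K (F x) := hFc.to_localInverse hd (by simp)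
  have hs := hFc.hasStrictFDerivAt' hd (by simp)
  have hKx : K (F x) = x := hs.localInverse_apply_image
  have hright : ∀ᶠ z in 𝓝 (F x), F (K z) = z := hs.eventually_right_inverse
  have hext : ContinuousAt (extChartAt 𝓘(ℝ, Mink d) (f x)) (f x) := continuousAt_extChartAt _
  have hk : ContMDiffAt 𝓘(ℝ, Mink d) 𝓘(ℝ, Mink d) ∞ (fun y ↦ K (extChartAt 𝓘(ℝ, Mink d) (f x) y))
      (f x) := ContMDiffAt.comp (g := K) (f x) hKc.contMDiffAt contMDiffAt_extChartAt
  refine ⟨fun y ↦ K (extChartAt 𝓘(ℝ, Mink d) (f x) y), hk, hKx, ?_⟩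
  have hsrc := (isOpen_extChartAt_source (I := 𝓘(ℝ, Mink d)) (f x)).mem_nhds
    (mem_extChartAt_source _)
  have hfk : ContinuousAt (fun y ↦ f (K (extChartAt 𝓘(ℝ, Mink d) (f x) y))) (f x) := by
    refine ContinuousAt.comp (g := f) ?_ hk.continuousAt
    change ContinuousAt f (K (F x))
    rw [hKx]
    exact hf.continuousAt
  have hval : f (K (extChartAt 𝓘(ℝ, Mink d) (f x) (f x))) = f x := congrArg f hKx
  have hsrc' : ∀ᶠ z in 𝓝 (f (K (extChartAt 𝓘(ℝ, Mink d) (f x) (f x)))),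
      z ∈ (extChartAt 𝓘(ℝ, Mink d) (f x)).source := by
    rw [hval]
    exact hsrc
  filter_upwards [hsrc, hext.eventually hright, hfk.eventually hsrc'] with y h1 h2 h3
  exact (extChartAt 𝓘(ℝ, Mink d) (f x)).injOn h3 h1 h2

theorem IsConformalOn.isOpen_image (h : IsConformalOn (minkowski d) g U f) (hU : IsOpen U) :
    IsOpen (f '' U) := by
  rw [isOpen_iff_mem_nhds]
  rintro _ ⟨x, hx, rfl⟩
  obtain ⟨k, hk, hkx, hfk⟩ := h.exists_local_inverse hU hx
  filter_upwards [hfk, hk.continuousAt.eventually (hkx.symm ▸ hU.mem_nhds hx)] with y h1 h2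
  exact ⟨k y, h2, h1⟩

variable (g X f) in
/-- The future directions of Minkowski space are mapped to future directions. -/
def IsFuturePreserving (U : Set (Mink d)) : Prop :=
  ∀ x ∈ U, mfderiv 𝓘(ℝ, Mink d) 𝓘(ℝ, Mink d) f x ((1, 0) : Mink d) ∈ futureCone g X (f x)

theorem vel_comp {η : ℝ → Mink d} {t : ℝ}
    (hf : ContMDiffAt 𝓘(ℝ, Mink d) 𝓘(ℝ, Mink d) ∞ f (η t)) (hη : ContDiffAt ℝ 1 η t) :
    ContMDiffAt 𝓘(ℝ, ℝ) 𝓘(ℝ, Mink d) 1 (fun s ↦ f (η s)) t ∧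
    (vel (fun s ↦ f (η s)) t : TangentBundle 𝓘(ℝ, Mink d) N) =
      ⟨f (η t), mfderiv 𝓘(ℝ, Mink d) 𝓘(ℝ, Mink d) f (η t) (deriv η t : Mink d)⟩ := by
  have hη' : ContMDiffAt 𝓘(ℝ, ℝ) 𝓘(ℝ, Mink d) 1 η t := hη.contMDiffAt
  refine ⟨(hf.of_le (by norm_cast)).comp t hη', TotalSpace.ext rfl (heq_of_eq ?_)⟩
  have h := mfderiv_comp t (hf.mdifferentiableAt (by simp)) (hη'.mdifferentiableAt one_ne_zero)
  change mfderiv 𝓘(ℝ, ℝ) 𝓘(ℝ, Mink d) (f ∘ η) t (1 : ℝ) = _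
  rw [h]
  simp only [mfderiv_eq_fderiv]
  rfl

theorem vel_comp_of_eq {η : ℝ → Mink d} {t : ℝ} {x v : Mink d} (hx : η t = x)
    (hf : ContMDiffAt 𝓘(ℝ, Mink d) 𝓘(ℝ, Mink d) ∞ f x) (hη : ContDiffAt ℝ 1 η t)
    (hv : deriv η t = v) :
    ContMDiffAt 𝓘(ℝ, ℝ) 𝓘(ℝ, Mink d) 1 (fun s ↦ f (η s)) t ∧
    (vel (fun s ↦ f (η s)) t : TangentBundle 𝓘(ℝ, Mink d) N) =
      ⟨f x, mfderiv 𝓘(ℝ, Mink d) 𝓘(ℝ, Mink d) f x v⟩ := by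
  subst hx hv
  exact vel_comp hf hη

theorem IsConformalOn.isFutureAt_comp (h : IsConformalOn (minkowski d) g U f) (hU : IsOpen U)
    (hX : IsTimeOrientation g X W) (hm : MapsTo f U W) (hfut : IsFuturePreserving g X f U)
    {η : ℝ → Mink d} {t : ℝ} (hη : ContDiffAt ℝ 1 η t) (ht : η t ∈ U)
    (hv : ‖(deriv η t).2‖ < (deriv η t).1) : IsFutureAt g X W (fun s ↦ f (η s)) t := by
  obtain ⟨h1, h2⟩ := vel_comp (h.contMDiffAt hU ht) hη
  refine ⟨h1, ?_⟩
  rw [h2]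
  obtain ⟨c, hc, hform⟩ := h.exists_pos ht
  have hpos : 0 < (deriv η t).1 := (norm_nonneg _).trans_lt hv
  refine ⟨hm ht, mem_futureCone_congr (hX.timelike _ (hm ht)) (hfut _ ht) ?_ ?_⟩
  · rw [hform]
    exact mul_neg_of_pos_of_neg hc (minkForm_self_neg_iff.2 (by rwa [abs_of_pos hpos]))
  · rw [hform, minkForm_vertical]
    exact mul_neg_of_pos_of_neg hc (neg_lt_zero.2 hpos)

theorem IsConformalOn.deriv_mem_of_isFutureAt (h : IsConformalOn (minkowski d) g U f) (hU : IsOpen U)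
    (hX : IsTimeOrientation g X W) (hfut : IsFuturePreserving g X f U)
    {η : ℝ → Mink d} {t : ℝ} (hη : ContDiffAt ℝ 1 η t) (ht : η t ∈ U)
    (hβ : IsFutureAt g X W (fun s ↦ f (η s)) t) : ‖(deriv η t).2‖ < (deriv η t).1 := by
  obtain ⟨-, h2⟩ := vel_comp (h.contMDiffAt hU ht) hη
  obtain ⟨-, h3, h4⟩ := hβ
  rw [h2] at h3 h4
  obtain ⟨c, hc, hform⟩ := h.exists_pos ht
  have h5 := form_neg_of_mem_futureCone (hX.timelike _ h3) h4 (hfut _ ht)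
  have h6 := h4.1
  change g.form (f (η t)) _ _ < 0 at h5
  change g.form (f (η t)) _ _ < 0 at h6
  rw [hform] at h5 h6
  rw [minkForm_vertical] at h5
  have h7 := minkForm_self_neg_iff.1 ((pos_iff_neg_of_mul_neg h6).1 hc)
  rwa [abs_of_pos (neg_lt_zero.1 ((pos_iff_neg_of_mul_neg h5).1 hc))] at h7

/-- On a connected set, a conformal map preserves or reverses the time orientations. -/
theorem IsConformalOn.isFuturePreserving_or (h : IsConformalOn (minkowski d) g U f) (hU : IsOpen U)
    (hconn : IsPreconnected U) (hX : IsTimeOrientation g X W) (hm : MapsTo f U W) :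
    IsFuturePreserving g X f U ∨ IsFuturePreserving g (fun x ↦ -X x) f U := by
  -- Applied to `X` and to `-X`, this gives two disjoint open sets covering `U`. The condition is
  -- read off vertical lines, whose images are curves, so that the chart description of future
  -- curves applies.
  have hopen : ∀ Y : ∀ x : N, TangentSpace 𝓘(ℝ, Mink d) x, IsTimeOrientation g Y W →
      IsOpen {x | x ∈ U ∧ mfderiv 𝓘(ℝ, Mink d) 𝓘(ℝ, Mink d) f x ((1, 0) : Mink d) ∈
        futureCone g Y (f x)} := by
    intro Y hY
    have hline : ∀ x ∈ U, (mfderiv 𝓘(ℝ, Mink d) 𝓘(ℝ, Mink d) f x ((1, 0) : Mink d) ∈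
        futureCone g Y (f x) ↔ IsFutureAt g Y W (fun s : ℝ ↦ f (x + s • ((1, 0) : Mink d))) 0) := by
      intro x hx
      have hd : HasDerivAt (fun s : ℝ ↦ x + s • ((1, 0) : Mink d)) (1, 0) 0 := by
        simpa using ((hasDerivAt_id (0 : ℝ)).smul_const ((1, 0) : Mink d)).const_add x
      obtain ⟨h1, h2⟩ := vel_comp_of_eq (f := f) (η := fun s : ℝ ↦ x + s • ((1, 0) : Mink d)) (t := 0)
        (by simp) (h.contMDiffAt hU hx) (by fun_prop) hd.deriv
      constructor
      · intro h3
        refine ⟨h1, ?_⟩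
        rw [h2]
        exact ⟨hm hx, h3⟩
      · intro h3
        have h4 := h3.2
        rw [h2] at h4
        exact h4.2
    rw [isOpen_iff_mem_nhds]
    rintro x₀ ⟨hx₀, hfx₀⟩
    set c := f x₀
    set F : Mink d → Mink d := fun y ↦ extChartAt 𝓘(ℝ, Mink d) c (f y) with hF
    have hFc : ContDiffAt ℝ ∞ F x₀ := by
      rw [← contMDiffAt_iff_contDiffAt]
      exact (contMDiffAt_extChartAt (n := ∞)).comp x₀ (h.contMDiffAt hU hx₀)
    have hcont := (h.contMDiffAt hU hx₀).continuousAt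
    have hderiv : ∀ x, DifferentiableAt ℝ F x → deriv (fun s : ℝ ↦
        extChartAt 𝓘(ℝ, Mink d) c (f (x + s • ((1, 0) : Mink d)))) 0 = fderiv ℝ F x (1, 0) := by
      intro x hx
      have hd : HasDerivAt (fun s : ℝ ↦ x + s • ((1, 0) : Mink d)) (1, 0) 0 := by
        simpa using ((hasDerivAt_id (0 : ℝ)).smul_const ((1, 0) : Mink d)).const_add x
      have hx' : HasFDerivAt F (fderiv ℝ F x) (x + (0 : ℝ) • ((1, 0) : Mink d)) := by
        simpa using hx.hasFDerivAt
      exact (hx'.comp_hasDerivAt 0 hd).deriv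
    have hF1 : ∀ᶠ x in 𝓝 x₀, DifferentiableAt ℝ F x :=
      (hFc.of_le (by norm_cast) : ContDiffAt ℝ 1 F x₀).eventually (by simp) |>.mono
        fun x hx ↦ hx.differentiableAt one_ne_zero
    have hpair : ContinuousAt (fun x ↦ (F x, fderiv ℝ F x ((1, 0) : Mink d))) x₀ :=
      hFc.continuousAt.prodMk ((hFc.continuousAt_fderiv (by simp)).clm_apply continuousAt_const)
    have hS := isOpen_coordCone (g := g) hY.isOpen hY.continuousOn c
    have h0 : (F x₀, fderiv ℝ F x₀ ((1, 0) : Mink d)) ∈ {p : Mink d × Mink d |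
        p.1 ∈ chartDom c W ∧ p.2 ∈ coordCone g Y c p.1} := by
      refine ⟨⟨(extChartAt 𝓘(ℝ, Mink d) c).map_source (mem_extChartAt_source _), ?_⟩, ?_⟩
      · rw [mem_preimage, PartialEquiv.left_inv _ (mem_extChartAt_source _)]
        exact hm hx₀
      · have h1 := ((hline x₀ hx₀).1 hfx₀).chart (c := c) (by
          simp only [zero_smul, add_zero]
          exact mem_extChartAt_source _)
        rw [hderiv x₀ hF1.self_of_nhds] at h1
        simpa only [zero_smul, add_zero] using h1
    filter_upwards [hU.mem_nhds hx₀, hF1, hpair.eventually (hS.mem_nhds h0),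
      hcont.eventually ((isOpen_extChartAt_source (I := 𝓘(ℝ, Mink d)) c).mem_nhds
        (mem_extChartAt_source _)), (hFc.of_le (by norm_cast) : ContDiffAt ℝ 1 F x₀).eventually
        (by simp)] with x hx hx1 hx2 hx3 hx4
    refine ⟨hx, (hline x hx).2 ?_⟩
    have h2 := isFutureAt_chart_symm (g := g) (X := Y) (O := W) (c := c) (t := 0)
      (F := fun s : ℝ ↦ F (x + s • ((1, 0) : Mink d))) ?_ ?_ ?_
    · refine h2.congr (eventuallyEq_chart ?_ ?_)
      · have : ContinuousAt f (x + (0 : ℝ) • ((1, 0) : Mink d)) := by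
          simpa using (h.contMDiffAt hU hx).continuousAt
        exact ContinuousAt.comp (g := f) (f := fun s : ℝ ↦ x + s • ((1, 0) : Mink d)) this
          (by fun_prop)
      · simp only [zero_smul, add_zero]
        exact hx3
    · have : ContDiffAt ℝ 1 F (x + (0 : ℝ) • ((1, 0) : Mink d)) := by simpa using hx4
      exact ContDiffAt.comp (g := F) (f := fun s : ℝ ↦ x + s • ((1, 0) : Mink d)) 0 this
        (by fun_prop)
    · simpa only [zero_smul, add_zero] using hx2.1
    · rw [hderiv x hx1]
      simpa only [zero_smul, add_zero] using hx2.2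
  have hneg : ∀ x ∈ U, g.form (f x) (mfderiv 𝓘(ℝ, Mink d) 𝓘(ℝ, Mink d) f x ((1, 0) : Mink d))
      (mfderiv 𝓘(ℝ, Mink d) 𝓘(ℝ, Mink d) f x ((1, 0) : Mink d)) < 0 := by
    intro x hx
    obtain ⟨c, hc, hform⟩ := h.exists_pos hx
    rw [hform, minkForm_vertical]
    simpa using hc
  have hcov : ∀ x ∈ U, mfderiv 𝓘(ℝ, Mink d) 𝓘(ℝ, Mink d) f x ((1, 0) : Mink d) ∈
      futureCone g X (f x) ∨ mfderiv 𝓘(ℝ, Mink d) 𝓘(ℝ, Mink d) f x ((1, 0) : Mink d) ∈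
      futureCone g (fun x ↦ -X x) (f x) := by
    intro x hx
    rcases lt_or_gt_of_ne (g.ne_zero_of_timelike (hneg x hx) (hX.timelike _ (hm hx))) with h1 | h1
    · exact Or.inl ⟨hneg x hx, h1⟩
    · exact Or.inr ⟨hneg x hx, by rw [map_neg]; exact neg_lt_zero.2 h1⟩
  have hdisj : ∀ x, mfderiv 𝓘(ℝ, Mink d) 𝓘(ℝ, Mink d) f x ((1, 0) : Mink d) ∈
      futureCone g X (f x) → mfderiv 𝓘(ℝ, Mink d) 𝓘(ℝ, Mink d) f x ((1, 0) : Mink d) ∉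
      futureCone g (fun x ↦ -X x) (f x) := by
    intro x h1 h2
    have h3 := h2.2
    rw [map_neg] at h3
    linarith [h1.2, neg_lt_zero.1 h3]
  have := isPreconnected_iff_subset_of_disjoint.1 hconn _ _ (hopen X hX) (hopen _ hX.neg)
    (fun x hx ↦ (hcov x hx).imp (fun h ↦ ⟨hx, h⟩) fun h ↦ ⟨hx, h⟩)
    (by
      ext x
      simp only [mem_inter_iff, mem_ofPred_eq, mem_empty_iff_false, iff_false]
      rintro ⟨-, ⟨-, h1⟩, -, h2⟩
      exact hdisj x h1 h2)
  exact this.imp (fun h x hx ↦ (h hx).2) fun h x hx ↦ (h hx).2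

end Conformal

/-- If a curve ends inside of a component of the preimage of an open set, then it does so at the end
of the whole curve. -/
theorem tendsto_atTop_of_component {Z : Type*} [TopologicalSpace Z] [T2Space Z] {β : ℝ → Z}
    (hβ : Continuous β) {T : Set ℝ} (hT : IsOpen T) {t₀ : ℝ} (ht₀ : t₀ ∈ T) {z : Z}
    (hz : ∀ t, β t = z → t ∈ T)
    (h : Tendsto (fun t : connectedComponentIn T t₀ ↦ β t) atTop (𝓝 z)) :
    Tendsto (fun t : (univ : Set ℝ) ↦ β t) atTop (𝓝 z) := by
  set I := connectedComponentIn T t₀ with hI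
  have hIo : IsOpen I := hT.connectedComponentIn
  have hord : I.OrdConnected := isPreconnected_connectedComponentIn.ordConnected
  have hmem : t₀ ∈ I := mem_connectedComponentIn ht₀
  have hne : Nonempty I := ⟨⟨t₀, hmem⟩⟩
  -- A finite supremum `b` of the component would satisfy `β b = z`, hence `b ∈ T`. Then `b` would
  -- be in the open component, which would extend beyond its supremum.
  by_cases hbd : BddAbove I
  · exfalso
    have hlub := isLUB_csSup ⟨t₀, hmem⟩ hbd
    set b := sSup I
    have hcoe : Tendsto (fun t : I ↦ (t : ℝ)) atTop (𝓝 b) :=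
      tendsto_atTop_isLUB (fun s t h ↦ h) (by simpa using hlub)
    have hbz : β b = z := tendsto_nhds_unique ((hβ.tendsto b).comp hcoe) h
    have hbT : b ∈ T := hz b hbz
    have hbI : b ∈ I := by
      have h1 : IsPreconnected (insert b I) :=
        isPreconnected_connectedComponentIn.subset_closure (subset_insert _ _)
          (insert_subset (hlub.mem_closure ⟨t₀, hmem⟩) subset_closure)
      exact h1.subset_connectedComponentIn (mem_insert_of_mem _ hmem)
        (insert_subset hbT (connectedComponentIn_subset _ _)) (mem_insert _ _)
    have hev : ∀ᶠ c in 𝓝[>] b, c ∈ I := nhdsWithin_le_nhds (hIo.mem_nhds hbI)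
    obtain ⟨c, hcI, hbc⟩ := (hev.and (self_mem_nhdsWithin : ∀ᶠ c in 𝓝[>] b, b < c)).exists
    exact (hlub.1 hcI).not_gt hbc
  · rw [tendsto_def]
    intro s hs
    obtain ⟨i, hi⟩ := mem_atTop_sets.1 (tendsto_def.1 h s hs)
    refine mem_atTop_sets.2 ⟨⟨i, trivial⟩, fun t ht ↦ ?_⟩
    obtain ⟨c, hc, hct⟩ := not_bddAbove_iff.1 hbd t
    exact hi ⟨t, hord.out i.2 hc ⟨ht, hct.le⟩⟩ ht

theorem tendsto_atBot_of_component {Z : Type*} [TopologicalSpace Z] [T2Space Z] {β : ℝ → Z}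
    (hβ : Continuous β) {T : Set ℝ} (hT : IsOpen T) {t₀ : ℝ} (ht₀ : t₀ ∈ T) {z : Z}
    (hz : ∀ t, β t = z → t ∈ T)
    (h : Tendsto (fun t : connectedComponentIn T t₀ ↦ β t) atBot (𝓝 z)) :
    Tendsto (fun t : (univ : Set ℝ) ↦ β t) atBot (𝓝 z) := by
  set I := connectedComponentIn T t₀ with hI
  have hIo : IsOpen I := hT.connectedComponentIn
  have hord : I.OrdConnected := isPreconnected_connectedComponentIn.ordConnected
  have hmem : t₀ ∈ I := mem_connectedComponentIn ht₀
  have hne : Nonempty I := ⟨⟨t₀, hmem⟩⟩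
  by_cases hbd : BddBelow I
  · exfalso
    have hglb := isGLB_csInf ⟨t₀, hmem⟩ hbd
    set b := sInf I
    have hcoe : Tendsto (fun t : I ↦ (t : ℝ)) atBot (𝓝 b) :=
      tendsto_atBot_isGLB (fun s t h ↦ h) (by simpa using hglb)
    have hbz : β b = z := tendsto_nhds_unique ((hβ.tendsto b).comp hcoe) h
    have hbT : b ∈ T := hz b hbz
    have hbI : b ∈ I := by
      have h1 : IsPreconnected (insert b I) :=
        isPreconnected_connectedComponentIn.subset_closure (subset_insert _ _)
          (insert_subset (hglb.mem_closure ⟨t₀, hmem⟩) subset_closure)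
      exact h1.subset_connectedComponentIn (mem_insert_of_mem _ hmem)
        (insert_subset hbT (connectedComponentIn_subset _ _)) (mem_insert _ _)
    have hev : ∀ᶠ c in 𝓝[<] b, c ∈ I := nhdsWithin_le_nhds (hIo.mem_nhds hbI)
    obtain ⟨c, hcI, hbc⟩ := (hev.and (self_mem_nhdsWithin : ∀ᶠ c in 𝓝[<] b, c < b)).exists
    exact (hglb.1 hcI).not_gt hbc
  · rw [tendsto_def]
    intro s hs
    obtain ⟨i, hi⟩ := mem_atBot_sets.1 (tendsto_def.1 h s hs)
    refine mem_atBot_sets.2 ⟨⟨i, trivial⟩, fun t ht ↦ ?_⟩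
    obtain ⟨c, hc, hct⟩ := not_bddBelow_iff.1 hbd t
    exact hi ⟨t, hord.out hc i.2 ⟨hct.le, ht⟩⟩ ht

/-! ### Conformal maps that respect Cauchy hypersurfaces -/

section CauchyMap
variable {d : ℕ} {N : Type} [TopologicalSpace N] [T2Space N] [SecondCountableTopology N]
  [ChartedSpace (Mink d) N] [IsManifold 𝓘(ℝ, Mink d) ∞ N]

/-- A one-to-one conformal map that preserves the future and maps the Cauchy hypersurface `S` to a
Cauchy hypersurface. -/
structure IsCauchyMap (g : LorentzMetric d N) (X : ∀ x : N, TangentSpace 𝓘(ℝ, Mink d) x)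
    (U S : Set (Mink d)) (W : Set N) (f : Mink d → N) : Prop where
  isOpen : IsOpen U
  orientation : IsTimeOrientation g X W
  mapsTo : MapsTo f U W
  injOn : InjOn f U
  conformal : IsConformalOn (minkowski d) g U f
  future : IsFuturePreserving g X f U
  cauchy : IsCauchyHypersurface (minkowski d) U S
  cauchy_image : IsCauchyHypersurface g W (f '' S)

variable {g : LorentzMetric d N} {X : ∀ x : N, TangentSpace 𝓘(ℝ, Mink d) x}
  {U S : Set (Mink d)} {W : Set N} {f : Mink d → N}

theorem IsCauchyMap.exists_mem (h : IsCauchyMap g X U S W f) {β : ℝ → N}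
    {Y : ∀ x : N, TangentSpace 𝓘(ℝ, Mink d) x}
    (hβ : ∀ t, IsFutureAt g Y W β t) (hinext : IsInextensibleIn W β univ) :
    ∃ t, β t ∈ f '' S ∧ ∀ t', β t' ∈ f '' S → t' = t := by
  obtain ⟨t, ⟨-, ht⟩, huniq⟩ := h.cauchy_image.2.2.2 univ β ordConnected_univ
    (IsFutureAt.isCausalCurve hβ) (fun t _ ↦ (hβ t).mem) hinext
  exact ⟨t, ht, fun t' ht' ↦ huniq t' ⟨trivial, ht'⟩⟩

/-- Future timelike curves in the image lift to future timelike curves. -/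
theorem IsCauchyMap.lift (h : IsCauchyMap g X U S W f) {β : ℝ → N} {t : ℝ}
    (hβ : IsFutureAt g X W β t) (ht : β t ∈ f '' U) :
    ContDiffAt ℝ 1 (fun s ↦ Function.invFunOn f U (β s)) t ∧
      ‖(deriv (fun s ↦ Function.invFunOn f U (β s)) t).2‖ <
        (deriv (fun s ↦ Function.invFunOn f U (β s)) t).1 := by
  obtain ⟨x, hx, hxt⟩ := ht
  obtain ⟨k, hk, hkx, hfk⟩ := h.conformal.exists_local_inverse h.isOpen hx
  rw [hxt] at hk hkx hfk
  have hc : ContinuousAt β t := hβ.1.continuousAt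
  have heq : (fun s ↦ k (β s)) =ᶠ[𝓝 t] fun s ↦ Function.invFunOn f U (β s) := by
    filter_upwards [hc.eventually hfk, (hk.continuousAt.comp hc).eventually
      (show U ∈ 𝓝 (k (β t)) from hkx.symm ▸ h.isOpen.mem_nhds hx)] with s h1 h2
    have h3 : k (β s) ∈ U := h2
    rw [← h.injOn.leftInvOn_invFunOn h3, h1]
  have hC : ContDiffAt ℝ 1 (fun s ↦ k (β s)) t :=
    contMDiffAt_iff_contDiffAt.1 (ContMDiffAt.comp t (hk.of_le (by norm_cast)) hβ.1)
  rw [← heq.deriv_eq]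
  refine ⟨hC.congr_of_eventuallyEq heq.symm, h.conformal.deriv_mem_of_isFutureAt h.isOpen
    h.orientation h.future hC (by rw [hkx]; exact hx) (hβ.congr ?_)⟩
  filter_upwards [hc.eventually hfk] with s hs
  exact hs.symm

/-- Every component of the parameters in the image lifts to an inextensible causal curve of `U`,
which meets `S`. As the whole curve meets the image of `S` only once, there is at most one
component. -/
theorem IsCauchyMap.ordConnected (h : IsCauchyMap g X U S W f) {β : ℝ → N}
    (hβ : ∀ t, IsFutureAt g X W β t) (hinext : IsInextensibleIn W β univ) :
    (β ⁻¹' (f '' U)).OrdConnected := by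
  have hc : Continuous β := continuous_iff_continuousAt.2 fun t ↦ (hβ t).1.continuousAt
  have hT : IsOpen (β ⁻¹' (f '' U)) := (h.conformal.isOpen_image h.isOpen).preimage hc
  set T := β ⁻¹' (f '' U)
  set σ := fun s ↦ Function.invFunOn f U (β s) with hσ
  have hσU : ∀ t ∈ T, σ t ∈ U ∧ f (σ t) = β t := fun t ht ↦
    ⟨Function.invFunOn_mem ht, Function.invFunOn_eq ht⟩
  have hmeet : ∀ t₀ ∈ T, ∃ t ∈ connectedComponentIn T t₀, β t ∈ f '' S := by
    intro t₀ ht₀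
    set I := connectedComponentIn T t₀ with hI
    have hIo : IsOpen I := hT.connectedComponentIn
    have hIT : I ⊆ T := connectedComponentIn_subset _ _
    have hcausal : IsCausalCurve (minkowski d) σ I := by
      refine ⟨fun t ht ↦ ((h.lift (hβ t) (hIT ht)).1.contMDiffAt).contMDiffWithinAt, fun t ht ↦ ?_⟩
      rw [mfderivWithin_of_mem_nhds (hIo.mem_nhds ht)]
      have h1 : (mfderiv 𝓘(ℝ, ℝ) 𝓘(ℝ, Mink d) σ t (1 : ℝ) : Mink d) = deriv σ t := by
        rw [mfderiv_eq_fderiv]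
        rfl
      rw [h1]
      have h2 := (h.lift (hβ t) (hIT ht)).2
      refine ⟨fun h0 ↦ ?_, minkForm_self_nonpos_iff.2 (h2.le.trans (le_abs_self _))⟩
      change deriv σ t = 0 at h0
      rw [h0] at h2
      simp at h2
    -- An endpoint of the lift in `U` would map to a limit of `β` along this component, hence to an
    -- endpoint of `β` itself.
    have hlim : ∀ p ∈ U, ∀ l : Filter I, Tendsto (fun t : I ↦ σ t) l (𝓝 p) →
        Tendsto (fun t : I ↦ β t) l (𝓝 (f p)) := by
      intro p hp l hl
      have := ((h.conformal.contMDiffAt h.isOpen hp).continuousAt.tendsto).comp hl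
      refine this.congr fun t ↦ (hσU t (hIT t.2)).2
    obtain ⟨t, ⟨ht, htS⟩, -⟩ := h.cauchy.2.2.2 I σ
      isPreconnected_connectedComponentIn.ordConnected hcausal (fun t ht ↦ (hσU t (hIT ht)).1)
      fun p hp ↦ ⟨fun hl ↦ (hinext (f p) (h.mapsTo hp)).1 (tendsto_atTop_of_component hc hT ht₀
          (fun t ht ↦ ⟨p, hp, ht.symm⟩) (hlim p hp _ hl)),
        fun hl ↦ (hinext (f p) (h.mapsTo hp)).2 (tendsto_atBot_of_component hc hT ht₀
          (fun t ht ↦ ⟨p, hp, ht.symm⟩) (hlim p hp _ hl))⟩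
    exact ⟨t, ht, σ t, htS, (hσU t (hIT ht)).2⟩
  obtain ⟨τ, -, huniq⟩ := h.exists_mem hβ hinext
  refine ⟨fun s hs t ht ↦ ?_⟩
  obtain ⟨s', hs', hsS⟩ := hmeet s hs
  obtain ⟨t', ht', htS⟩ := hmeet t ht
  rw [huniq s' hsS] at hs'
  rw [huniq t' htS] at ht'
  have heq : connectedComponentIn T s = connectedComponentIn T t :=
    (connectedComponentIn_eq hs').trans (connectedComponentIn_eq ht').symm
  have h1 : t ∈ connectedComponentIn T s := heq ▸ mem_connectedComponentIn ht
  exact (isPreconnected_connectedComponentIn.ordConnected.out (mem_connectedComponentIn hs) h1).trans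
    (connectedComponentIn_subset _ _)

theorem exists_descent (hX : IsTimeOrientation g X W) {p : N} (hp : p ∈ W) :
    ∃ G, IsOpen G ∧ p ∈ G ∧ ∀ y ∈ W ∩ G, ∃ y' ∈ W, y' ∉ G ∧ Chron g X W y' y := by
  obtain ⟨G, hG, hpG, h⟩ := exists_escape hX hp
  refine ⟨G, hG, hpG, fun y hy ↦ ?_⟩
  obtain ⟨y', h1, h2⟩ := h y hy.2
  exact ⟨y', h2.left_mem, h1, h2⟩

theorem exists_chron_right (hX : IsTimeOrientation g X W) {p : N} (hp : p ∈ W) :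
    ∃ q, Chron g X W p q := by
  obtain ⟨G, -, hpG, h⟩ := exists_escape hX.neg hp
  obtain ⟨q, -, hq⟩ := h p hpG
  exact ⟨q, chron_neg_iff.1 hq⟩

/-- The inverse of a Cauchy map preserves the causal order. -/
theorem IsCauchyMap.causalLE_of_chron (h : IsCauchyMap g X U S W f) {u v : Mink d} (hu : u ∈ U)
    (hv : v ∈ U) (huv : Chron g X W (f u) (f v)) : CausalLE u v := by
  -- The connecting curve is taken inextensible, so that its part between the two image points
  -- cannot leave the image and can be lifted.
  obtain ⟨β, hβ, hinext, h0, h1, -⟩ := exists_inextensible_curve h.orientation Subset.rfl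
    (fun p hp ↦ exists_descent h.orientation hp) (h.mapsTo hu) huv
  have hsub := (h.ordConnected hβ hinext).out (show β 0 ∈ f '' U from h0 ▸ mem_image_of_mem f hu)
    (show β 1 ∈ f '' U from h1 ▸ mem_image_of_mem f hv)
  have := causalLE_of_hasDerivWithinAt zero_le_one
    (γ := fun s ↦ Function.invFunOn f U (β s)) (γ' := deriv fun s ↦ Function.invFunOn f U (β s))
    (fun t ht ↦ ((h.lift (hβ t) (hsub ht)).1.differentiableAt one_ne_zero).hasDerivAt.hasDerivWithinAt)
    fun t ht ↦ (h.lift (hβ t) (hsub ht)).2.le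
  simp only [h0, h1] at this
  rwa [h.injOn.leftInvOn_invFunOn hu, h.injOn.leftInvOn_invFunOn hv] at this

theorem IsCauchyMap.chron (h : IsCauchyMap g X U S W f) (hconv : IsOrderConvex U) {u v : Mink d}
    (hu : u ∈ U) (hv : v ∈ U) (huv : ChronLT u v) : Chron g X W (f u) (f v) := by
  have hd : ∀ t, HasDerivAt (fun t : ℝ ↦ u + t • (v - u)) (v - u) t := fun t ↦ by
    simpa using ((hasDerivAt_id t).smul_const (v - u)).const_add u
  have := chron_of_curve (γ := fun t : ℝ ↦ f (u + t • (v - u))) h.orientation one_pos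
    fun t ht ↦ h.conformal.isFutureAt_comp h.isOpen h.orientation h.mapsTo h.future
      (η := fun t : ℝ ↦ u + t • (v - u)) (by fun_prop)
      (hconv u hu v hv _ (by
        simp only [CausalLE, Prod.snd_add, Prod.fst_add, Prod.smul_snd, Prod.smul_fst,
          add_sub_cancel_left, norm_smul, Real.norm_of_nonneg ht.1, smul_eq_mul, Prod.fst_sub,
          Prod.snd_sub]
        exact mul_le_mul_of_nonneg_left huv.le ht.1) (by
        have e : v - (u + t • (v - u)) = (1 - t) • (v - u) := by
          rw [sub_smul, one_smul]; abel
        have e1 := congrArg Prod.fst e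
        have e2 := congrArg Prod.snd e
        simp only [Prod.fst_sub, Prod.snd_sub, Prod.smul_fst, Prod.smul_snd, smul_eq_mul] at e1 e2
        have h1t : 0 ≤ 1 - t := by linarith [ht.2]
        unfold CausalLE
        rw [e1, e2, norm_smul, Real.norm_of_nonneg h1t]
        exact mul_le_mul_of_nonneg_left huv.le h1t))
      (by rw [(hd t).deriv]; exact huv)
  simpa using this

end CauchyMap

/-! ### The criterion for maximality -/

section Maximal
variable {d : ℕ} {N : Type} [TopologicalSpace N] [T2Space N] [SecondCountableTopology N]
  [ChartedSpace (Mink d) N] [IsManifold 𝓘(ℝ, Mink d) ∞ N]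
  {g : LorentzMetric d N} {X : ∀ x : N, TangentSpace 𝓘(ℝ, Mink d) x}
  {U S : Set (Mink d)} {W : Set N} {f : Mink d → N}

theorem CausalLE.of_frequently {u : ℕ → Mink d} {p q : Mink d} (hu : Tendsto u atTop (𝓝 p))
    (h : ∃ᶠ j in atTop, CausalLE (u j) q) : CausalLE p q := by
  have hne : (atTop ⊓ 𝓟 {j | CausalLE (u j) q}).NeBot := frequently_mem_iff_neBot.1 h
  exact CausalLE.of_tendsto (hu.mono_left inf_le_left) tendsto_const_nhds
    (mem_inf_of_right (mem_principal_self _))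

theorem CausalLE.of_frequently' {u : ℕ → Mink d} {p q : Mink d} (hu : Tendsto u atTop (𝓝 p))
    (h : ∃ᶠ j in atTop, CausalLE q (u j)) : CausalLE q p := by
  have hne : (atTop ⊓ 𝓟 {j | CausalLE q (u j)}).NeBot := frequently_mem_iff_neBot.1 h
  exact CausalLE.of_tendsto tendsto_const_nhds (hu.mono_left inf_le_left)
    (mem_inf_of_right (mem_principal_self _))

/-- The point is causally related to no point of `U`. -/
def IsSpacelikeTo (U : Set (Mink d)) (q : Mink d) : Prop :=
  ∀ u ∈ U, ¬ CausalLE u q ∧ ¬ CausalLE q u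

/-- Sequences that converge to a point spacelike to `U` have images that leave every compact set. -/
theorem IsCauchyMap.escapes (h : IsCauchyMap g X U S W f) {q : Mink d} (hq : IsSpacelikeTo U q)
    {u : ℕ → Mink d} (hu : ∀ j, u j ∈ U) (hlim : Tendsto u atTop (𝓝 q)) {w : N} (hw : w ∈ W) :
    ∃ G ∈ 𝓝 w, ∀ᶠ j in atTop, f (u j) ∉ G := by
  by_contra! hcon
  obtain ⟨w', hw'⟩ := exists_chron_right h.orientation hw
  obtain ⟨β, hβ, hinext, h0, -, -⟩ := exists_inextensible_curve h.orientation Subset.rfl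
    (fun p hp ↦ exists_descent h.orientation hp) hw hw'
  have hc : Continuous β := continuous_iff_continuousAt.2 fun t ↦ (hβ t).1.continuousAt
  have hT : IsOpen (β ⁻¹' (f '' U)) := (h.conformal.isOpen_image h.isOpen).preimage hc
  obtain ⟨t, htS, -⟩ := h.exists_mem hβ hinext
  have htT : t ∈ β ⁻¹' (f '' U) := image_mono h.cauchy.1 htS
  -- The curve meets the open image also at a time other than `0`, and there at a point `f v`
  -- strictly before or after `w`. This relation is open at `w`, so it holds with infinitely many `f
  -- (u j)`; in the limit `v` is causally related to `q`.
  obtain ⟨s, hsT, hs0⟩ : ∃ s ∈ β ⁻¹' (f '' U), s ≠ 0 := by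
    by_cases ht0 : t = 0
    · have h1 : ∀ᶠ s in 𝓝[>] t, s ∈ β ⁻¹' (f '' U) := nhdsWithin_le_nhds (hT.mem_nhds htT)
      obtain ⟨s, hs, hst⟩ := (h1.and (self_mem_nhdsWithin : ∀ᶠ s in 𝓝[>] t, t < s)).exists
      exact ⟨s, hs, ht0 ▸ (ne_of_gt hst)⟩
    · exact ⟨t, htT, ht0⟩
  obtain ⟨v, hv, hvs⟩ := hsT
  rcases lt_or_gt_of_ne hs0 with hs | hs
  · have h1 : Chron g X W (f v) w := by
      rw [hvs, ← h0]
      exact chron_of_curve h.orientation hs fun t _ ↦ hβ t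
    have h2 := hcon _ h1.eventually_right
    refine (hq v hv).1 (CausalLE.of_frequently' hlim (h2.mono fun j hj ↦ ?_))
    exact h.causalLE_of_chron hv (hu j) hj
  · have h1 : Chron g X W w (f v) := by
      rw [hvs, ← h0]
      exact chron_of_curve h.orientation hs fun t _ ↦ hβ t
    have h2 := hcon _ h1.eventually_left
    refine (hq v hv).2 (CausalLE.of_frequently hlim (h2.mono fun j hj ↦ ?_))
    exact h.causalLE_of_chron (hu j) hv hj

/-- If points of the image that leave every compact set precede points converging in `W`, then they
precede a point of the Cauchy hypersurface. -/
theorem IsCauchyMap.exists_frequently_chron (h : IsCauchyMap g X U S W f)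
    {Y : ∀ x : N, TangentSpace 𝓘(ℝ, Mink d) x} (hY : IsTimeOrientation g Y W) {q c : ℕ → N} {z : N}
    (hz : z ∈ W) (hc : Tendsto c atTop (𝓝 z)) (hq : ∀ w ∈ W, ∃ G ∈ 𝓝 w, ∀ᶠ j in atTop, q j ∉ G)
    (hqc : ∀ j, ∀ᶠ i in atTop, Chron g Y W (q j) (c i)) :
    ∃ u ∈ S, ∃ᶠ j in atTop, Chron g Y W (q j) (f u) := by
  obtain ⟨x, hx⟩ := exists_chron_right hY hz
  obtain ⟨y, hy⟩ := exists_chron_right hY hx.right_mem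
  obtain ⟨y', hy'⟩ := exists_chron_right hY hy.right_mem
  -- Descent within `Q` gives an inextensible curve all of whose points are after infinitely many `q
  -- j`; its intersection with the Cauchy hypersurface is the required point.
  set Q := {y | ∃ x, (∃ᶠ j in atTop, Chron g Y W (q j) x) ∧ Chron g Y W x y} with hQ
  have hyQ : y ∈ Q := by
    refine ⟨x, (Eventually.of_forall fun j ↦ ?_).frequently, hy⟩
    obtain ⟨i, h1, h2⟩ := ((hqc j).and (hc.eventually hx.eventually_left)).exists
    exact h1.trans h2
  obtain ⟨β, hβ, hinext, -, -, hβQ⟩ := exists_inextensible_curve hY (Q := Q)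
    (fun y ⟨x, _, h2⟩ ↦ h2.right_mem) (fun p hp ↦ exists_descent_of_escape hY hq hp) hyQ hy'
  obtain ⟨t, ⟨u, hu, hut⟩, -⟩ := h.exists_mem hβ hinext
  obtain ⟨y₁, ⟨x₁, h1, h2⟩, h3⟩ := hβQ t
  refine ⟨u, hu, h1.mono fun j hj ↦ ?_⟩
  rw [hut]
  exact (hj.trans h2).trans h3

/-- A Cauchy map is onto as soon as every boundary point of the domain is related to sequences that
converge to points spacelike to the domain. -/
theorem IsCauchyMap.surjOn (h : IsCauchyMap g X U S W f) (hconv : IsOrderConvex U)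
    (hbdd : Bornology.IsBounded U) (hne : U.Nonempty) (hW : IsPreconnected W)
    (hfr : ∀ p ∈ frontier U, ∃ (q : Mink d) (x : ℕ → Mink d), (∀ j, x j ∈ U) ∧
      Tendsto x atTop (𝓝 q) ∧ IsSpacelikeTo U q ∧
      (p = q ∨ (∀ j, ChronLT (x j) p) ∨ ∀ j, ChronLT p (x j))) : SurjOn f U W := by
  have hopen := h.conformal.isOpen_image h.isOpen
  by_contra hnot
  -- Otherwise the open image would also be closed in the connected `W`.
  obtain ⟨z, hzW, hzcl, hzf⟩ : ∃ z ∈ W, z ∈ closure (f '' U) ∧ z ∉ f '' U := by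
    by_contra! hcon
    refine hnot (hW.subset_left_of_subset_union hopen
      (isClosed_closure (s := f '' U)).isOpen_compl ?_ ?_ ?_)
    · exact disjoint_compl_right_iff_subset.2 subset_closure
    · intro w hw
      by_cases hwc : w ∈ closure (f '' U)
      · exact Or.inl (hcon w hw hwc)
      · exact Or.inr hwc
    · obtain ⟨u, hu⟩ := hne
      exact ⟨f u, h.mapsTo hu, mem_image_of_mem f hu⟩
  have : FirstCountableTopology N := inferInstance
  obtain ⟨y, hyU, hylim⟩ := mem_closure_iff_seq_limit.1 hzcl
  choose c₀ hc₀U hc₀ using hyU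
  -- The limit `p` of the preimages is not in `U`: if it were, `z = f p`, since limits in `N` are
  -- unique.
  obtain ⟨p, hp, φ, hφ, hplim⟩ := tendsto_subseq_of_bounded hbdd hc₀U
  set c := c₀ ∘ φ with hcdef
  have hcU : ∀ i, c i ∈ U := fun i ↦ hc₀U _
  have hclim : Tendsto (fun i ↦ f (c i)) atTop (𝓝 z) := by
    refine (hylim.comp hφ.tendsto_atTop).congr fun i ↦ ?_
    exact (hc₀ _).symm
  have hpU : p ∉ U := fun hpU ↦ by
    have h1 := ((h.conformal.contMDiffAt h.isOpen hpU).continuousAt.tendsto).comp hplim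
    exact hzf ⟨p, hpU, tendsto_nhds_unique h1 hclim⟩
  have hpfr : p ∈ frontier U := by
    rw [h.isOpen.frontier_eq]
    exact ⟨hp, hpU⟩
  obtain ⟨q, x, hxU, hxlim, hq, hcase⟩ := hfr p hpfr
  have hesc : ∀ w ∈ W, ∃ G ∈ 𝓝 w, ∀ᶠ j in atTop, f (x j) ∉ G := fun w hw ↦
    h.escapes hq hxU hxlim hw
  rcases hcase with rfl | hlt | hgt
  · obtain ⟨G, hG, hev⟩ := h.escapes hq hcU hplim hzW
    obtain ⟨i, h1, h2⟩ := (hev.and (hclim.eventually hG)).exists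
    exact h1 h2
  -- As `x j` is strictly before `p`, its image precedes `f (c i)` for large `i`, and these tend to
  -- `z`. So infinitely many `f (x j)` precede a point `f u` with `u ∈ S`, and in the limit `q` is
  -- causally before `u`.
  · obtain ⟨u, hu, hfreq⟩ := h.exists_frequently_chron h.orientation hzW hclim hesc fun j ↦ by
      have h1 : ∀ᶠ i in atTop, ChronLT (x j) (c i) :=
        (tendsto_const_nhds.prodMk_nhds hplim).eventually (isOpen_chronLT.mem_nhds (hlt j))
      exact h1.mono fun i hi ↦ h.chron hconv (hxU j) (hcU i) hi
    have huU := h.cauchy.1 hu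
    exact (hq u huU).2 (CausalLE.of_frequently hxlim (hfreq.mono fun j hj ↦
      h.causalLE_of_chron (hxU j) huU hj))
  · obtain ⟨u, hu, hfreq⟩ := h.exists_frequently_chron h.orientation.neg hzW hclim hesc fun j ↦ by
      have h1 : ∀ᶠ i in atTop, ChronLT (c i) (x j) :=
        (hplim.prodMk_nhds tendsto_const_nhds).eventually (isOpen_chronLT.mem_nhds (hgt j))
      exact h1.mono fun i hi ↦ (h.chron hconv (hcU i) (hxU j) hi).neg
    have huU := h.cauchy.1 hu
    exact (hq u huU).1 (CausalLE.of_frequently' hxlim (hfreq.mono fun j hj ↦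
      h.causalLE_of_chron huU (hxU j) (chron_neg_iff.1 hj)))

/-- Criterion for maximality. -/
theorem isGloballyHyperbolicMaximal_of_frontier (hU : IsOpen U) (hconn : IsConnected U)
    (hconv : IsOrderConvex U) (hbdd : Bornology.IsBounded U)
    (hGH : IsGloballyHyperbolic (minkowski d) U)
    (hfr : ∀ p ∈ frontier U, ∃ (q : Mink d) (x : ℕ → Mink d), (∀ j, x j ∈ U) ∧
      Tendsto x atTop (𝓝 q) ∧ IsSpacelikeTo U q ∧
      (p = q ∨ (∀ j, ChronLT (x j) p) ∨ ∀ j, ChronLT p (x j))) :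
    IsGloballyHyperbolicMaximal (minkowski d) U := by
  refine ⟨hGH, ?_⟩
  intro N _ _ _ _ _ gN W hW f hf
  obtain ⟨⟨hWo, hWc, X, hXc, hXt⟩, -⟩ := hW
  obtain ⟨hm, hinj, hconf, S, hS, hfS⟩ := hf
  have hX : IsTimeOrientation gN X W := ⟨hWo, hXc, hXt⟩
  -- A map that reverses time preserves it for the opposite field.
  rcases hconf.isFuturePreserving_or hU hconn.isPreconnected hX hm with hfut | hfut
  · exact IsCauchyMap.surjOn ⟨hU, hX, hm, hinj, hconf, hfut, hS, hfS⟩ hconv hbdd hconn.nonempty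
      hWc.isPreconnected hfr
  · exact IsCauchyMap.surjOn ⟨hU, hX.neg, hm, hinj, hconf, hfut, hS, hfS⟩ hconv hbdd
      hconn.nonempty hWc.isPreconnected hfr

end Maximal

/-! ### The region spacelike to the boundary graph -/

section Region
variable {d : ℕ} {U : Set (Mink d)} {a b : EuclideanSpace ℝ (Fin d) → ℝ}

theorem IsBoundaryData.eq_slab (h : IsBoundaryData U a b) : U = slab (spaceProj U) a b := h.2.2.2

theorem IsBoundaryData.mem_iff (h : IsBoundaryData U a b) {p : Mink d} :
    p ∈ U ↔ p.2 ∈ spaceProj U ∧ a p.2 < p.1 ∧ p.1 < b p.2 := by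
  conv_lhs => rw [h.eq_slab]
  rfl

theorem IsBoundaryData.mem_closure (h : IsBoundaryData U a b) {p : Mink d} (hp : p ∈ closure U) :
    p.2 ∈ closure (spaceProj U) ∧ a p.2 ≤ p.1 ∧ p.1 ≤ b p.2 := by
  refine closure_slab_subset h.1 h.2.1 ?_
  rwa [← h.eq_slab]

theorem IsBoundaryData.lt (h : IsBoundaryData U a b) {x : EuclideanSpace ℝ (Fin d)}
    (hx : x ∈ spaceProj U) : a x < b x := by
  obtain ⟨p, hp, rfl⟩ := hx
  have := h.mem_iff.1 hp
  linarith

/-- A bounded region between two Lipschitz graphs contains a common strict contraction. -/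
theorem IsBoundaryData.exists_contraction (h : IsBoundaryData U a b) (hb : Bornology.IsBounded U) :
    ∃ g : EuclideanSpace ℝ (Fin d) → ℝ, Continuous g ∧
      (∀ x ∈ spaceProj U, a x < g x ∧ g x < b x) ∧
      ∀ x ∈ spaceProj U, ∀ y ∈ spaceProj U, x ≠ y → g x - g y < ‖x - y‖ := by
  obtain ⟨C, hC⟩ := hb.closure.exists_norm_le
  -- Global Lipschitz extensions make the contraction continuous everywhere; taking `C + 1` for `R`
  -- makes the bounds strict.
  obtain ⟨a', ha', haa'⟩ := h.1.extend_real
  obtain ⟨b', hb', hbb'⟩ := h.2.1.extend_real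
  have hcl : ∀ x ∈ spaceProj U, a x ∈ Icc (-C) C ∧ b x ∈ Icc (-C) C := by
    intro x hx
    have hlt := h.lt hx
    have key : ∀ t ∈ Icc (a x) (b x), (t, x) ∈ closure U := by
      have h1 : closure (Ioo (a x) (b x)) ⊆ (fun t : ℝ ↦ ((t, x) : Mink d)) ⁻¹' closure U := by
        refine closure_minimal (fun t ht ↦ subset_closure (h.mem_iff.2 ⟨hx, ht.1, ht.2⟩)) ?_
        exact isClosed_closure.preimage (by fun_prop)
      rwa [closure_Ioo hlt.ne] at h1
    have h2 : ∀ t ∈ Icc (a x) (b x), t ∈ Icc (-C) C := fun t ht ↦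
      abs_le.1 ((norm_fst_le (t, x)).trans (hC _ (key t ht)))
    exact ⟨h2 _ ⟨le_rfl, hlt.le⟩, h2 _ ⟨hlt.le, le_rfl⟩⟩
  have hsub : spaceProj U ⊆ closure (spaceProj U) := subset_closure
  have hea : ∀ x ∈ spaceProj U, a x = a' x := fun x hx ↦ haa' (hsub hx)
  have heb : ∀ x ∈ spaceProj U, b x = b' x := fun x hx ↦ hbb' (hsub hx)
  have key := exists_contraction_between (V := spaceProj U) (a := a') (b := b') (R := C + 1)
    ha'.lipschitzOnWith hb'.lipschitzOnWith (fun x hx ↦ by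
      rw [← hea x hx, ← heb x hx]; exact h.lt hx) (fun x hx ↦ by
      obtain ⟨⟨h1, h2⟩, h3, h4⟩ := hcl x hx
      rw [← hea x hx, ← heb x hx]
      constructor <;> linarith)
  refine ⟨fun x ↦ (a' x + b' x) / 2 - (b' x ^ 2 - a' x ^ 2) / (4 * (C + 1)), ?_, fun x hx ↦ ?_,
    fun x hx ↦ (key x hx).2⟩
  · have := ha'.continuous
    have := hb'.continuous
    fun_prop
  · rw [hea x hx, heb x hx]
    exact (key x hx).1

/-- The base `V` is a variable of its own so that the same graph can be used for `U` and for a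
larger region with the same projection. -/
theorem isCauchyHypersurface_of_contraction (h : IsBoundaryData U a b) (hU : IsOpen U)
    (hb : Bornology.IsBounded U) (hne : U.Nonempty) {V : Set (EuclideanSpace ℝ (Fin d))}
    (hV : spaceProj U = V) {g : EuclideanSpace ℝ (Fin d) → ℝ}
    (hg : Continuous g) (hgab : ∀ x ∈ V, (g x, x) ∈ U)
    (hcontr : ∀ x ∈ V, ∀ y ∈ V, x ≠ y → g x - g y < ‖x - y‖) :
    IsCauchyHypersurface (minkowski d) U (graphOver V g) := by
  subst hV
  have hs := h.eq_slab
  have := isCauchyHypersurface_graphOver (V := spaceProj U) (a := a) (b := b) (g := g)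
    (hs ▸ hne) (isOpen_spaceProj hU) h.1 h.2.1 h.2.2.1 (hs ▸ hb) hg
    (fun x hx ↦ (h.mem_iff.1 (hgab x hx)).2.1) (fun x hx ↦ (h.mem_iff.1 (hgab x hx)).2.2) hcontr
  rwa [← hs] at this

theorem isSpacetime_minkowski (hU : IsOpen U) (hconn : IsConnected U) :
    IsSpacetime (minkowski d) U :=
  ⟨hU, hconn, fun _ ↦ ((1, 0) : Mink d), isTimeOrientation_vertical.continuousOn.mono (subset_univ _),
    fun x _ ↦ isTimeOrientation_vertical.timelike x trivial⟩

theorem IsBoundaryData.isGloballyHyperbolic (h : IsBoundaryData U a b) (hU : IsOpen U)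
    (hconn : IsConnected U) (hb : Bornology.IsBounded U) :
    IsGloballyHyperbolic (minkowski d) U := by
  obtain ⟨g, hg, hgab, hcontr⟩ := h.exists_contraction hb
  exact ⟨isSpacetime_minkowski hU hconn, _, isCauchyHypersurface_of_contraction h hU hb
    hconn.nonempty rfl hg (fun x hx ↦ h.mem_iff.2 ⟨hx, hgab x hx⟩) hcontr⟩

/-! ### Points spacelike to the boundary -/

/-- The points over the projection of `U` that are spacelike to the boundary graph. -/
def spacelikeRegion (U : Set (Mink d)) (f : EuclideanSpace ℝ (Fin d) → ℝ) : Set (Mink d) :=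
  {p | p.2 ∈ spaceProj U ∧ ∀ q ∈ boundaryGraph U f, |p.1 - q.1| < ‖p.2 - q.2‖}

theorem abs_lt_iff_not_causalLE {p q : Mink d} :
    |p.1 - q.1| < ‖p.2 - q.2‖ ↔ ¬ CausalLE p q ∧ ¬ CausalLE q p := by
  unfold CausalLE
  rw [abs_lt, not_le, not_le, norm_sub_rev q.2]
  constructor
  · rintro ⟨h1, h2⟩; constructor <;> linarith
  · rintro ⟨h1, h2⟩; constructor <;> linarith

theorem IsBoundaryData.isSpacelikeTo (h : IsBoundaryData U a b) {q : Mink d}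
    (hq : q ∈ boundaryGraph U b) : IsSpacelikeTo U q := by
  intro u hu
  rw [h.eq_slab] at hu
  have hcl := frontier_subset_closure hq.1
  refine ⟨not_causalLE_of_mem_slab h.1 hu hcl ?_, not_causalLE_of_mem_slab' h.2.1 hu hcl hq.2.ge⟩
  rw [h.2.2.1 _ hq.1]
  exact hq.2.le

theorem IsBoundaryData.subset_spacelikeRegion (h : IsBoundaryData U a b) :
    U ⊆ spacelikeRegion U b := fun p hp ↦
  ⟨⟨p, hp, rfl⟩, fun _ hq ↦ abs_lt_iff_not_causalLE.2 (h.isSpacelikeTo hq p hp)⟩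

/-- The set of points that are not null related to the boundary graph. -/
def nonNull (Λ : Set (Mink d)) : Set (Mink d) := {p | ∀ q ∈ Λ, minkForm d (p - q) (p - q) ≠ 0}

theorem minkForm_pos_iff {v : Mink d} : 0 < minkForm d v v ↔ |v.1| < ‖v.2‖ := by
  rw [minkForm_self, sub_pos, sq_lt_sq, abs_of_nonneg (norm_nonneg v.2)]

theorem IsPreconnected.exists_mem_frontier {Z : Type*} [TopologicalSpace Z] {C V : Set Z}
    (hC : IsPreconnected C) (h1 : (C ∩ V).Nonempty) (h2 : (C ∩ Vᶜ).Nonempty) :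
    (C ∩ frontier V).Nonempty := by
  by_contra hcon
  rw [not_nonempty_iff_eq_empty] at hcon
  have hcov : C ⊆ interior V ∪ (closure V)ᶜ := fun x hx ↦ by
    by_contra hx'
    rw [mem_union, not_or, notMem_compl_iff] at hx'
    exact (hcon.subset ⟨hx, hx'.2, hx'.1⟩ : x ∈ (∅ : Set Z))
  obtain ⟨x, hxC, hxV⟩ := h1
  obtain ⟨y, hyC, hyV⟩ := h2
  have h3 : x ∈ interior V := (hcov hxC).resolve_right fun h ↦ h (subset_closure hxV)
  have h4 : y ∈ (closure V)ᶜ := (hcov hyC).resolve_left fun h ↦ hyV (interior_subset h)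
  obtain ⟨z, -, hz1, hz2⟩ := hC _ _ isOpen_interior isClosed_closure.isOpen_compl hcov
    ⟨x, hxC, h3⟩ ⟨y, hyC, h4⟩
  exact hz2 (interior_subset_closure hz1)

/-- For each point of `Λ` the quadratic form keeps its sign along a connected set that avoids the
null cone, and it is positive on `U`. The region is itself connected because it hangs together with
`U` by vertical segments. -/
theorem IsBoundaryData.connectedComponentIn_eq (h : IsBoundaryData U a b) (hconn : IsConnected U)
    {p : Mink d} (hp : p ∈ U) :
    connectedComponentIn (nonNull (boundaryGraph U b)) p = spacelikeRegion U b := by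
  have hsub : spacelikeRegion U b ⊆ nonNull (boundaryGraph U b) := fun x hx q hq ↦
    (minkForm_pos_iff.2 (hx.2 q hq)).ne'
  have hpF := hsub (h.subset_spacelikeRegion hp)
  refine Subset.antisymm ?_ ?_
  · set C := connectedComponentIn (nonNull (boundaryGraph U b)) p with hC
    have hCc : IsPreconnected C := isPreconnected_connectedComponentIn
    have hpC : p ∈ C := mem_connectedComponentIn hpF
    have hCF : C ⊆ nonNull (boundaryGraph U b) := connectedComponentIn_subset _ _
    have hspace : ∀ x ∈ C, ∀ q ∈ boundaryGraph U b, |x.1 - q.1| < ‖x.2 - q.2‖ := by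
      intro x hx q hq
      by_contra hcon
      have h1 : minkForm d (x - q) (x - q) ≤ 0 := by
        by_contra! h2
        exact hcon (minkForm_pos_iff.1 h2)
      have h2 : 0 ≤ minkForm d (p - q) (p - q) :=
        (minkForm_pos_iff.2 ((h.subset_spacelikeRegion hp).2 q hq)).le
      have hcont : Continuous fun x : Mink d ↦ minkForm d (x - q) (x - q) := by fun_prop
      obtain ⟨y, hy, hy0⟩ := hCc.intermediate_value hx hpC hcont.continuousOn ⟨h1, h2⟩
      exact hCF hy q hq hy0
    intro x hx
    refine ⟨?_, hspace x hx⟩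
    -- Otherwise the projection of the component meets the frontier of `V`, and the point over it
    -- would have a point of `Λ` on its own vertical line.
    by_contra hxV
    obtain ⟨y, ⟨z, hz, rfl⟩, hyfr⟩ := (hCc.image Prod.snd continuous_snd.continuousOn).exists_mem_frontier
      (V := spaceProj U) ⟨p.2, ⟨p, hpC, rfl⟩, ⟨p, hp, rfl⟩⟩ ⟨x.2, ⟨x, hx, rfl⟩, hxV⟩
    have := hspace z hz (b z.2, z.2) ⟨hyfr, rfl⟩
    simp only [sub_self, norm_zero] at this
    exact (abs_nonneg _).not_gt this
  · have hpre : IsPreconnected (spacelikeRegion U b) := by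
      -- On a vertical line the spatial distances are constant, so the conditions defining the
      -- region cut out a convex set of heights.
      refine isPreconnected_of_forall p fun x hx ↦ ?_
      obtain ⟨u, hu, hux⟩ := hx.1
      have hseg : IsPreconnected (segment ℝ u x) := (convex_segment u x).isPreconnected
      have hsegsub : segment ℝ u x ⊆ spacelikeRegion U b := by
        rintro _ ⟨α, β, hα, hβ, hαβ, rfl⟩
        have e2 : (α • u + β • x).2 = x.2 := by
          simp only [Prod.snd_add, Prod.smul_snd]
          rw [hux, ← add_smul, hαβ, one_smul]
        refine ⟨by rw [e2]; exact hx.1, fun q hq ↦ ?_⟩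
        rw [e2]
        have h1 := (h.subset_spacelikeRegion hu).2 q hq
        have h2 := hx.2 q hq
        rw [hux] at h1
        have e1 : (α • u + β • x).1 - q.1 = α * (u.1 - q.1) + β * (x.1 - q.1) := by
          simp only [Prod.fst_add, Prod.smul_fst, smul_eq_mul]
          linear_combination q.1 * hαβ
        rw [e1]
        rw [abs_lt] at *
        have e3 : ‖x.2 - q.2‖ = α * ‖x.2 - q.2‖ + β * ‖x.2 - q.2‖ := by
          rw [← add_mul, hαβ, one_mul]
        rcases hα.eq_or_lt with rfl | hα
        · obtain rfl : β = 1 := by linarith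
          simpa using h2
        · constructor <;> nlinarith
      exact ⟨U ∪ segment ℝ u x, union_subset h.subset_spacelikeRegion hsegsub, Or.inl hp,
        Or.inr (right_mem_segment ℝ u x), hconn.isPreconnected.union u hu
          (left_mem_segment ℝ u x) hseg⟩
    exact hpre.subset_connectedComponentIn (h.subset_spacelikeRegion hp) hsub

theorem IsBoundaryData.isComponentOf_iff (h : IsBoundaryData U a b) (hconn : IsConnected U) :
    IsComponentOf U (nonNull (boundaryGraph U b)) ↔ U = spacelikeRegion U b := by
  obtain ⟨u, hu⟩ := hconn.nonempty
  constructor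
  · rintro ⟨p, hp, hUp⟩
    rw [← h.connectedComponentIn_eq hconn hu]
    conv_lhs => rw [hUp]
    exact _root_.connectedComponentIn_eq (hUp ▸ hu)
  · intro hU
    refine ⟨u, fun q hq ↦ ?_, ?_⟩
    · exact (minkForm_pos_iff.2 ((h.subset_spacelikeRegion hu).2 q hq)).ne'
    · rw [h.connectedComponentIn_eq hconn hu, ← hU]

/-- The first exit of a segment from an open set. -/
theorem exists_exit {E : Type*} [NormedAddCommGroup E] [NormedSpace ℝ E] {V : Set E}
    (hV : IsOpen V) {x y : E} (hx : x ∈ V) (hy : y ∉ V) :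
    ∃ s : ℝ, 0 < s ∧ s ≤ 1 ∧ x + s • (y - x) ∈ frontier V ∧
      ∀ r : ℝ, 0 ≤ r → r < s → x + r • (y - x) ∈ V := by
  have hc : Continuous fun s : ℝ ↦ x + s • (y - x) := by fun_prop
  set A := Icc (0 : ℝ) 1 ∩ (fun s : ℝ ↦ x + s • (y - x)) ⁻¹' Vᶜ with hA
  have hAc : IsClosed A := isClosed_Icc.inter (hV.isClosed_compl.preimage hc)
  have hAne : A.Nonempty := ⟨1, by simp, by simpa using hy⟩
  have hbd : BddBelow A := bddBelow_Icc.mono inter_subset_left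
  have hmem := hAc.csInf_mem hAne hbd
  set s := sInf A
  have hlow : ∀ r : ℝ, 0 ≤ r → r < s → x + r • (y - x) ∈ V := fun r h0 hr ↦ by
    by_contra hcon
    exact (csInf_le hbd (⟨⟨h0, hr.le.trans hmem.1.2⟩, hcon⟩ : r ∈ A)).not_gt hr
  have hs0 : 0 < s := lt_of_le_of_ne hmem.1.1 fun h0 ↦ hmem.2 (by
    rw [← h0]
    simpa using hx)
  refine ⟨s, hs0, hmem.1.2, ?_, hlow⟩
  rw [hV.frontier_eq]
  refine ⟨?_, hmem.2⟩
  have h1 : Tendsto (fun r : ℝ ↦ x + r • (y - x)) (𝓝[<] s) (𝓝 (x + s • (y - x))) :=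
    (hc.tendsto s).mono_left nhdsWithin_le_nhds
  refine mem_closure_of_tendsto h1 ?_
  filter_upwards [Ioo_mem_nhdsLT hs0] with r hr
  exact hlow r hr.1.le hr.2

end Region

/-! ### Maximality and the spacelike region -/

section MaximalRegion
variable {d : ℕ} {U : Set (Mink d)} {a b : EuclideanSpace ℝ (Fin d) → ℝ}

/-- Over a frontier point the two graphs meet, and the heights are squeezed between them. -/
theorem IsBoundaryData.tendsto_of_frontier (h : IsBoundaryData U a b) {u : ℕ → Mink d}
    (hu : ∀ j, u j ∈ U) {y : EuclideanSpace ℝ (Fin d)} (hy : y ∈ frontier (spaceProj U))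
    (hlim : Tendsto (fun j ↦ (u j).2) atTop (𝓝 y)) : Tendsto u atTop (𝓝 (b y, y)) := by
  have hycl := frontier_subset_closure hy
  have hw : Tendsto (fun j ↦ (u j).2) atTop (𝓝[closure (spaceProj U)] y) :=
    tendsto_nhdsWithin_iff.2 ⟨hlim, .of_forall fun j ↦ subset_closure ⟨u j, hu j, rfl⟩⟩
  have h1 := (h.1.continuousOn _ hycl).tendsto.comp hw
  have h2 := (h.2.1.continuousOn _ hycl).tendsto.comp hw
  rw [h.2.2.1 y hy] at h1
  exact (tendsto_of_tendsto_of_tendsto_of_le_of_le h1 h2 (fun j ↦ (h.mem_iff.1 (hu j)).2.1.le)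
    fun j ↦ (h.mem_iff.1 (hu j)).2.2.le).prodMk_nhds hlim

/-- Between a point of the projection and a point outside, there are points of the region over the
segment that converge to the boundary graph. -/
theorem IsBoundaryData.exists_seq_of_exit (h : IsBoundaryData U a b) (hU : IsOpen U)
    {x y : EuclideanSpace ℝ (Fin d)} (hx : x ∈ spaceProj U) (hy : y ∉ spaceProj U) :
    ∃ q ∈ boundaryGraph U b, ∃ u : ℕ → Mink d, (∀ j, u j ∈ U) ∧ Tendsto u atTop (𝓝 q) ∧
      ∀ j, ∃ r : ℝ, 0 ≤ r ∧ r ≤ 1 ∧ (u j).2 = x + r • (y - x) := by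
  obtain ⟨s, hs0, hs1, hsfr, hsV⟩ := exists_exit (isOpen_spaceProj hU) hx hy
  have hr : ∀ j : ℕ, 0 ≤ s * (1 - 1 / ((j : ℝ) + 1)) ∧ s * (1 - 1 / ((j : ℝ) + 1)) < s := fun j ↦ by
    have h1 : 0 < 1 / ((j : ℝ) + 1) := Nat.one_div_pos_of_nat
    have h2 : 1 / ((j : ℝ) + 1) ≤ 1 := by
      rw [div_le_one (by positivity)]
      linarith [(Nat.cast_nonneg j : (0 : ℝ) ≤ j)]
    constructor <;> nlinarith
  choose u hu hux using fun j ↦ hsV _ (hr j).1 (hr j).2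
  refine ⟨(b _, _), ⟨hsfr, rfl⟩, u, hu, h.tendsto_of_frontier hu hsfr ?_,
    fun j ↦ ⟨_, (hr j).1, (hr j).2.le.trans hs1, hux j⟩⟩
  simp only [hux]
  have h1 : Tendsto (fun j : ℕ ↦ s * (1 - 1 / ((j : ℝ) + 1))) atTop (𝓝 s) := by
    have := (tendsto_one_div_add_atTop_nhds_zero_nat (𝕜 := ℝ)).const_sub 1 |>.const_mul s
    simpa using this
  exact (h1.smul_const _).const_add _

/-- A boundary point over `∂V` is on `Λ`. Any other boundary point `p` is null related to some `q ∈
Λ`: it is not in the region and it is a limit of points spacelike to `q`. The segment from `p.2` to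
`q.2` first leaves `V` under a point of `Λ`, possibly not `q`. Points of `U` over the segment before
this exit are spacelike to `q`, which makes them strictly timelike related to `p`. -/
theorem IsBoundaryData.frontier_condition (h : IsBoundaryData U a b) (hU : IsOpen U)
    (heq : U = spacelikeRegion U b) {p : Mink d} (hp : p ∈ frontier U) :
    ∃ (q : Mink d) (x : ℕ → Mink d), (∀ j, x j ∈ U) ∧
      Tendsto x atTop (𝓝 q) ∧ IsSpacelikeTo U q ∧
      (p = q ∨ (∀ j, ChronLT (x j) p) ∨ ∀ j, ChronLT p (x j)) := by
  rw [hU.frontier_eq] at hp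
  obtain ⟨hpcl, hpU⟩ := hp
  obtain ⟨h1, h2, h3⟩ := h.mem_closure hpcl
  by_cases hpV : p.2 ∈ spaceProj U
  swap
  · have hfr : p.2 ∈ frontier (spaceProj U) := by
      rw [(isOpen_spaceProj hU).frontier_eq]
      exact ⟨h1, hpV⟩
    obtain ⟨x, hx, hlim⟩ := mem_closure_iff_seq_limit.1 hpcl
    refine ⟨p, x, hx, hlim, h.isSpacelikeTo ⟨hfr, le_antisymm h3 ?_⟩, Or.inl rfl⟩
    rwa [← h.2.2.1 _ hfr]
  · obtain ⟨q, hq, hpq⟩ : ∃ q ∈ boundaryGraph U b, ‖p.2 - q.2‖ ≤ |p.1 - q.1| := by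
      by_contra! hcon
      exact hpU (heq ▸ ⟨hpV, hcon⟩)
    have hle : |p.1 - q.1| ≤ ‖p.2 - q.2‖ := by
      have hcl : IsClosed {p : Mink d | |p.1 - q.1| ≤ ‖p.2 - q.2‖} :=
        isClosed_le (by fun_prop) (by fun_prop)
      exact closure_minimal (fun u hu ↦ ((h.subset_spacelikeRegion hu).2 q hq).le) hcl hpcl
    have hqV : q.2 ∉ spaceProj U := fun hqV ↦ by
      have := hq.1
      rw [(isOpen_spaceProj hU).frontier_eq] at this
      exact this.2 hqV
    obtain ⟨q', hq', u, hu, hlim, hur⟩ := h.exists_seq_of_exit hU hpV hqV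
    refine ⟨q', u, hu, hlim, h.isSpacelikeTo hq', Or.inr ?_⟩
    have hnorm : ∀ j, ∃ r : ℝ, ‖(u j).2 - p.2‖ = r * ‖p.2 - q.2‖ ∧
        ‖(u j).2 - q.2‖ = (1 - r) * ‖p.2 - q.2‖ := fun j ↦ by
      obtain ⟨r, hr0, hr1, hr⟩ := hur j
      refine ⟨r, ?_, ?_⟩
      · rw [hr, add_sub_cancel_left, norm_smul, Real.norm_of_nonneg hr0, norm_sub_rev]
      · have : p.2 + r • (q.2 - p.2) - q.2 = (1 - r) • (p.2 - q.2) := by module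
        rw [hr, this, norm_smul, Real.norm_of_nonneg (by linarith)]
    rcases le_total q.1 p.1 with hqp | hqp
    · rw [abs_of_nonneg (sub_nonneg.2 hqp)] at hpq hle
      refine Or.inl fun j ↦ ?_
      obtain ⟨r, hr1, hr2⟩ := hnorm j
      have h4 := (abs_lt.1 ((h.subset_spacelikeRegion (hu j)).2 q hq)).2
      unfold ChronLT
      rw [norm_sub_rev, hr1]
      rw [hr2] at h4
      linarith
    · rw [abs_of_nonpos (sub_nonpos.2 hqp)] at hpq hle
      refine Or.inr fun j ↦ ?_
      obtain ⟨r, hr1, hr2⟩ := hnorm j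
      have h4 := (abs_lt.1 ((h.subset_spacelikeRegion (hu j)).2 q hq)).1
      unfold ChronLT
      rw [hr1]
      rw [hr2] at h4
      linarith

/-! ### The region of all spacelike points is a globally hyperbolic extension -/

theorem IsBoundaryData.isCompact_boundaryGraph (h : IsBoundaryData U a b)
    (hb : Bornology.IsBounded U) : IsCompact (boundaryGraph U b) := by
  have hbV : Bornology.IsBounded (spaceProj U) := hb.image_snd
  have hc : IsCompact (frontier (spaceProj U)) :=
    Metric.isCompact_of_isClosed_isBounded isClosed_frontier (hbV.closure.subset frontier_subset_closure)
  have : boundaryGraph U b = (fun x ↦ (b x, x)) '' frontier (spaceProj U) := by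
    ext p
    constructor
    · rintro ⟨h1, h2⟩
      exact ⟨p.2, h1, Prod.ext h2.symm rfl⟩
    · rintro ⟨x, hx, rfl⟩
      exact ⟨hx, rfl⟩
  rw [this]
  exact hc.image_of_continuousOn ((h.2.1.continuousOn.mono frontier_subset_closure).prodMk
    continuousOn_id)

/-- Compactness of `Λ` makes the strict inequalities, one for each of its points, stable together.
-/
theorem IsBoundaryData.isOpen_spacelikeRegion (h : IsBoundaryData U a b) (hU : IsOpen U)
    (hb : Bornology.IsBounded U) : IsOpen (spacelikeRegion U b) := by
  have hopen : IsOpen {p : Mink d | ∀ q ∈ boundaryGraph U b, |p.1 - q.1| < ‖p.2 - q.2‖} := ?_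
  · exact ((isOpen_spaceProj hU).preimage continuous_snd).inter hopen
  rw [isOpen_iff_mem_nhds]
  intro p hp
  have := (h.isCompact_boundaryGraph hb).eventually_forall_of_forall_eventually (x₀ := p)
    (P := fun p q ↦ |p.1 - q.1| < ‖p.2 - q.2‖) fun q hq ↦ by
      have hopen : IsOpen {z : Mink d × Mink d | |z.1.1 - z.2.1| < ‖z.1.2 - z.2.2‖} :=
        isOpen_lt (by fun_prop) (by fun_prop)
      exact hopen.mem_nhds (hp q hq)
  exact this

/-- By transitivity a point between two points of the region is unrelated to `Λ`. If it were not
over `V`, the segment leading to it would cross a vertical line through a point of `Λ`; this point,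
being above or below the crossing, would be causally related to one of the two ends. -/
theorem IsBoundaryData.isOrderConvex_spacelikeRegion (hU : IsOpen U) :
    IsOrderConvex (spacelikeRegion U b) := by
  intro p hp q hq r hpr hrq
  have hrel : ∀ w ∈ boundaryGraph U b, ¬ CausalLE r w ∧ ¬ CausalLE w r := fun w hw ↦
    ⟨fun h ↦ (abs_lt_iff_not_causalLE.1 (hp.2 w hw)).1 (hpr.trans h),
      fun h ↦ (abs_lt_iff_not_causalLE.1 (hq.2 w hw)).2 (h.trans hrq)⟩
  refine ⟨?_, fun w hw ↦ abs_lt_iff_not_causalLE.2 (hrel w hw)⟩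
  by_contra hrV
  obtain ⟨s, hs0, hs1, hsfr, -⟩ := exists_exit (isOpen_spaceProj hU) hp.1 hrV
  set m : Mink d := (p.1 + s * (r.1 - p.1), p.2 + s • (r.2 - p.2)) with hm
  have hpm : CausalLE p m := by
    unfold CausalLE at *
    simp only [hm, add_sub_cancel_left, norm_smul, Real.norm_of_nonneg hs0.le]
    exact mul_le_mul_of_nonneg_left hpr hs0.le
  have hmr : CausalLE m r := by
    unfold CausalLE at *
    have e : r.2 - m.2 = (1 - s) • (r.2 - p.2) := by simp only [hm]; module
    rw [e, norm_smul, Real.norm_of_nonneg (by linarith : 0 ≤ 1 - s)]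
    simp only [hm]
    nlinarith
  have hw : (b m.2, m.2) ∈ boundaryGraph U b := ⟨hsfr, rfl⟩
  rcases le_total (b m.2) m.1 with h | h
  · exact (abs_lt_iff_not_causalLE.1 (hq.2 _ hw)).2
      ((show CausalLE (b m.2, m.2) m by simpa [CausalLE] using h).trans (hmr.trans hrq))
  · exact (abs_lt_iff_not_causalLE.1 (hp.2 _ hw)).1
      (hpm.trans (show CausalLE m (b m.2, m.2) by simpa [CausalLE] using h))

/-- A single point of `Λ` bounds all heights. Here `1 ≤ d` is essential: it makes `∂V` nonempty,
whereas for `d = 0` the region would be a full vertical line. -/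
theorem isBounded_spacelikeRegion (hd : 1 ≤ d) (hne : U.Nonempty)
    (hb : Bornology.IsBounded U) : Bornology.IsBounded (spacelikeRegion U b) := by
  have hbV : Bornology.IsBounded (spaceProj U) := hb.image_snd
  have hfr : (frontier (spaceProj U)).Nonempty := by
    rw [nonempty_iff_ne_empty]
    intro h0
    rcases isClopen_iff.1 (isClopen_iff_frontier_eq_empty.2 h0) with h1 | h1
    · obtain ⟨u, hu⟩ := hne
      exact (h1.subset ⟨u, hu, rfl⟩ : u.2 ∈ (∅ : Set _))
    · have : Nontrivial (EuclideanSpace ℝ (Fin d)) := by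
        have : Nonempty (Fin d) := ⟨⟨0, hd⟩⟩
        infer_instance
      rw [h1] at hbV
      exact NormedSpace.unbounded_univ ℝ _ hbV
  obtain ⟨y, hy⟩ := hfr
  obtain ⟨C, hC⟩ := hbV.exists_norm_le
  refine isBounded_iff_forall_norm_le.2 ⟨max (|b y| + (C + ‖y‖)) C, fun p hp ↦ ?_⟩
  have h1 := hp.2 (b y, y) ⟨hy, rfl⟩
  have h2 := hC p.2 hp.1
  rw [Prod.norm_def]
  refine max_le_max ?_ h2
  have h3 := abs_add_le (b y) (p.1 - b y)
  rw [add_sub_cancel] at h3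
  have h4 := norm_sub_le p.2 y
  simp only at h1
  rw [Real.norm_eq_abs]
  linarith

theorem spaceProj_spacelikeRegion (h : IsBoundaryData U a b) :
    spaceProj (spacelikeRegion U b) = spaceProj U := by
  refine Subset.antisymm ?_ (image_mono h.subset_spacelikeRegion)
  rintro _ ⟨p, hp, rfl⟩
  exact hp.1

theorem isConformalOn_id (U : Set (Mink d)) : IsConformalOn (minkowski d) (minkowski d) U id := by
  refine ⟨contMDiffOn_id, fun _ ↦ 0, contMDiffOn_const, fun x _ v w ↦ ?_⟩
  rw [Real.exp_zero, one_mul, mfderiv_id]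
  rfl

/-- The region is itself bounded, open and order convex, so it has boundary data of its own. The
same graph is therefore a Cauchy hypersurface in it and in `U`, and the inclusion is a Cauchy
embedding. -/
theorem IsBoundaryData.eq_spacelikeRegion_of_maximal (h : IsBoundaryData U a b) (hd : 1 ≤ d)
    (hU : IsOpen U) (hconn : IsConnected U) (hb : Bornology.IsBounded U)
    (hmax : IsGloballyHyperbolicMaximal (minkowski d) U) : U = spacelikeRegion U b := by
  have hDo := h.isOpen_spacelikeRegion hU hb
  have hDb := isBounded_spacelikeRegion (b := b) hd hconn.nonempty hb
  have hUD := h.subset_spacelikeRegion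
  obtain ⟨u, hu⟩ := hconn.nonempty
  have hDc : IsConnected (spacelikeRegion U b) := by
    refine ⟨⟨u, hUD hu⟩, ?_⟩
    rw [← h.connectedComponentIn_eq hconn hu]
    exact isPreconnected_connectedComponentIn
  obtain ⟨a', b', hD⟩ := exists_boundaryData hDo
    (IsBoundaryData.isOrderConvex_spacelikeRegion hU) hDb
  obtain ⟨g, hg, hgab, hcontr⟩ := h.exists_contraction hb
  have hgU : ∀ x ∈ spaceProj U, (g x, x) ∈ U := fun x hx ↦ h.mem_iff.2 ⟨hx, hgab x hx⟩
  have hS := isCauchyHypersurface_of_contraction h hU hb hconn.nonempty rfl hg hgU hcontr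
  have hS' := isCauchyHypersurface_of_contraction hD hDo hDb hDc.nonempty
    (spaceProj_spacelikeRegion h) hg (fun x hx ↦ hUD (hgU x hx)) hcontr
  have hsurj := hmax.2 (Mink d) (minkowski d) (spacelikeRegion U b)
    (hD.isGloballyHyperbolic hDo hDc hDb) id
    ⟨fun x hx ↦ hUD hx, injOn_id _, isConformalOn_id U, _, hS, by rwa [image_id]⟩
  refine Subset.antisymm hUD fun x hx ↦ ?_
  obtain ⟨y, hy, rfl⟩ := hsurj hx
  exact hy

theorem IsBoundaryData.maximal_iff (h : IsBoundaryData U a b) (hd : 1 ≤ d) (hU : IsOpen U)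
    (hconn : IsConnected U) (hb : Bornology.IsBounded U) (hconv : IsOrderConvex U) :
    IsGloballyHyperbolicMaximal (minkowski d) U ↔ U = spacelikeRegion U b :=
  ⟨h.eq_spacelikeRegion_of_maximal hd hU hconn hb, fun heq ↦
    isGloballyHyperbolicMaximal_of_frontier hU hconn hconv hb (h.isGloballyHyperbolic hU hconn hb)
      fun _ hp ↦ h.frontier_condition hU heq hp⟩

end MaximalRegion

/-! ### Affine charts and compactness of the Einstein universe -/

section Einstein
variable {d : ℕ}

theorem ambientForm_symm (p q : Ambient d) : ambientForm d p q = ambientForm d q p := by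
  rw [ambientForm_apply, ambientForm_apply, minkForm_symm]; ring

/-- Polarization of isotropic vectors; it identifies lightcones seen in a chart with null cones. -/
theorem ambientForm_minkLift (v w : Mink d) :
    ambientForm d (minkLift v) (minkLift w) = -minkForm d (v - w) (v - w) / 2 := by
  simp only [ambientForm_apply, minkLift, map_sub, sub_apply, minkForm_symm w v]
  ring

theorem continuous_minkLift : Continuous (minkLift (d := d)) := by
  unfold minkLift; fun_prop

theorem AmbientIsometry.continuous (A : AmbientIsometry d) : Continuous A.toLinearEquiv :=
  A.toLinearEquiv.toLinearMap.continuous_of_finiteDimensional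

/-- The inverse isometry. -/
def AmbientIsometry.symm (A : AmbientIsometry d) : AmbientIsometry d where
  toLinearEquiv := A.toLinearEquiv.symm
  isometry' p q := by
    conv_rhs => rw [← A.toLinearEquiv.apply_symm_apply p, ← A.toLinearEquiv.apply_symm_apply q]
    exact (A.isometry' _ _).symm

/-- The composition of isometries. -/
def AmbientIsometry.trans (A B : AmbientIsometry d) : AmbientIsometry d where
  toLinearEquiv := A.toLinearEquiv.trans B.toLinearEquiv
  isometry' p q := (B.isometry' _ _).trans (A.isometry' _ _)

theorem AmbientIsometry.form_symm_left (A : AmbientIsometry d) (p q : Ambient d) :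
    ambientForm d (A.toLinearEquiv.symm p) q = ambientForm d p (A.toLinearEquiv q) := by
  rw [← A.isometry', A.toLinearEquiv.apply_symm_apply]

/-- A nonzero isotropic vector whose first coordinate does not vanish is a multiple of a point of
the standard section. -/
theorem minkLift_of_isotropic {w : Ambient d} (hw : ambientForm d w w = 0) (h1 : w.1 ≠ 0) :
    minkLift (w.1⁻¹ • w.2.2) = w.1⁻¹ • w := by
  rw [ambientForm_apply] at hw
  refine Prod.ext ?_ (Prod.ext ?_ rfl)
  · simp [minkLift, h1]
  · simp only [minkLift, map_smul, smul_apply, smul_eq_mul, Prod.smul_snd, Prod.smul_fst]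
    have : minkForm d w.2.2 w.2.2 = w.1 * w.2.1 := by linarith
    rw [this]
    field_simp

theorem Ein.exists_rep (y : Ein d) : ∃ (v : Ambient d) (hv : v ≠ 0) (h : ambientForm d v v = 0),
    y = Ein.mk v hv h :=
  ⟨y.1.rep, y.1.rep_nonzero, y.2, Subtype.ext (y.1.mk_rep).symm⟩

theorem Ein.mk_eq_mk_of_smul {v w : Ambient d} {hv : v ≠ 0} {hw : w ≠ 0} {h : ambientForm d v v = 0}
    {h' : ambientForm d w w = 0} {c : ℝ} (hc : v = c • w) : Ein.mk v hv h = Ein.mk w hw h' := by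
  refine Subtype.ext ((Projectivization.mk_eq_mk_iff' ℝ v w hv hw).2 ⟨c, hc.symm⟩)

theorem mem_lightcone_mk {v w : Ambient d} {hv : v ≠ 0} {hw : w ≠ 0} {h : ambientForm d v v = 0}
    {h' : ambientForm d w w = 0} :
    Ein.mk w hw h' ∈ lightcone (Ein.mk v hv h) ↔ ambientForm d v w = 0 :=
  ambientForm_rep_mk hv hw

theorem affineChart_mem_lightcone_mk (A : AmbientIsometry d) {v : Ambient d} {hv : v ≠ 0}
    {h : ambientForm d v v = 0} {p : Mink d} : affineChart A p ∈ lightcone (Ein.mk v hv h) ↔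
      ambientForm d (A.toLinearEquiv.symm v) (minkLift p) = 0 := by
  rw [affineChart, mem_lightcone_mk, A.form_symm_left]

theorem affineChart_mem_lightcone (A : AmbientIsometry d) (p q : Mink d) :
    affineChart A p ∈ lightcone (affineChart A q) ↔ minkForm d (p - q) (p - q) = 0 := by
  rw [affineChart, affineChart, mem_lightcone_mk, A.isometry', ambientForm_symm,
    ambientForm_minkLift]
  constructor <;> intro h <;> linarith

theorem coneUnion_compl (A : AmbientIsometry d) (Λ : Set (Mink d)) :
    (coneUnion A Λ)ᶜ = nonNull Λ := by
  ext p
  simp only [coneUnion, mem_compl_iff, mem_preimage, mem_iUnion, affineChart_mem_lightcone,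
    exists_prop, not_exists, not_and]
  rfl

/-! ### The affine charts are open embeddings -/

/-- The affine coordinate of a line. -/
def affineCoord (A : AmbientIsometry d) (y : Ein d) : Mink d :=
  (A.toLinearEquiv.symm y.1.rep).1⁻¹ • (A.toLinearEquiv.symm y.1.rep).2.2

theorem smul_inv_congr {c a : ℝ} (hc : c ≠ 0) (v : Mink d) : (c * a)⁻¹ • c • v = a⁻¹ • v := by
  rw [smul_smul, mul_inv, mul_right_comm, inv_mul_cancel₀ hc, one_mul]

/-- The quotient is homogeneous of degree zero, so the chosen representative does not matter and the
coordinate can be studied on nonzero vectors. -/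
theorem coord_rep_mk (A : AmbientIsometry d) {v : Ambient d} (hv : v ≠ 0) :
    (A.toLinearEquiv.symm (Projectivization.mk ℝ v hv).rep).1⁻¹ •
      (A.toLinearEquiv.symm (Projectivization.mk ℝ v hv).rep).2.2 =
    (A.toLinearEquiv.symm v).1⁻¹ • (A.toLinearEquiv.symm v).2.2 := by
  obtain ⟨a, ha⟩ := Projectivization.exists_smul_eq_mk_rep ℝ v hv
  rw [← ha, Units.smul_def, map_smul]
  exact smul_inv_congr a.ne_zero _

theorem affineCoord_mk (A : AmbientIsometry d) {v : Ambient d} {hv : v ≠ 0}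
    {h : ambientForm d v v = 0} : affineCoord A (Ein.mk v hv h) =
      (A.toLinearEquiv.symm v).1⁻¹ • (A.toLinearEquiv.symm v).2.2 :=
  coord_rep_mk A hv

theorem affineCoord_affineChart (A : AmbientIsometry d) (p : Mink d) :
    affineCoord A (affineChart A p) = p := by
  rw [affineChart, affineCoord_mk, LinearEquiv.symm_apply_apply]
  simp [minkLift]

theorem affineChart_coord_mk (A : AmbientIsometry d) {v : Ambient d} {hv : v ≠ 0}
    {h : ambientForm d v v = 0} (h1 : (A.toLinearEquiv.symm v).1 ≠ 0) :
    affineChart A ((A.toLinearEquiv.symm v).1⁻¹ • (A.toLinearEquiv.symm v).2.2) = Ein.mk v hv h := by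
  refine Ein.mk_eq_mk_of_smul (c := (A.toLinearEquiv.symm v).1⁻¹) ?_
  rw [minkLift_of_isotropic (w := A.toLinearEquiv.symm v) ((A.symm.isometry' v v).trans h) h1,
    map_smul, LinearEquiv.apply_symm_apply]

theorem mk_mem_range_affineChart (A : AmbientIsometry d) {v : Ambient d} {hv : v ≠ 0}
    {h : ambientForm d v v = 0} :
    Ein.mk v hv h ∈ range (affineChart A) ↔ (A.toLinearEquiv.symm v).1 ≠ 0 := by
  refine ⟨?_, fun h1 ↦ ⟨_, affineChart_coord_mk A h1⟩⟩
  rintro ⟨p, hp⟩ h0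
  obtain ⟨c, hc⟩ := (Projectivization.mk_eq_mk_iff' ℝ _ _ _ _).1 (congrArg Subtype.val hp)
  have h1 := congrArg (fun w ↦ (A.toLinearEquiv.symm w).1) hc
  simp only [map_smul, Prod.smul_fst, h0, smul_zero, LinearEquiv.symm_apply_apply, minkLift] at h1
  exact zero_ne_one h1

theorem continuous_affineChart (A : AmbientIsometry d) : Continuous (affineChart A) := by
  refine Continuous.subtype_mk ?_ _
  have h1 : Continuous (Projectivization.mk' ℝ (V := Ambient d)) := continuous_coinduced_rng
  exact h1.comp ((A.continuous.comp continuous_minkLift).subtype_mk fun v h ↦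
    minkLift_ne_zero v ((LinearEquiv.map_eq_zero_iff _).1 h))

theorem isQuotientMap_mk' : Topology.IsQuotientMap (Projectivization.mk' ℝ (V := Ambient d)) :=
  ⟨⟨rfl⟩, Quotient.mk''_surjective⟩

theorem mk'_preimage_coord (A : AmbientIsometry d) :
    Projectivization.mk' ℝ ⁻¹' {x : ℙ ℝ (Ambient d) | (A.toLinearEquiv.symm x.rep).1 ≠ 0} =
      {v : {v : Ambient d // v ≠ 0} | (A.toLinearEquiv.symm v.1).1 ≠ 0} := by
  ext v
  obtain ⟨a, ha⟩ := Projectivization.exists_smul_eq_mk_rep ℝ v.1 v.2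
  simp only [mem_preimage, mem_ofPred_eq, Projectivization.mk'_eq_mk]
  rw [← ha, Units.smul_def, map_smul]
  simp [a.ne_zero]

theorem isOpen_coord_ne_zero (A : AmbientIsometry d) :
    IsOpen {x : ℙ ℝ (Ambient d) | (A.toLinearEquiv.symm x.rep).1 ≠ 0} := by
  rw [← isQuotientMap_mk'.isOpen_preimage, mk'_preimage_coord]
  have h : Continuous fun v : {v : Ambient d // v ≠ 0} ↦ (A.toLinearEquiv.symm v.1).1 :=
    continuous_fst.comp (A.symm.continuous.comp continuous_subtype_val)
  exact isOpen_ne_fun h continuous_const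

theorem continuousOn_coord (A : AmbientIsometry d) :
    ContinuousOn (fun x : ℙ ℝ (Ambient d) ↦
      (A.toLinearEquiv.symm x.rep).1⁻¹ • (A.toLinearEquiv.symm x.rep).2.2)
      {x : ℙ ℝ (Ambient d) | (A.toLinearEquiv.symm x.rep).1 ≠ 0} := by
  rw [isQuotientMap_mk'.continuousOn_isOpen_iff (isOpen_coord_ne_zero A), mk'_preimage_coord]
  have h : Continuous fun v : {v : Ambient d // v ≠ 0} ↦ A.toLinearEquiv.symm v.1 :=
    A.symm.continuous.comp continuous_subtype_val
  have h2 : ContinuousOn (fun v : {v : Ambient d // v ≠ 0} ↦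
      (A.toLinearEquiv.symm v.1).1⁻¹ • (A.toLinearEquiv.symm v.1).2.2)
      {v : {v : Ambient d // v ≠ 0} | (A.toLinearEquiv.symm v.1).1 ≠ 0} :=
    ((continuous_fst.comp h).continuousOn.inv₀ fun v hv ↦ hv).smul
      (continuous_snd.comp (continuous_snd.comp h)).continuousOn
  exact h2.congr fun v _ ↦ coord_rep_mk A v.2

theorem range_affineChart (A : AmbientIsometry d) :
    range (affineChart A) = {y | (A.toLinearEquiv.symm y.1.rep).1 ≠ 0} := by
  ext y
  have : y = Ein.mk y.1.rep y.1.rep_nonzero y.2 := Subtype.ext (y.1.mk_rep).symm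
  conv_lhs => rw [this, mk_mem_range_affineChart]
  rfl

theorem continuousOn_affineCoord (A : AmbientIsometry d) :
    ContinuousOn (affineCoord A) (range (affineChart A)) := by
  rw [range_affineChart]
  exact (continuousOn_coord A).comp continuous_subtype_val.continuousOn fun y hy ↦ hy

theorem isOpen_range_affineChart (A : AmbientIsometry d) : IsOpen (range (affineChart A)) := by
  rw [range_affineChart]
  exact (isOpen_coord_ne_zero A).preimage continuous_subtype_val

theorem affineChart_affineCoord (A : AmbientIsometry d) {y : Ein d} (hy : y ∈ range (affineChart A)) :
    affineChart A (affineCoord A y) = y := by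
  obtain ⟨p, rfl⟩ := hy
  rw [affineCoord_affineChart]

theorem isOpenMap_affineChart (A : AmbientIsometry d) : IsOpenMap (affineChart A) := by
  intro O hO
  have : affineChart A '' O = range (affineChart A) ∩ affineCoord A ⁻¹' O := by
    ext y
    constructor
    · rintro ⟨p, hp, rfl⟩
      exact ⟨mem_range_self p, by rwa [mem_preimage, affineCoord_affineChart]⟩
    · rintro ⟨⟨p, rfl⟩, hp⟩
      rw [mem_preimage, affineCoord_affineChart] at hp
      exact ⟨p, hp, rfl⟩
  rw [this]
  exact (continuousOn_affineCoord A).isOpen_inter_preimage (isOpen_range_affineChart A) hO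

/-! ### Compactness -/

instance : CompactSpace (ℙ ℝ (Ambient d)) := by
  have h1 : IsCompact (Metric.sphere (0 : Ambient d) 1) := isCompact_sphere 0 1
  have h2 : ∀ v ∈ Metric.sphere (0 : Ambient d) 1, v ≠ 0 := fun v hv h0 ↦ by
    rw [h0, mem_sphere_zero_iff_norm, norm_zero] at hv
    exact zero_ne_one hv
  have h3 : CompactSpace (Metric.sphere (0 : Ambient d) 1) := isCompact_iff_compactSpace.1 h1
  have hc : Continuous fun v : Metric.sphere (0 : Ambient d) 1 ↦
      Projectivization.mk' ℝ (⟨v.1, h2 v.1 v.2⟩ : {v : Ambient d // v ≠ 0}) :=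
    isQuotientMap_mk'.continuous.comp (continuous_subtype_val.subtype_mk _)
  refine ⟨?_⟩
  rw [← (show Function.Surjective _ from ?_).range_eq (f := fun v : Metric.sphere (0 : Ambient d) 1 ↦
      Projectivization.mk' ℝ (⟨v.1, h2 v.1 v.2⟩ : {v : Ambient d // v ≠ 0}))]
  · exact isCompact_range hc
  · intro x
    have hx := x.rep_nonzero
    refine ⟨⟨‖x.rep‖⁻¹ • x.rep, by
      rw [mem_sphere_zero_iff_norm, norm_smul, norm_inv, norm_norm,
        inv_mul_cancel₀ (norm_ne_zero_iff.2 hx)]⟩, ?_⟩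
    change Projectivization.mk ℝ (‖x.rep‖⁻¹ • x.rep) _ = x
    conv_rhs => rw [← x.mk_rep]
    exact (Projectivization.mk_eq_mk_iff' ℝ _ _ _ _).2 ⟨_, rfl⟩

instance : CompactSpace (Ein d) := by
  have hcl : IsClosed {x : ℙ ℝ (Ambient d) | ambientForm d x.rep x.rep = 0} := ?_
  · exact isCompact_iff_compactSpace.1 hcl.isCompact
  rw [← isQuotientMap_mk'.isClosed_preimage]
  have : Projectivization.mk' ℝ ⁻¹' {x : ℙ ℝ (Ambient d) | ambientForm d x.rep x.rep = 0} =
      {v : {v : Ambient d // v ≠ 0} | ambientForm d v.1 v.1 = 0} := by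
    ext v
    exact ambientForm_rep_mk v.2 v.2
  rw [this]
  have hc : Continuous fun v : {v : Ambient d // v ≠ 0} ↦ ambientForm d v.1 v.1 := by
    simp only [ambientForm_apply]
    fun_prop
  exact isClosed_eq hc continuous_const

variable {A : AmbientIsometry d} {Ω : Set (Ein d)}

/-- The closure is compact, as a closed subset of the Einstein universe, and the affine coordinate
is continuous on it. -/
theorem isBounded_preimage_affineChart (h : closure Ω ⊆ range (affineChart A)) :
    Bornology.IsBounded (affineChart A ⁻¹' Ω) := by
  have h1 : IsCompact (affineCoord A '' closure Ω) :=
    isClosed_closure.isCompact.image_of_continuousOn ((continuousOn_affineCoord A).mono h)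
  refine h1.isBounded.subset fun p hp ↦ ⟨_, subset_closure hp, affineCoord_affineChart A p⟩

theorem isConnected_preimage_affineChart (hΩ : IsConnected Ω) (h : Ω ⊆ range (affineChart A)) :
    IsConnected (affineChart A ⁻¹' Ω) := by
  have : affineChart A ⁻¹' Ω = affineCoord A '' Ω := by
    ext p
    constructor
    · intro hp
      exact ⟨_, hp, affineCoord_affineChart A p⟩
    · rintro ⟨y, hy, rfl⟩
      rwa [mem_preimage, affineChart_affineCoord A (h hy)]
  rw [this]
  exact hΩ.image _ ((continuousOn_affineCoord A).mono h)

end Einstein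

/-! ### Isometries and changes of affine chart -/

section Transition
variable {d : ℕ}

/-! ### Transitivity of the isometry group on isotropic lines -/

/-- The reflection in a vector that is not isotropic. -/
theorem exists_reflection {u : Ambient d} (hu : ambientForm d u u ≠ 0) :
    ∃ A : AmbientIsometry d, ∀ p, A.toLinearEquiv p =
      p - (2 / ambientForm d u u * ambientForm d u p) • u := by
  have h2 : ((2 / ambientForm d u u) • ambientForm d u : Module.Dual ℝ (Ambient d)) u = 2 := by
    rw [LinearMap.smul_apply, smul_eq_mul, div_mul_cancel₀ _ hu]
  have hr : ∀ p, Module.reflection h2 p = p - (2 / ambientForm d u u * ambientForm d u p) • u :=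
    fun p ↦ by rw [Module.reflection_apply, LinearMap.smul_apply, smul_eq_mul]
  refine ⟨⟨Module.reflection h2, fun p q ↦ ?_⟩, hr⟩
  rw [hr, hr]
  simp only [map_sub, map_smul, LinearMap.sub_apply, LinearMap.smul_apply, smul_eq_mul]
  rw [ambientForm_symm p u]
  field_simp
  ring

/-- The reflection in `e - w` exchanges the two vectors; `e - w` is not isotropic because `e` and
`w` are not orthogonal. -/
theorem exists_isometry_of_form_ne_zero {e w : Ambient d} (he : ambientForm d e e = 0)
    (hw : ambientForm d w w = 0) (h : ambientForm d e w ≠ 0) :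
    ∃ A : AmbientIsometry d, A.toLinearEquiv e = w := by
  have huu : ambientForm d (e - w) (e - w) = -2 * ambientForm d e w := by
    simp only [map_sub, LinearMap.sub_apply, he, hw, ambientForm_symm w e]
    ring
  obtain ⟨A, hA⟩ := exists_reflection (u := e - w) (by rw [huu]; simpa using h)
  refine ⟨A, ?_⟩
  have hue : ambientForm d (e - w) e = -ambientForm d e w := by
    simp only [map_sub, LinearMap.sub_apply, he, ambientForm_symm w e]
    ring
  rw [hA, huu, hue]
  have : 2 / (-2 * ambientForm d e w) * -ambientForm d e w = 1 := by field_simp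
  rw [this, one_smul, sub_sub_cancel]

/-- Two reflections suffice, through a point `minkLift v` that is orthogonal neither to the point at
infinity nor to `w`. If `w` were orthogonal to all such points, testing `0` and `(±1, 0)`, and then
arbitrary `v`, would give `w = 0`. -/
theorem exists_isometry_apply_infinity {w : Ambient d} (hw0 : w ≠ 0) (hw : ambientForm d w w = 0) :
    ∃ A : AmbientIsometry d, A.toLinearEquiv ((0, 1, 0) : Ambient d) = w := by
  have he : ambientForm d ((0, 1, 0) : Ambient d) (0, 1, 0) = 0 := by simp [ambientForm_apply]
  have hlift : ∀ v : Mink d, ambientForm d ((0, 1, 0) : Ambient d) (minkLift v) ≠ 0 := fun v ↦ by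
    simp [ambientForm_apply, minkLift]
  obtain ⟨v, hv⟩ : ∃ v : Mink d, ambientForm d (minkLift v) w ≠ 0 := by
    by_contra! hcon
    obtain ⟨α, γ, ζ⟩ := w
    have key : ∀ v : Mink d, minkForm d v ζ = (γ + minkForm d v v * α) / 2 := fun v ↦ by
      have := hcon v
      simp only [ambientForm_apply, minkLift, one_mul] at this
      linarith
    have h0 := key 0
    simp only [map_zero, zero_apply, zero_mul, add_zero] at h0
    have hγ : γ = 0 := by linarith
    have h1 := key (1, 0)
    have h2 := key (-1, 0)
    have h3 : minkForm d (-1, 0) ζ = -minkForm d (1, 0) ζ := by simp [minkForm_apply]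
    have h4 : minkForm d ((1, 0) : Mink d) (1, 0) = -1 := by simp [minkForm_apply]
    have h5 : minkForm d ((-1, 0) : Mink d) (-1, 0) = -1 := by simp [minkForm_apply]
    rw [h4] at h1
    rw [h3, h5] at h2
    have hα : α = 0 := by linarith
    have hz : ζ = 0 := by
      refine (minkowski d).nondegenerate (y := 0) fun (v : Mink d) ↦ ?_
      change minkForm d ζ v = 0
      rw [minkForm_symm, key v, hγ, hα, mul_zero, add_zero, zero_div]
    exact hw0 (by rw [hγ, hα, hz]; rfl)
  obtain ⟨A, hA⟩ := exists_isometry_of_form_ne_zero he (minkLift_isotropic v) (hlift v)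
  obtain ⟨B, hB⟩ := exists_isometry_of_form_ne_zero (minkLift_isotropic v) hw hv
  exact ⟨A.trans B, (congrArg B.toLinearEquiv hA).trans hB⟩

theorem fst_eq_form (w : Ambient d) : w.1 = -2 * ambientForm d ((0, 1, 0) : Ambient d) w := by
  simp [ambientForm_apply]
  ring

/-- The complement of a lightcone is an affine chart. -/
theorem exists_affineChart (x : Ein d) : ∃ A : AmbientIsometry d,
    range (affineChart A) = (lightcone x)ᶜ := by
  obtain ⟨A, hA⟩ := exists_isometry_apply_infinity x.1.rep_nonzero x.2
  refine ⟨A, ?_⟩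
  rw [range_affineChart]
  ext y
  rw [mem_ofPred_eq, fst_eq_form, ambientForm_symm, A.form_symm_left, hA, ambientForm_symm]
  simp [lightcone]

/-! ### Order convexity in all charts -/

theorem minkForm_nonpos_of_null {ζ w : Mink d} (hζ : minkForm d ζ ζ = 0) (h0 : 0 ≤ ζ.1)
    (hw : ‖w.2‖ ≤ w.1) : minkForm d ζ w ≤ 0 := by
  rw [minkForm_self, sub_eq_zero, sq_eq_sq₀ (norm_nonneg _) h0] at hζ
  rw [minkForm_apply]
  have h1 := real_inner_le_norm ζ.2 w.2
  rw [hζ] at h1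
  nlinarith

/-- If a connected set misses the null cone of `o`, so do all points between its points. -/
theorem form_sub_ne_zero_of_between {U : Set (Mink d)} (hU : IsPreconnected U) {o : Mink d}
    (hB : ∀ v ∈ U, minkForm d (v - o) (v - o) ≠ 0) {p q r : Mink d} (hp : p ∈ U)
    (hq : q ∈ U) (hpr : CausalLE p r) (hrq : CausalLE r q) :
    minkForm d (r - o) (r - o) ≠ 0 := by
  intro hr0
  have hcB : Continuous fun v : Mink d ↦ minkForm d (v - o) (v - o) := by fun_prop
  have hle : ∀ v : Mink d, minkForm d (v - o) (v - o) ≤ 0 ↔ ‖v.2 - o.2‖ ≤ |v.1 - o.1| :=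
    fun v ↦ minkForm_self_nonpos_iff
  have hlt : ∀ v : Mink d, minkForm d (v - o) (v - o) < 0 ↔ ‖v.2 - o.2‖ < |v.1 - o.1| :=
    fun v ↦ minkForm_self_neg_iff
  have hnull1 : ¬ ChronLT o r := fun h ↦
    ((hlt r).2 (lt_of_lt_of_le h (le_abs_self _))).ne hr0
  have hnull2 : ¬ ChronLT r o := fun h ↦ by
    unfold ChronLT at h
    rw [norm_sub_rev] at h
    exact ((hlt r).2 (h.trans_le (by rw [abs_sub_comm]; exact le_abs_self _))).ne hr0
  -- A null relation of `r` and `o` makes `p` or `q` causally related to `o`; since the form has no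
  -- zero on the connected set, all of `U` is timelike related to `o`.
  have hneg : ∀ v ∈ U, minkForm d (v - o) (v - o) < 0 := by
    have hone : minkForm d (p - o) (p - o) ≤ 0 ∨ minkForm d (q - o) (q - o) ≤ 0 := by
      rcases le_abs'.1 ((hle r).1 hr0.le) with h | h
      · have hro : CausalLE r o := by
          unfold CausalLE
          rw [norm_sub_rev]
          linarith
        have h3 : ‖o.2 - p.2‖ ≤ o.1 - p.1 := hpr.trans hro
        refine Or.inl ((hle p).2 ?_)
        rw [norm_sub_rev, abs_sub_comm]
        exact h3.trans (le_abs_self _)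
      · have hor : CausalLE o r := h
        have h3 : ‖q.2 - o.2‖ ≤ q.1 - o.1 := hor.trans hrq
        exact Or.inr ((hle q).2 (h3.trans (le_abs_self _)))
    intro v hv
    by_contra! hpos
    rcases hone with h | h
    · obtain ⟨y, hy, hy0⟩ := hU.intermediate_value hp hv hcB.continuousOn ⟨h, hpos⟩
      exact hB y hy hy0
    · obtain ⟨y, hy, hy0⟩ := hU.intermediate_value hq hv hcB.continuousOn ⟨h, hpos⟩
      exact hB y hy hy0
  have htime : ∀ v ∈ U, v.1 - o.1 ≠ 0 := fun v hv h0 ↦ by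
    have := (hlt v).1 (hneg v hv)
    rw [h0, abs_zero] at this
    exact (norm_nonneg _).not_gt this
  have hp' := (hlt p).1 (hneg p hp)
  have hq' := (hlt q).1 (hneg q hq)
  -- If `p` were after `o`, or `q` before `o`, then `r` would be timelike related to `o`. So the
  -- time difference to `o` changes sign on `U`, although it vanishes nowhere there.
  have hpo : p.1 - o.1 ≤ 0 := by
    by_contra! h
    rw [abs_of_pos h] at hp'
    have h2 : ChronLT o p := hp'
    exact hnull1 (h2.trans_causalLE hpr)
  have hqo : 0 ≤ q.1 - o.1 := by
    by_contra! h
    rw [abs_of_neg h, norm_sub_rev] at hq'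
    have h2 : ChronLT q o := by unfold ChronLT; linarith
    exact hnull2 (hrq.trans_chronLT h2)
  obtain ⟨v, hv, hv0⟩ := hU.intermediate_value hp hq
    (f := fun v : Mink d ↦ v.1 - o.1) (by fun_prop) ⟨hpo, hqo⟩
  exact htime v hv hv0

/-- The denominator of a transition map does not vanish between points of a connected set on which
it does not vanish. -/
theorem ne_zero_of_between {U : Set (Mink d)} (hU : IsPreconnected U) {α γ : ℝ} {ζ : Mink d}
    (hζ : minkForm d ζ ζ = α * γ)
    (hQ : ∀ v ∈ U, α * minkForm d v v + γ - 2 * minkForm d ζ v ≠ 0) {p q r : Mink d} (hp : p ∈ U)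
    (hq : q ∈ U) (hpr : CausalLE p r) (hrq : CausalLE r q) :
    α * minkForm d r r + γ - 2 * minkForm d ζ r ≠ 0 := by
  -- For `α = 0` the vector `ζ` is null and the denominator is affine and monotone for the causal
  -- order. Otherwise it is `α` times the quadratic form centred at `α⁻¹ • ζ`.
  rcases eq_or_ne α 0 with rfl | hα
  · intro hr
    have sign : ∀ F : Mink d → ℝ, Continuous F → (∀ v ∈ U, F v ≠ 0) → F p ≤ 0 → 0 ≤ F q →
        False := by
      intro F hF hF0 h1 h2
      obtain ⟨v, hv, hv0⟩ := hU.intermediate_value hp hq hF.continuousOn ⟨h1, h2⟩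
      exact hF0 v hv hv0
    have hcQ : Continuous fun v : Mink d ↦ γ - 2 * minkForm d ζ v := by fun_prop
    simp only [zero_mul, zero_add] at *
    have e1 : minkForm d ζ (r - p) = minkForm d ζ r - minkForm d ζ p := map_sub _ _ _
    have e2 : minkForm d ζ (q - r) = minkForm d ζ q - minkForm d ζ r := map_sub _ _ _
    rcases le_total 0 ζ.1 with h0 | h0
    · have h1 := minkForm_nonpos_of_null hζ h0 (w := r - p) hpr
      have h2 := minkForm_nonpos_of_null hζ h0 (w := q - r) hrq
      exact sign _ hcQ hQ (by linarith) (by linarith)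
    · have hζ' : minkForm d (-ζ) (-ζ) = 0 := by simpa using hζ
      have h1 := minkForm_nonpos_of_null hζ' (by simpa using h0) (w := r - p) hpr
      have h2 := minkForm_nonpos_of_null hζ' (by simpa using h0) (w := q - r) hrq
      rw [map_neg, neg_apply] at h1 h2
      exact sign (fun v ↦ -(γ - 2 * minkForm d ζ v)) hcQ.neg (fun v hv ↦ neg_ne_zero.2 (hQ v hv))
        (by linarith) (by linarith)
  · obtain ⟨o, ho⟩ : ∃ o, o = α⁻¹ • ζ := ⟨_, rfl⟩
    have key : ∀ v, α * minkForm d v v + γ - 2 * minkForm d ζ v =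
        α * minkForm d (v - o) (v - o) := fun v ↦ by
      simp only [ho, map_sub, sub_apply, map_smul, smul_apply, smul_eq_mul, minkForm_symm v ζ, hζ]
      field_simp
      ring
    rw [key]
    refine mul_ne_zero hα (form_sub_ne_zero_of_between hU (fun v hv h0 ↦ hQ v hv ?_) hp hq hpr hrq)
    rw [key, h0, mul_zero]

theorem convex_between (p q : Mink d) : Convex ℝ {x | CausalLE p x ∧ CausalLE x q} := by
  rintro x ⟨hx1, hx2⟩ y ⟨hy1, hy2⟩ s t hs ht hst
  have e1 : s • x + t • y - p = s • (x - p) + t • (y - p) := by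
    have : p = (s + t) • p := by rw [hst, one_smul]
    nth_rewrite 1 [this]
    module
  have e2 : q - (s • x + t • y) = s • (q - x) + t • (q - y) := by
    have : q = (s + t) • q := by rw [hst, one_smul]
    nth_rewrite 1 [this]
    module
  have key : ∀ u v : Mink d, ‖u.2‖ ≤ u.1 → ‖v.2‖ ≤ v.1 →
      ‖(s • u + t • v).2‖ ≤ (s • u + t • v).1 := fun u v hu hv ↦ by
    simp only [Prod.snd_add, Prod.smul_snd, Prod.fst_add, Prod.smul_fst, smul_eq_mul]
    refine (norm_add_le _ _).trans ?_
    rw [norm_smul, norm_smul, Real.norm_of_nonneg hs, Real.norm_of_nonneg ht]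
    gcongr
  constructor
  · change ‖(s • x + t • y - p).2‖ ≤ (s • x + t • y - p).1
    rw [e1]
    exact key _ _ hx1 hy1
  · change ‖(q - (s • x + t • y)).2‖ ≤ (q - (s • x + t • y)).1
    rw [e2]
    exact key _ _ hx2 hy2

theorem convex_chronLT : Convex ℝ {z : Mink d × Mink d | ChronLT z.1 z.2} := by
  refine convex_iff_forall_pos.2 ?_
  rintro ⟨x, x'⟩ hx ⟨y, y'⟩ hy s t hs ht hst
  have e : (s • x' + t • y') - (s • x + t • y) = s • (x' - x) + t • (y' - y) := by module
  change ‖((s • x' + t • y') - (s • x + t • y)).2‖ < ((s • x' + t • y') - (s • x + t • y)).1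
  rw [e]
  simp only [Prod.snd_add, Prod.smul_snd, Prod.fst_add, Prod.smul_fst, smul_eq_mul]
  refine (norm_add_le _ _).trans_lt ?_
  rw [norm_smul, norm_smul, Real.norm_of_nonneg hs.le, Real.norm_of_nonneg ht.le]
  exact add_lt_add (mul_lt_mul_of_pos_left hx hs) (mul_lt_mul_of_pos_left hy ht)

theorem exists_mem_chronLT {U : Set (Mink d)} (hU : IsOpen U) {p : Mink d} (hp : p ∈ U) :
    ∃ q ∈ U, ChronLT p q := by
  have h1 : Tendsto (fun ε : ℝ ↦ p + ((ε, 0) : Mink d)) (𝓝[>] 0) (𝓝 p) := by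
    have : Continuous fun ε : ℝ ↦ p + ((ε, 0) : Mink d) := by fun_prop
    simpa using (this.tendsto' 0 p (by ext <;> simp)).mono_left nhdsWithin_le_nhds
  obtain ⟨ε, hε, h0⟩ := ((h1.eventually (hU.mem_nhds hp)).and self_mem_nhdsWithin).exists
  exact ⟨_, hε, chronLT_add_vertical p h0⟩

theorem exists_chronLT_mem {U : Set (Mink d)} (hU : IsOpen U) {p : Mink d} (hp : p ∈ U) :
    ∃ q ∈ U, ChronLT q p := by
  have h1 : Tendsto (fun ε : ℝ ↦ p - ((ε, 0) : Mink d)) (𝓝[>] 0) (𝓝 p) := by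
    have : Continuous fun ε : ℝ ↦ p - ((ε, 0) : Mink d) := by fun_prop
    simpa using (this.tendsto' 0 p (by ext <;> simp)).mono_left nhdsWithin_le_nhds
  obtain ⟨ε, hε, h0⟩ := ((h1.eventually (hU.mem_nhds hp)).and self_mem_nhdsWithin).exists
  exact ⟨_, hε, chronLT_sub_vertical p h0⟩

/-- Order convexity passes through conformal transition maps. -/
theorem isOrderConvex_of_transition {U U₀ : Set (Mink d)} (hU : IsOpen U) (hconn : IsPreconnected U)
    (hU₀ : IsOrderConvex U₀) (B : AmbientIsometry d)
    (hQ : ∀ v ∈ U, (B.toLinearEquiv (minkLift v)).1 ≠ 0)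
    (hT : ∀ v, (B.toLinearEquiv (minkLift v)).1 ≠ 0 → (v ∈ U ↔
      (B.toLinearEquiv (minkLift v)).1⁻¹ • (B.toLinearEquiv (minkLift v)).2.2 ∈ U₀)) :
    IsOrderConvex U := by
  set Q : Mink d → ℝ := fun v ↦ (B.toLinearEquiv (minkLift v)).1 with hQdef
  set T : Mink d → Mink d := fun v ↦ (Q v)⁻¹ • (B.toLinearEquiv (minkLift v)).2.2 with hTdef
  have hcont : Continuous fun v : Mink d ↦ B.toLinearEquiv (minkLift v) :=
    B.continuous.comp continuous_minkLift
  have hQc : Continuous Q := continuous_fst.comp hcont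
  -- Pairing with the preimage `z` of the point at infinity expresses the denominator `Q`, which
  -- thus has the form treated in `ne_zero_of_between`.
  obtain ⟨z, hz⟩ : ∃ z, z = B.toLinearEquiv.symm ((0, 1, 0) : Ambient d) := ⟨_, rfl⟩
  have hzz : ambientForm d z z = 0 := by
    rw [hz, B.form_symm_left, LinearEquiv.apply_symm_apply]
    simp [ambientForm_apply]
  have hQz : ∀ v, Q v = z.1 * minkForm d v v + z.2.1 - 2 * minkForm d z.2.2 v := fun v ↦ by
    have h1 : Q v = -2 * ambientForm d z (minkLift v) := by
      rw [hz, B.form_symm_left]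
      exact fst_eq_form _
    rw [h1, ambientForm_apply, minkLift]
    ring
  have hζ : minkForm d z.2.2 z.2.2 = z.1 * z.2.1 := by
    rw [ambientForm_apply] at hzz
    linarith
  have hbetween : ∀ p ∈ U, ∀ q ∈ U, ∀ r, CausalLE p r → CausalLE r q → Q r ≠ 0 := by
    intro p hp q hq r hpr hrq
    rw [hQz]
    exact ne_zero_of_between hconn hζ (fun v hv ↦ by rw [← hQz]; exact hQ v hv) hp hq hpr hrq
  -- Conformality for pairs of points, not only infinitesimally: timelike separation survives
  -- wherever `Q x * Q y` is positive.
  have hform : ∀ x y, Q x ≠ 0 → Q y ≠ 0 → minkForm d (T y - T x) (T y - T x) =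
      (Q x * Q y)⁻¹ * minkForm d (y - x) (y - x) := fun x y hx hy ↦ by
    have h1 : ∀ v, Q v ≠ 0 → minkLift (T v) = (Q v)⁻¹ • B.toLinearEquiv (minkLift v) := fun v hv ↦
      minkLift_of_isotropic ((B.isometry' _ _).trans (minkLift_isotropic v)) hv
    have h2 := ambientForm_minkLift (T y) (T x)
    rw [h1 x hx, h1 y hy, map_smul, map_smul, LinearMap.smul_apply, B.isometry',
      ambientForm_minkLift, smul_eq_mul, smul_eq_mul] at h2
    rw [mul_inv]
    linarith
  intro p hp q hq r hpr hrq
  -- The ends are moved apart within `U` to make their relations to `r` strict.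
  obtain ⟨p', hp', hpp'⟩ : ∃ p' ∈ U, ChronLT p' p := exists_chronLT_mem hU hp
  obtain ⟨q', hq', hqq'⟩ : ∃ q' ∈ U, ChronLT q q' := exists_mem_chronLT hU hq
  have hp'r : ChronLT p' r := hpp'.trans_causalLE hpr
  have hrq' : ChronLT r q' := hrq.trans_chronLT hqq'
  set K : Set (Mink d) := {x | CausalLE p' x ∧ CausalLE x q'} with hK
  have hKconv : Convex ℝ K := convex_between p' q'
  have hQK : ∀ x ∈ K, Q x ≠ 0 := fun x hx ↦ hbetween p' hp' q' hq' x hx.1 hx.2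
  have hQpos : ∀ x ∈ K, ∀ y ∈ K, 0 < Q x * Q y := by
    intro x hx y hy
    by_contra! h
    rcases mul_nonpos_iff.1 h with ⟨h1, h2⟩ | ⟨h1, h2⟩
    · obtain ⟨v, hv, hv0⟩ := hKconv.isPreconnected.intermediate_value hy hx hQc.continuousOn ⟨h2, h1⟩
      exact hQK v hv hv0
    · obtain ⟨v, hv, hv0⟩ := hKconv.isPreconnected.intermediate_value hx hy hQc.continuousOn ⟨h1, h2⟩
      exact hQK v hv hv0
  have hchron : ∀ x ∈ K, ∀ y ∈ K, ChronLT x y → ‖(T y).2 - (T x).2‖ < |(T y).1 - (T x).1| := by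
    intro x hx y hy hxy
    refine minkForm_self_neg_iff (v := T y - T x) |>.1 ?_
    rw [hform x y (hQK x hx) (hQK y hy)]
    exact mul_neg_of_pos_of_neg (inv_pos.2 (hQpos x hx y hy))
      (minkForm_self_neg_iff (v := y - x) |>.2 (lt_of_lt_of_le hxy (le_abs_self _)))
  have hTc : ContinuousOn T K := hQc.continuousOn.inv₀ hQK |>.smul
    (continuous_snd.comp (continuous_snd.comp hcont)).continuousOn
  -- The chronologically ordered pairs of the diamond form a convex set, on which the time
  -- difference of the images never vanishes. So the transition map preserves or reverses the order
  -- on the whole diamond.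
  set D : Set (Mink d × Mink d) := (K ×ˢ K) ∩ {z | ChronLT z.1 z.2} with hD
  have hDconv : Convex ℝ D := (hKconv.prod hKconv).inter convex_chronLT
  have hsc : ContinuousOn (fun z : Mink d × Mink d ↦ (T z.2).1 - (T z.1).1) D := by
    have h1 : ContinuousOn (fun z : Mink d × Mink d ↦ T z.1) D :=
      hTc.comp continuous_fst.continuousOn fun z hz ↦ hz.1.1
    have h2 : ContinuousOn (fun z : Mink d × Mink d ↦ T z.2) D :=
      hTc.comp continuous_snd.continuousOn fun z hz ↦ hz.1.2
    exact (continuous_fst.comp_continuousOn h2).sub (continuous_fst.comp_continuousOn h1)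
  have hs0 : ∀ z ∈ D, (T z.2).1 - (T z.1).1 ≠ 0 := fun z hz h0 ↦ by
    have := hchron z.1 hz.1.1 z.2 hz.1.2 hz.2
    rw [h0, abs_zero] at this
    exact (norm_nonneg _).not_gt this
  have hsign : ∀ z ∈ D, ∀ w ∈ D, (T z.2).1 - (T z.1).1 ≤ 0 → 0 ≤ (T w.2).1 - (T w.1).1 → False := by
    intro z hz w hw h1 h2
    obtain ⟨v, hv, hv0⟩ := hDconv.isPreconnected.intermediate_value hz hw hsc ⟨h1, h2⟩
    exact hs0 v hv hv0
  have hrK : r ∈ K := ⟨hp'r.le, hrq'.le⟩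
  have hpK : p' ∈ K := ⟨CausalLE.refl _, (hp'r.trans_causalLE hrq'.le).le⟩
  have hqK : q' ∈ K := ⟨(hp'r.trans_causalLE hrq'.le).le, CausalLE.refl _⟩
  have h1D : (p', r) ∈ D := ⟨⟨hpK, hrK⟩, hp'r⟩
  have h2D : (r, q') ∈ D := ⟨⟨hrK, hqK⟩, hrq'⟩
  have hTp := (hT p' (hQK p' hpK)).1 hp'
  have hTq := (hT q' (hQK q' hqK)).1 hq'
  refine (hT r (hQK r hrK)).2 ?_
  have c1 := hchron p' hpK r hrK hp'r
  have c2 := hchron r hrK q' hqK hrq'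
  rcases le_total 0 ((T r).1 - (T p').1) with h | h
  · have h' : 0 ≤ (T q').1 - (T r).1 := by
      by_contra! h'
      exact hsign _ h2D _ h1D h'.le h
    rw [abs_of_nonneg h] at c1
    rw [abs_of_nonneg h'] at c2
    exact hU₀ (T p') hTp (T q') hTq (T r) c1.le c2.le
  · have h' : (T q').1 - (T r).1 ≤ 0 := by
      by_contra! h'
      exact hsign _ h1D _ h2D h h'.le
    rw [abs_of_nonpos h, neg_sub, norm_sub_rev] at c1
    rw [abs_of_nonpos h', neg_sub, norm_sub_rev] at c2
    exact hU₀ (T q') hTq (T p') hTp (T r) c2.le c1.le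

end Transition

/-! ### Supporting lightcones and the final equivalence -/

section DualConvexity
variable {d : ℕ} {Ω : Set (Ein d)} {A : AmbientIsometry d}

/-- A causally convex domain is order convex in every affine chart that contains it. -/
theorem isOrderConvex_preimage_affineChart (hopen : IsOpen Ω) (hconn : IsConnected Ω)
    (hcc : IsCausallyConvexDomain Ω) (h : Ω ⊆ range (affineChart A)) :
    IsOrderConvex (affineChart A ⁻¹' Ω) := by
  obtain ⟨A₀, hA₀, hconv⟩ := hcc
  have hU₀ := hconv.isOrderConvex (hopen.preimage (continuous_affineChart A₀))
  refine isOrderConvex_of_transition (hopen.preimage (continuous_affineChart A))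
    (isConnected_preimage_affineChart hconn h).isPreconnected hU₀ (A.trans A₀.symm)
    (fun v hv ↦ ?_) fun v hv ↦ ?_
  · exact (mk_mem_range_affineChart A₀).1 (hA₀ hv)
  · have : affineChart A₀ ((A₀.toLinearEquiv.symm (A.toLinearEquiv (minkLift v))).1⁻¹ •
        (A₀.toLinearEquiv.symm (A.toLinearEquiv (minkLift v))).2.2) = affineChart A v :=
      affineChart_coord_mk A₀ hv
    rw [mem_preimage, mem_preimage, ← this]
    rfl

/-! ### Dual convexity -/

/-- A nonzero null vector is orthogonal to its own multiples, one of which has time component `σ`.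
For `ξ = 0` any unit vector serves, and there is one because `1 ≤ d`. -/
theorem exists_null_orthogonal (hd : 1 ≤ d) {ξ : Mink d} (hξ : minkForm d ξ ξ = 0) {σ : ℝ}
    (hσ : |σ| = 1) : ∃ e : EuclideanSpace ℝ (Fin d), ‖e‖ = 1 ∧ minkForm d ξ (σ, e) = 0 := by
  rw [minkForm_self, sub_eq_zero, sq_eq_sq_iff_abs_eq_abs, abs_norm] at hξ
  rcases eq_or_ne ξ.1 0 with h0 | h0
  · refine ⟨EuclideanSpace.single ⟨0, hd⟩ 1, by simp, ?_⟩
    rw [h0, abs_zero, norm_eq_zero] at hξ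
    rw [minkForm_apply, h0, hξ, zero_mul, inner_zero_left, neg_zero, add_zero]
  · refine ⟨(σ * ξ.1⁻¹) • ξ.2, ?_, ?_⟩
    · rw [norm_smul, hξ, norm_mul, norm_inv, Real.norm_eq_abs, Real.norm_eq_abs, hσ, one_mul,
        inv_mul_cancel₀ (abs_ne_zero.2 h0)]
    · rw [minkForm_apply, inner_smul_right, real_inner_self_eq_norm_sq, hξ, sq_abs]
      field_simp
      ring

/-- If a hyperplane section of the isotropic cone contains a point, then it contains a null line
through this point in any given time direction. -/
theorem exists_null_line (hd : 1 ≤ d) {z : Ambient d} (hz : ambientForm d z z = 0) {p : Mink d}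
    (hp : ambientForm d z (minkLift p) = 0) {σ : ℝ} (hσ : |σ| = 1) :
    ∃ e : EuclideanSpace ℝ (Fin d), ‖e‖ = 1 ∧
      ∀ τ : ℝ, ambientForm d z (minkLift (p + τ • ((σ, e) : Mink d))) = 0 := by
  rw [ambientForm_apply] at hz hp
  simp only [minkLift, mul_one] at hp
  -- Up to sign this vector is the gradient at `p` of the pairing with `z` along the section; it is
  -- null because `z` is isotropic. Along a null direction orthogonal to it, neither the linear nor
  -- the quadratic term changes the pairing.
  have hξ : minkForm d (z.1 • p - z.2.2) (z.1 • p - z.2.2) = 0 := by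
    simp only [map_sub, map_smul, sub_apply, smul_apply, smul_eq_mul, minkForm_symm p z.2.2]
    linear_combination hz - 2 * z.1 * hp
  obtain ⟨e, he, h0⟩ := exists_null_orthogonal hd hξ hσ
  refine ⟨e, he, fun τ ↦ ?_⟩
  have hnull : minkForm d ((σ, e) : Mink d) (σ, e) = 0 := by
    rw [minkForm_self, he, ← sq_abs σ, hσ, sub_self]
  generalize ((σ, e) : Mink d) = w at h0 hnull
  rw [ambientForm_apply]
  simp only [map_sub, map_smul, sub_apply, smul_apply, smul_eq_mul] at h0
  simp only [minkLift, mul_one, map_add, add_apply, map_smul, smul_apply, smul_eq_mul, hnull,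
    minkForm_symm w p]
  linear_combination hp - τ * h0

/-- If a past directed null ray that starts at the upper boundary graph misses a slab, then it runs
in this graph and leaves the slab over the boundary. -/
theorem exists_frontier_of_ray {V : Set (EuclideanSpace ℝ (Fin d))}
    {a b : EuclideanSpace ℝ (Fin d) → ℝ} (hV : IsOpen V) (hVb : Bornology.IsBounded V)
    (ha : LipschitzOnWith 1 a (closure V)) (hb : LipschitzOnWith 1 b (closure V))
    (hab : ∀ x ∈ V, a x < b x) (heq : ∀ x ∈ frontier V, a x = b x)
    {x e : EuclideanSpace ℝ (Fin d)} (hx : x ∈ V) (he : ‖e‖ = 1)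
    (hray : ∀ τ : ℝ, (b x - τ, x + τ • e) ∉ slab V a b) :
    ∃ y ∈ frontier V, ‖x - y‖ ≤ b x - b y := by
  obtain ⟨C, hC⟩ := hVb.exists_norm_le
  -- Points of `V` are at most `2 * C` apart.
  have hy : x + (2 * C + 1) • e ∉ V := fun h ↦ by
    have h1 := hC _ h
    have h2 := norm_sub_le (x + (2 * C + 1) • e) x
    have h3 := le_abs_self (2 * C + 1)
    rw [add_sub_cancel_left, norm_smul, he, mul_one, Real.norm_eq_abs] at h2
    linarith [hC x hx]
  obtain ⟨s, hs0, -, hsfr, hsV⟩ := exists_exit hV hx hy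
  have hC0 : 0 < 2 * C + 1 := by linarith [(norm_nonneg x).trans (hC x hx)]
  obtain ⟨R, hR, hR0⟩ : ∃ R, R = 2 * C + 1 ∧ 0 < R := ⟨_, rfl, hC0⟩
  rw [← hR] at hsfr hsV
  simp only [add_sub_cancel_left] at hsfr hsV
  refine ⟨_, hsfr, ?_⟩
  have hz : ∀ r ∈ Icc 0 s, x + r • R • e ∈ closure V := by
    intro r hr
    rcases hr.2.lt_or_eq with h | h
    · exact subset_closure (hsV r hr.1 h)
    · rw [h]
      exact frontier_subset_closure hsfr
  have hmap : ContinuousOn (fun r : ℝ ↦ x + r • R • e) (Icc 0 s) := by fun_prop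
  have hac : ContinuousOn (fun r : ℝ ↦ a (x + r • R • e)) (Icc 0 s) :=
    ha.continuousOn.comp hmap hz
  have hbc : ContinuousOn (fun r : ℝ ↦ b (x + r • R • e)) (Icc 0 s) :=
    hb.continuousOn.comp hmap hz
  have hhc : ContinuousOn (fun r : ℝ ↦ b x - r * R -
      (a (x + r • R • e) + b (x + r • R • e)) / 2) (Icc 0 s) :=
    ((continuousOn_const.sub (continuousOn_id.mul continuousOn_const))).sub
      ((hac.add hbc).div_const 2)
  have hn : ‖x - (x + s • R • e)‖ = s * R := by
    rw [sub_add_cancel_left, norm_neg, norm_smul, norm_smul, he, mul_one,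
      Real.norm_of_nonneg hs0.le, Real.norm_of_nonneg hR0.le]
  rw [hn]
  -- Otherwise the ray leaves below the common boundary value. It starts above the mean of `a` and
  -- `b`, so it crosses this mean before the exit, that is, inside the slab.
  by_contra! hlt
  have hends : (0 : ℝ) ∈ Icc (b x - s * R - (a (x + s • R • e) + b (x + s • R • e)) / 2)
      (b x - 0 * R - (a (x + (0 : ℝ) • R • e) + b (x + (0 : ℝ) • R • e)) / 2) := by
    rw [heq _ hsfr, zero_smul, add_zero]
    constructor
    · linarith
    · linarith [hab x hx]
  obtain ⟨r, hr, hr0⟩ := intermediate_value_Icc' hs0.le hhc hends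
  rcases hr.2.lt_or_eq with h | h
  · have h1 := hab _ (hsV r hr.1 h)
    refine hray (r * R) ?_
    rw [mul_smul]
    refine ⟨hsV r hr.1 h, ?_, ?_⟩ <;> dsimp only at hr0 ⊢ <;> linarith
  · rw [h] at hr0
    dsimp only at hr0
    rw [heq _ hsfr] at hr0
    linarith

variable {U : Set (Mink d)} {a b : EuclideanSpace ℝ (Fin d) → ℝ}

theorem IsBoundaryData.upper_mem_frontier (h : IsBoundaryData U a b) (hU : IsOpen U)
    {x : EuclideanSpace ℝ (Fin d)} (hx : x ∈ spaceProj U) : (b x, x) ∈ frontier U := by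
  rw [hU.frontier_eq]
  refine ⟨?_, fun hmem ↦ lt_irrefl _ (h.mem_iff.1 hmem).2.2⟩
  have h1 : MapsTo (fun t : ℝ ↦ ((t, x) : Mink d)) (Ioo (a x) (b x)) U := fun t ht ↦
    h.mem_iff.2 ⟨hx, ht.1, ht.2⟩
  have h2 := h1.closure (by fun_prop)
  rw [closure_Ioo (h.lt hx).ne] at h2
  exact h2 (right_mem_Icc.2 (h.lt hx).le)

theorem IsBoundaryData.lower_mem_frontier (h : IsBoundaryData U a b) (hU : IsOpen U)
    {x : EuclideanSpace ℝ (Fin d)} (hx : x ∈ spaceProj U) : (a x, x) ∈ frontier U := by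
  rw [hU.frontier_eq]
  refine ⟨?_, fun hmem ↦ lt_irrefl _ (h.mem_iff.1 hmem).2.1⟩
  have h1 : MapsTo (fun t : ℝ ↦ ((t, x) : Mink d)) (Ioo (a x) (b x)) U := fun t ht ↦
    h.mem_iff.2 ⟨hx, ht.1, ht.2⟩
  have h2 := h1.closure (by fun_prop)
  rw [closure_Ioo (h.lt hx).ne] at h2
  exact h2 (left_mem_Icc.2 (h.lt hx).le)

/-- If every boundary point lies on a hyperplane section of the isotropic cone that misses the
region, then the region contains every point spacelike to the boundary graph. -/
theorem IsBoundaryData.eq_spacelikeRegion_of_support (h : IsBoundaryData U a b) (hd : 1 ≤ d)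
    (hU : IsOpen U) (hb : Bornology.IsBounded U)
    (hsupp : ∀ p ∈ frontier U, ∃ z : Ambient d, ambientForm d z z = 0 ∧
      ambientForm d z (minkLift p) = 0 ∧ ∀ u ∈ U, ambientForm d z (minkLift u) ≠ 0) :
    U = spacelikeRegion U b := by
  refine Subset.antisymm h.subset_spacelikeRegion fun p hp ↦ ?_
  by_contra hpU
  have hV := isOpen_spaceProj hU
  have hVb : Bornology.IsBounded (spaceProj U) := hb.image_snd
  rcases le_or_gt (b p.2) p.1 with hle | hlt
  · obtain ⟨z, hz, hz0, hzU⟩ := hsupp _ (h.upper_mem_frontier hU hp.1)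
    obtain ⟨e, he, hline⟩ := exists_null_line hd hz hz0 (σ := -1) (by simp)
    -- The past half of the null line misses `U`, which yields a point of `Λ` causally before `(b
    -- p.2, p.2)`, hence before `p`. So `p` is not spacelike to `Λ`; points below the lower graph
    -- are excluded by time reversal.
    obtain ⟨y, hy, hxy⟩ := exists_frontier_of_ray hV hVb h.1 h.2.1 (fun _ ↦ h.lt) h.2.2.1 hp.1 he
      (fun τ hτ ↦ by
        rw [← h.eq_slab] at hτ
        refine hzU _ hτ ?_
        have := hline τ
        rwa [Prod.smul_mk, Prod.mk_add_mk, smul_eq_mul, mul_neg_one, ← sub_eq_add_neg] at this)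
    have h1 := (abs_lt.1 (hp.2 (b y, y) ⟨hy, rfl⟩)).2
    dsimp only at h1
    linarith
  · have hle : p.1 ≤ a p.2 := by
      by_contra! hlt'
      exact hpU (h.mem_iff.2 ⟨hp.1, hlt', hlt⟩)
    obtain ⟨z, hz, hz0, hzU⟩ := hsupp _ (h.lower_mem_frontier hU hp.1)
    obtain ⟨e, he, hline⟩ := exists_null_line hd hz hz0 (σ := 1) (by simp)
    obtain ⟨y, hy, hxy⟩ := exists_frontier_of_ray (a := -b) (b := -a) hV hVb h.2.1.neg h.1.neg
      (fun x hx ↦ neg_lt_neg (h.lt hx)) (fun x hx ↦ congrArg Neg.neg (h.2.2.1 x hx).symm) hp.1 he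
      (fun τ hτ ↦ by
        have h1 : ((a p.2 + τ, p.2 + τ • e) : Mink d) ∈ slab (spaceProj U) a b := by
          rw [← timeRev_mem_slab]
          convert hτ using 1
          simp [timeRev, sub_eq_add_neg, add_comm]
        rw [← h.eq_slab] at h1
        refine hzU _ h1 ?_
        have := hline τ
        rwa [Prod.smul_mk, Prod.mk_add_mk, smul_eq_mul, mul_one] at this)
    have h1 := (abs_lt.1 (hp.2 (b y, y) ⟨hy, rfl⟩)).1
    simp only [Pi.neg_apply] at hxy
    rw [h.2.2.1 y hy] at hxy
    dsimp only at h1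
    linarith

/-- A boundary point over `V` fails to be spacelike to some point of `Λ`, but is a limit of points
spacelike to it. A boundary point over `∂V` is on `Λ` and serves itself. -/
theorem IsBoundaryData.exists_null_of_frontier (h : IsBoundaryData U a b) (hU : IsOpen U)
    (heq : U = spacelikeRegion U b) {p : Mink d} (hp : p ∈ frontier U) :
    ∃ q ∈ boundaryGraph U b, minkForm d (p - q) (p - q) = 0 := by
  rw [hU.frontier_eq] at hp
  obtain ⟨hpcl, hpU⟩ := hp
  obtain ⟨h1, h2, h3⟩ := h.mem_closure hpcl
  by_cases hpV : p.2 ∈ spaceProj U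
  · obtain ⟨q, hq, hpq⟩ : ∃ q ∈ boundaryGraph U b, ‖p.2 - q.2‖ ≤ |p.1 - q.1| := by
      by_contra! hcon
      exact hpU (heq ▸ ⟨hpV, hcon⟩)
    have hcl : IsClosed {p : Mink d | |p.1 - q.1| ≤ ‖p.2 - q.2‖} :=
      isClosed_le (by fun_prop) (by fun_prop)
    have hle : |p.1 - q.1| ≤ ‖p.2 - q.2‖ :=
      closure_minimal (fun u hu ↦ ((h.subset_spacelikeRegion hu).2 q hq).le) hcl hpcl
    refine ⟨q, hq, ?_⟩
    rw [minkForm_self, Prod.fst_sub, Prod.snd_sub, le_antisymm hpq hle, sq_abs, sub_self]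
  · have hfr : p.2 ∈ frontier (spaceProj U) := by
      rw [(isOpen_spaceProj hU).frontier_eq]
      exact ⟨h1, hpV⟩
    refine ⟨p, ⟨hfr, le_antisymm h3 ?_⟩, by simp⟩
    rwa [← h.2.2.1 _ hfr]

/-- In the chart a lightcone is the zero set of the pairing with an isotropic vector, even if its
vertex is at infinity, so dual convexity provides the supports of
`IsBoundaryData.eq_spacelikeRegion_of_support`. Conversely the lightcones of points of `Λ` support,
as these points are spacelike to the domain. -/
theorem IsBoundaryData.isDuallyConvex_iff (hd : 1 ≤ d) (hopen : IsOpen Ω)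
    (hA : closure Ω ⊆ range (affineChart A)) (h : IsBoundaryData (affineChart A ⁻¹' Ω) a b) :
    IsDuallyConvex Ω ↔ affineChart A ⁻¹' Ω = spacelikeRegion (affineChart A ⁻¹' Ω) b := by
  have hU : IsOpen (affineChart A ⁻¹' Ω) := hopen.preimage (continuous_affineChart A)
  have hfr : ∀ p, affineChart A p ∈ frontier Ω ↔ p ∈ frontier (affineChart A ⁻¹' Ω) := fun p ↦ by
    rw [← (isOpenMap_affineChart A).preimage_frontier_eq_frontier_preimage
      (continuous_affineChart A) Ω, mem_preimage]
  constructor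
  · intro hdual
    refine h.eq_spacelikeRegion_of_support hd hU (isBounded_preimage_affineChart hA) fun p hp ↦ ?_
    obtain ⟨y, hy, hyΩ⟩ := hdual _ ((hfr p).2 hp)
    obtain ⟨v, hv, hv0, rfl⟩ := y.exists_rep
    refine ⟨A.toLinearEquiv.symm v, (A.symm.isometry' v v).trans hv0,
      (affineChart_mem_lightcone_mk A).1 hy, fun u hu h0 ↦ ?_⟩
    exact eq_empty_iff_forall_notMem.1 hyΩ _ ⟨(affineChart_mem_lightcone_mk A).2 h0, hu⟩
  · intro heq x hx
    obtain ⟨p, rfl⟩ := hA (frontier_subset_closure hx)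
    obtain ⟨q, hq, hpq⟩ := h.exists_null_of_frontier hU heq ((hfr p).1 hx)
    refine ⟨affineChart A q, (affineChart_mem_lightcone A p q).2 hpq, ?_⟩
    refine eq_empty_iff_forall_notMem.2 ?_
    rintro y ⟨hy, hyΩ⟩
    obtain ⟨u, rfl⟩ := hA (subset_closure hyΩ)
    have hu : u ∈ affineChart A ⁻¹' Ω := hyΩ
    exact (minkForm_pos_iff.2 ((h.subset_spacelikeRegion hu).2 q hq)).ne'
      ((affineChart_mem_lightcone A u q).1 hy)

end DualConvexity

end

theorem mainTheorem5 (d : ℕ) (hd : 1 ≤ d) (Ω : Set (Ein d))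
    (hopen : IsOpen Ω) (hconn : IsConnected Ω)
    (hproper : IsProperDomain Ω) (hcc : IsCausallyConvexDomain Ω) :
    (∃ A : AmbientIsometry d, closure Ω ⊆ Set.range (affineChart A)) ∧
    ∀ A : AmbientIsometry d, closure Ω ⊆ Set.range (affineChart A) →
      ∃ fLow fUp : EuclideanSpace ℝ (Fin d) → ℝ,
        IsBoundaryData (affineChart A ⁻¹' Ω) fLow fUp ∧
        List.TFAE [
          IsDuallyConvex Ω,
          IsGloballyHyperbolicMaximal (minkowski d) (affineChart A ⁻¹' Ω),
          IsComponentOf (affineChart A ⁻¹' Ω)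
            (coneUnion A (boundaryGraph (affineChart A ⁻¹' Ω) fUp))ᶜ] := by
  refine ⟨?_, fun A hA ↦ ?_⟩
  · obtain ⟨x, hx⟩ := hproper
    obtain ⟨A, hA⟩ := exists_affineChart x
    exact ⟨A, hA ▸ fun y hy hyx ↦ eq_empty_iff_forall_notMem.1 hx y ⟨hy, hyx⟩⟩
  · have hA' : Ω ⊆ range (affineChart A) := subset_closure.trans hA
    have hU : IsOpen (affineChart A ⁻¹' Ω) := hopen.preimage (continuous_affineChart A)
    have hUc := isConnected_preimage_affineChart hconn hA'
    have hUb := isBounded_preimage_affineChart hA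
    have hconv := isOrderConvex_preimage_affineChart hopen hconn hcc hA'
    obtain ⟨a, b, h⟩ := exists_boundaryData hU hconv hUb
    refine ⟨a, b, h, ?_⟩
    rw [coneUnion_compl]
    tfae_have 1 ↔ 2 :=
      (h.isDuallyConvex_iff hd hopen hA).trans (h.maximal_iff hd hU hUc hUb hconv).symm
    tfae_have 2 ↔ 3 :=
      (h.maximal_iff hd hU hUc hUb hconv).trans (h.isComponentOf_iff hUc).symm
    tfae_finish
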